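/- Let $E$ be a Euclidean space of finite dimension $n$, with closed unit ball $\mathbf B$. Let $\mathcal K(E)$ be the set of non-empty compact convex subsets of $E$ with the Hausdorff metric, and write $V$ for the mixed volume of $n$ convex bodies, where $K[i]$ means that $K$ is repeated $i$ times. For $0\le i\le n$ let $\mathcal P_i$ be the cone of functionals $\phi_\mu(L)=\int_{\mathcal K(E)^{n-i}}V(L[i],K_1,\dots,K_{n-i})\,d\mu(K_1,\dots,K_{n-i})$ on $\mathcal K(E)$, where $\mu$ is a positive Radon measure on $\mathcal K(E)^{n-i}$ with $\int V(\mathbf B[i],K_1,\dots,K_{n-i})\,d\mu<\infty$. For $\phi\in\mathcal P_i$ put $\phi(L_1,\dots,L_i)=\frac1{i!}\frac{\partial^i}{\partial t_1\cdots\partial t_i}\big|_{t=0^+}\phi(t_1L_1+\dots+t_iL_i)$, and call $\phi$ strictly $\mathcal P$-positive if there is $\varepsilon>0$ with $\phi(L_1,\dots,L_i)\ge\varepsilon V(\mathbf B[n-i],L_1,\dots,L_i)$ for all $L_1,\dots,L_i\in\mathcal K(E)$. The group $\mathrm{GL}(E)$ acts by $(g\cdot\phi)(K)=\phi(g^{-1}K)$.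 For $0\le k\le n$, $\psi=\phi_\mu\in\mathcal P_{n-k}$ and $\phi=\phi_\nu\in\mathcal P_k$, the convolution $\psi*\phi$ is the number $$\psi*\phi=\frac{k!\,(n-k)!}{n!}\int\!\!\int V(A_1,\dots,A_k,B_1,\dots,B_{n-k})\,d\nu(B)\,d\mu(A).$$ Theorem. Let $0\le k\le n$. Strictly $\mathcal P$-positive $\psi\in\mathcal P_{n-k}$ and $\phi\in\mathcal P_k$ exist. For all such $\psi,\phi$ and all $g\in\mathrm{GL}(E)$ the limit $$d_k(g)=\lim_{p\to\infty}\big((g^p\cdot\psi)*\phi\big)^{1/p},$$ the $k$-th dynamical degree of $g$, exists in $\mathbb R$ and does not depend on the choice of $\psi$ and $\phi$. The function $d_k:\mathrm{GL}(E)\to\mathbb R$ is continuous: if $g_l\to g$ in $\mathrm{GL}(E)$, then $d_k(g_l)\to d_k(g)$. -/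

import Mathlib

open MeasureTheory Filter Topology Module
open scoped NNReal

noncomputable section

namespace ConvexValuation

variable {E : Type*} [NormedAddCommGroup E] [InnerProductSpace ℝ E]

/-- The space of convex bodies, a metric space for the Hausdorff distance, carries its Borel
sigma-algebra. -/
instance instMeasurableSpaceConvexBody : MeasurableSpace (ConvexBody E) := borel _

instance instBorelSpaceConvexBody : BorelSpace (ConvexBody E) := ⟨rfl⟩

/-- The closed unit ball of `E`. -/
def unitBall (E : Type*) [NormedAddCommGroup E] [InnerProductSpace ℝ E]
    [FiniteDimensional ℝ E] : ConvexBody E where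
  carrier := Metric.closedBall 0 1
  convex' := convex_closedBall 0 1
  isCompact' := isCompact_closedBall 0 1
  nonempty' := ⟨0, by simp⟩

/-- The image `A(K)` of a convex body under a linear map. -/
def image (A : E →L[ℝ] E) (K : ConvexBody E) : ConvexBody E where
  carrier := A '' (K : Set E)
  convex' := K.convex.linear_image A.toLinearMap
  isCompact' := K.isCompact.image A.continuous
  nonempty' := K.nonempty.image A

/-- `P` is the polynomial `t ↦ F (∑ a, t a • L a)`, where `t a ≥ 0`. -/
def IsMinkowskiPolynomial {ι : Type*} [Fintype ι] (F : ConvexBody E → ℝ) (L : ι → ConvexBody E)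
    (P : MvPolynomial ι ℝ) : Prop :=
  ∀ t : ι → ℝ≥0, MvPolynomial.eval (fun a => (t a : ℝ)) P = F (∑ a, t a • L a)

open Classical in
/-- The polarization `F (L₁, …, L_i)` of a functional `F` of convex bodies which is polynomial
along Minkowski combinations: `1 / i!` times the mixed derivative `∂^i / ∂t₁ ⋯ ∂t_i` at `0` of
`t ↦ F (t₁ L₁ + ⋯ + t_i L_i)`, that is, `1 / i!` times the coefficient of the monomial
`t₁ ⋯ t_i` of this polynomial. -/
def polarization {ι : Type*} [Fintype ι] (F : ConvexBody E → ℝ) (L : ι → ConvexBody E) : ℝ :=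
  if h : ∃ P, IsMinkowskiPolynomial F L P then
    h.choose.coeff (Finsupp.equivFunOnFinite.symm fun _ => 1) / (Nat.factorial (Fintype.card ι) : ℝ)
  else 0

/-- The polynomial in the definition of the polarization is unique. -/
theorem polarization_eq {ι : Type*} [Fintype ι] {F : ConvexBody E → ℝ} {L : ι → ConvexBody E}
    {P : MvPolynomial ι ℝ} (hP : IsMinkowskiPolynomial F L P) :
    polarization F L =
      P.coeff (Finsupp.equivFunOnFinite.symm fun _ => 1) / (Nat.factorial (Fintype.card ι) : ℝ) := by
  have h : ∃ P, IsMinkowskiPolynomial F L P := ⟨P, hP⟩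
  have hPQ : h.choose = P := by
    refine MvPolynomial.funext_set (fun _ => Set.Ici (0 : ℝ))
      (fun _ => Set.Ici_infinite (0 : ℝ)) fun x hx => ?_
    have hx' : ∀ a, 0 ≤ x a := fun a => hx a (Set.mem_univ a)
    exact (h.choose_spec fun a => ⟨x a, hx' a⟩).trans (hP fun a => ⟨x a, hx' a⟩).symm
  rw [polarization, dif_pos h, hPQ]

/-- The action of the general linear group on functionals of convex bodies,
`(g · φ) (K) = φ (g⁻¹ K)`. -/
def act (g : (E →L[ℝ] E)ˣ) (φ : ConvexBody E → ℝ) : ConvexBody E → ℝ :=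
  fun K => φ (image (↑g⁻¹ : E →L[ℝ] E) K)

variable [FiniteDimensional ℝ E] [MeasurableSpace E] [BorelSpace E]

/-- The mixed volume of `n = dim E` convex bodies, indexed by a type `ι` with `n` elements: the
coefficient of `t₁ ⋯ t_n` in the polynomial `vol (t₁ K₁ + ⋯ + t_n K_n)` is `n! V(K₁, …, K_n)`. -/
def mixedVolume {ι : Type*} [Fintype ι] (K : ι → ConvexBody E) : ℝ :=
  polarization (fun M : ConvexBody E => (volume : Measure E).real M) K

/-- `φ = φ_μ` for the positive Radon measure `μ` on `(n - i)`-tuples of convex bodies: the integral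
of `V(B[i], K₁, …, K_{n-i})` is finite, where `B` is the unit ball, and
`φ (L) = ∫ V(L[i], K₁, …, K_{n-i}) dμ(K₁, …, K_{n-i})` for every convex body `L`. -/
structure Represents (i : ℕ) (μ : Measure (Fin (finrank ℝ E - i) → ConvexBody E))
    (φ : ConvexBody E → ℝ) : Prop where
  regular : μ.Regular
  integrable : Integrable (fun K => mixedVolume (Sum.elim (fun _ : Fin i => unitBall E) K)) μ
  eq_integral : ∀ L, φ L = ∫ K, mixedVolume (Sum.elim (fun _ : Fin i => L) K) ∂μ

/-- The cone `𝒫_i` of `𝒫`-positive valuations of degree `i`. -/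
def PCone (E : Type*) [NormedAddCommGroup E] [InnerProductSpace ℝ E] [FiniteDimensional ℝ E]
    [MeasurableSpace E] [BorelSpace E] (i : ℕ) : Set (ConvexBody E → ℝ) :=
  {φ | ∃ μ, Represents i μ φ}

/-- A valuation `φ ∈ 𝒫_i` is strictly `𝒫`-positive if for some `ε > 0` the inequality
`φ (L₁, …, L_i) ≥ ε V(B[n - i], L₁, …, L_i)` holds for all convex bodies. -/
def StrictlyPPositive (i : ℕ) (φ : ConvexBody E → ℝ) : Prop :=
  φ ∈ PCone E i ∧ ∃ ε : ℝ, 0 < ε ∧ ∀ L : Fin i → ConvexBody E,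
    ε * mixedVolume (Sum.elim (fun _ : Fin (finrank ℝ E - i) => unitBall E) L) ≤ polarization φ L

open Classical in
/-- The convolution of `φ = φ_μ ∈ 𝒫_i` and `ψ = φ_ν ∈ 𝒫_j`, where `i, j ≤ n ≤ i + j`:
`(φ * ψ) (D) = (i! j! / n!) ∬ V(D[i + j - n], A₁, …, A_{n-i}, B₁, …, B_{n-j}) dμ(A) dν(B)`.
The value depends on `φ` and `ψ` only, not on the representing measures. -/
def convolution (i j : ℕ) (φ ψ : ConvexBody E → ℝ) : ConvexBody E → ℝ := fun D =>
  if h : φ ∈ PCone E i ∧ ψ ∈ PCone E j then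
    ((Nat.factorial i : ℝ) * (Nat.factorial j : ℝ) / (Nat.factorial (finrank ℝ E) : ℝ)) *
      ∫ A, ∫ B, mixedVolume
        (Sum.elim (fun _ : Fin (i + j - finrank ℝ E) => D) (Sum.elim A B)) ∂h.2.choose ∂h.1.choose
  else 0

/-- The `k`-th degree `(g · ψ) * φ` of `g` with respect to `ψ ∈ 𝒫_{n-k}` and `φ ∈ 𝒫_k`. The
convolution has degree `0`, so it is a constant valuation; it is identified with its value. -/
def degree (k : ℕ) (ψ φ : ConvexBody E → ℝ) (g : (E →L[ℝ] E)ˣ) : ℝ :=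
  convolution (finrank ℝ E - k) k (act g ψ) φ (unitBall E)

/-- The sequence `((g^p · ψ) * φ)^(1/p)`, whose limit is the `k`-th dynamical degree of `g`. -/
def degreeRoot (k : ℕ) (ψ φ : ConvexBody E → ℝ) (g : (E →L[ℝ] E)ˣ) (p : ℕ) : ℝ :=
  degree k ψ φ (g ^ p) ^ (1 / (p : ℝ))

/-- The `k`-th dynamical degree of `g`, computed with `ψ ∈ 𝒫_{n-k}` and `φ ∈ 𝒫_k`. -/
def dynamicalDegree (k : ℕ) (ψ φ : ConvexBody E → ℝ) (g : (E →L[ℝ] E)ˣ) : ℝ :=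
  limUnder atTop (degreeRoot k ψ φ g)

end ConvexValuation

end

/-! The degrees of `g ^ p` are squeezed, up to constants independent of `p`, between multiples of a
norm of the `p`-th power of one fixed matrix. Gelfand's formula then gives the limit, and its
continuity is the continuity of the spectral radius.

The squeeze rests on a reverse Khovanskii–Teissier inequality, V(L, K) ≤ C V(L, B) V(B, K) for
complementary groups of bodies L and K and balls B (`exists_mixedVolume_le_mul`). Integrated against
a representing measure, it bounds the polarization of any element of the cone above by a multiple of
the mixed volume with balls; strict positivity is the matching lower bound. Applied to φ inside the
convolution and then to ψ, this makes (g · ψ) * φ comparable to V(g⁻¹B[n-k], B[k]), with constants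
independent of g (`exists_degree_comparable`). Replacing balls by cubes turns this number into a sum
of absolute determinants, comparable to the sum of the absolute minors of order n - k of g⁻¹
(`exists_mixedVolume_image_comparable`). By Cauchy–Binet these minors form a matrix multiplicative
in g⁻¹ (`minorMatrix_mul`), so the limit is its spectral radius, in which ψ and φ no longer appear.

The reverse inequality reduces to parallelotopes: a body with interior is comparable, up to
translation and a dimensional factor, to the parallelotope of a suitable inscribed simplex
(`exists_zonotope_comparable`). For parallelotopes mixed volumes are sums of absolute determinants,
and the inequality is a Laplace expansion.

The required theory of mixed volumes comes from an explicit transport. For a polytope with vertices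
among the p_j, the gradient of log Σ w_j exp⟨p_j, x⟩ takes values in the polytope, and Minkowski
combinations correspond to combinations of gradients. If the combination has interior, the gradient
map is injective and covers that interior, so its volume is the integral of a Hessian determinant.
Expanding this determinant gives a polynomial whose coefficients are integrals of nonnegative mixed
discriminants. This yields Minkowski's theorem and positivity; letting the weights of superfluous
vertices tend to zero, Fatou's lemma yields monotonicity. Density of polytopes and continuity of
volume extend everything to all convex bodies. -/

namespace ConvexValuation

/-! ### Cauchy–Binet and compound matrices. -/

section Algebra

/-- Expansion of an alternating map on linear combinations of a fixed family, in terms of the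
minors of the coefficient matrix. -/
theorem factorial_smul_alternatingMap_sum {R M N ι J : Type*} [CommRing R] [AddCommGroup M]
    [Module R M] [AddCommGroup N] [Module R N] [Fintype ι] [DecidableEq ι] [Fintype J]
    (ω : M [⋀^ι]→ₗ[R] N) (c : Matrix ι J R) (e : J → M) :
    (Nat.factorial (Fintype.card ι) : R) • ω (fun i => ∑ j, c i j • e j) =
      ∑ f : ι → J, (c.submatrix id f).det • ω (e ∘ f) := by
  classical
  have h1 : ω (fun i => ∑ j, c i j • e j) =
      ∑ f : ι → J, (∏ i, c i (f i)) • ω (e ∘ f) := by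
    have := ω.toMultilinearMap.map_sum (fun i j => c i j • e j)
    simp only [AlternatingMap.coe_multilinearMap] at this
    rw [this]
    refine Finset.sum_congr rfl fun f _ => ?_
    exact ω.toMultilinearMap.map_smul_univ (fun i => c i (f i)) (e ∘ f)
  -- Substituting f ∘ σ⁻¹ for f costs the sign of σ. Each permutation thus gives the same left side,
  -- and summing over σ assembles the Leibniz formula for the minor.
  have h2 : ∀ σ : Equiv.Perm ι, ω (fun i => ∑ j, c i j • e j) =
      ∑ f : ι → J, ((Equiv.Perm.sign σ : ℤ) : R) • (∏ i, c (σ i) (f i)) • ω (e ∘ f) := by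
    intro σ
    rw [h1, ← (Equiv.arrowCongr σ (Equiv.refl J)).sum_comp]
    refine Finset.sum_congr rfl fun f _ => ?_
    have h3 : (Equiv.arrowCongr σ (Equiv.refl J)) f = f ∘ σ.symm := rfl
    rw [h3, ← Function.comp_assoc, ω.map_perm]
    rw [← Equiv.prod_comp σ, smul_comm]
    simp only [Function.comp_apply, Equiv.symm_apply_apply, Equiv.Perm.sign_symm,
      Units.smul_def, Int.cast_smul_eq_zsmul]
  have h4 : ∑ _σ : Equiv.Perm ι, ω (fun i => ∑ j, c i j • e j) =
      (Nat.factorial (Fintype.card ι) : R) • ω (fun i => ∑ j, c i j • e j) := by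
    rw [Finset.sum_const, Finset.card_univ, Fintype.card_perm, Nat.cast_smul_eq_nsmul]
  rw [← h4, Finset.sum_congr rfl fun σ _ => h2 σ, Finset.sum_comm]
  refine Finset.sum_congr rfl fun f _ => ?_
  rw [Matrix.det_apply', Finset.sum_smul]
  refine Finset.sum_congr rfl fun σ _ => ?_
  simp [mul_smul]

/-- The Cauchy–Binet formula, as a sum over all index maps. -/
theorem factorial_mul_det_mul {R ι J : Type*} [CommRing R] [Fintype ι] [DecidableEq ι] [Fintype J]
    (A : Matrix ι J R) (B : Matrix J ι R) :
    (Nat.factorial (Fintype.card ι) : R) * (A * B).det =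
      ∑ f : ι → J, (A.submatrix id f).det * (B.submatrix f id).det := by
  have h := factorial_smul_alternatingMap_sum (Matrix.detRowAlternating (n := ι) (R := R)) A
    (fun j => B j)
  have h2 : (fun i => ∑ j, A i j • (fun j => B j) j) = A * B := by
    ext i k
    simp [Matrix.mul_apply]
  rw [h2] at h
  exact h

/-- The determinant of a weighted sum of rank one positive operators. -/
theorem factorial_mul_det_transpose_mul_diagonal_mul {R ι C : Type*} [CommRing R] [Fintype ι]
    [DecidableEq ι] [Fintype C] [DecidableEq C] (s : C → R) (Q : Matrix C ι R) :
    (Nat.factorial (Fintype.card ι) : R) * (Q.transpose * Matrix.diagonal s * Q).det =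
      ∑ f : ι → C, (∏ i, s (f i)) * (Q.submatrix f id).det ^ 2 := by
  rw [factorial_mul_det_mul]
  refine Finset.sum_congr rfl fun f _ => ?_
  have : (Q.transpose * Matrix.diagonal s).submatrix id f =
      (Q.submatrix f id).transpose * Matrix.diagonal (s ∘ f) := by
    ext i j
    simp [Matrix.mul_diagonal]
  rw [this, Matrix.det_mul, Matrix.det_transpose, Matrix.det_diagonal]
  simp only [Function.comp_apply]
  ring

/-- The matrix of all minors of order `card ι`, divided by `(card ι)!` so that it is
multiplicative. -/
noncomputable def minorMatrix {𝕜 J : Type*} [Field 𝕜] (ι : Type*) [Fintype ι] [DecidableEq ι]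
    (A : Matrix J J 𝕜) : Matrix (ι → J) (ι → J) 𝕜 :=
  Matrix.of fun f f' => (A.submatrix f f').det / (Nat.factorial (Fintype.card ι) : 𝕜)

/-- Cauchy–Binet over all index maps counts every set of columns m! times; dividing each minor by m!
absorbs exactly this excess. -/
theorem minorMatrix_mul {𝕜 J ι : Type*} [Field 𝕜] [CharZero 𝕜] [Fintype ι] [DecidableEq ι]
    [Fintype J] (A B : Matrix J J 𝕜) :
    minorMatrix ι (A * B) = minorMatrix ι A * minorMatrix ι B := by
  ext f f'
  have h := factorial_mul_det_mul (A.submatrix f id) (B.submatrix id f')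
  have h0 : (Nat.factorial (Fintype.card ι) : 𝕜) ≠ 0 := by
    exact_mod_cast Nat.factorial_ne_zero _
  have h1 : (A * B).submatrix f f' = A.submatrix f id * B.submatrix id f' := by
    ext; simp [Matrix.mul_apply]
  simp only [minorMatrix, Matrix.of_apply, Matrix.mul_apply, h1]
  rw [div_eq_iff h0, ← mul_right_inj' h0, h, Finset.sum_mul, Finset.mul_sum]
  refine Finset.sum_congr rfl fun g _ => ?_
  simp only [Matrix.submatrix_submatrix, Function.id_comp, Function.comp_id]
  field_simp

/-- A minor of maximal order of a rectangular matrix is, up to sign, the determinant of the square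
matrix completed by rows of the identity matrix. -/
theorem abs_minor_le_sum_abs_det {ι κ : Type*} [Fintype ι] [DecidableEq ι] [Fintype κ]
    [DecidableEq κ] (A : Matrix ι (ι ⊕ κ) ℝ) (f : ι → ι ⊕ κ) :
    |(A.submatrix id f).det| ≤
      ∑ f' : κ → ι ⊕ κ, |(A.fromRows ((1 : Matrix (ι ⊕ κ) (ι ⊕ κ) ℝ).submatrix f' id)).det| := by
  by_cases hf : Function.Injective f
  swap
  · obtain ⟨i, j, hij, hne⟩ : ∃ i j, f i = f j ∧ i ≠ j := by
      simpa [Function.Injective] using hf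
    rw [Matrix.det_zero_of_column_eq hne (fun k => by simp [hij]), abs_zero]
    positivity
  -- The permutation lists the selected columns first. Completing by the identity rows of the
  -- remaining columns makes the permuted matrix block triangular with an identity block.
  obtain ⟨σ, hσ⟩ : ∃ σ : Equiv.Perm (ι ⊕ κ), ∀ i, σ (Sum.inl i) = f i := by
    let e : {x : ι ⊕ κ // x ∈ Set.range Sum.inl} ≃ {x : ι ⊕ κ // x ∈ Set.range f} :=
      (Equiv.ofInjective _ Sum.inl_injective).symm.trans (Equiv.ofInjective f hf)
    classical
    refine ⟨e.extendSubtype, fun i => ?_⟩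
    rw [e.extendSubtype_apply_of_mem _ ⟨i, rfl⟩]
    have : (Equiv.ofInjective (Sum.inl : ι → ι ⊕ κ) Sum.inl_injective).symm
        ⟨Sum.inl i, ⟨i, rfl⟩⟩ = i := by
      rw [Equiv.symm_apply_eq]; rfl
    simp only [e, Equiv.trans_apply]
    rw [this]; rfl
  refine le_trans (le_of_eq ?_) (Finset.single_le_sum (f := fun f' : κ → ι ⊕ κ =>
    |(A.fromRows ((1 : Matrix (ι ⊕ κ) (ι ⊕ κ) ℝ).submatrix f' id)).det|)
    (fun _ _ => abs_nonneg _) (Finset.mem_univ fun j => σ (Sum.inr j)))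
  set M := A.fromRows ((1 : Matrix (ι ⊕ κ) (ι ⊕ κ) ℝ).submatrix (fun j => σ (Sum.inr j)) id)
  have h1 : M.submatrix id σ = Matrix.fromBlocks (A.submatrix id f)
      (A.submatrix id fun j => σ (Sum.inr j)) 0 1 := by
    ext (i | i) (j | j)
    · simp [M, hσ]
    · simp [M]
    · simp [M]
    · simp [M, Matrix.one_apply]
  have h2 := Matrix.det_permute' σ M
  rw [h1, Matrix.det_fromBlocks_zero₂₁, Matrix.det_one, mul_one] at h2
  simp only [h2, abs_mul]
  have : |((Equiv.Perm.sign σ : ℤ) : ℝ)| = 1 := by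
    rcases Int.units_eq_one_or (Equiv.Perm.sign σ) with h | h <;> simp [h]
  rw [this, one_mul]

end Algebra

/-! ### Gibbs measures on finite point sets: gradient and Hessian of the log-partition function. -/

section Gibbs

open scoped InnerProductSpace Pointwise

variable {E : Type*} [NormedAddCommGroup E] [InnerProductSpace ℝ E]
variable {J : Type*} [Fintype J]

/-- The partition function of the weighted points `p j`. -/
noncomputable def expSum (w : J → ℝ) (p : J → E) (x : E) : ℝ :=
  ∑ j, w j * Real.exp ⟪p j, x⟫_ℝ

/-- The Gibbs weights of the weighted points `p j` at the parameter `x`. -/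
noncomputable def gibbs (w : J → ℝ) (p : J → E) (x : E) (j : J) : ℝ :=
  w j * Real.exp ⟪p j, x⟫_ℝ / expSum w p x

/-- The mean of the points `p j` with respect to their Gibbs weights, that is, the gradient of
`log ∘ expSum w p`. -/
noncomputable def gibbsMean (w : J → ℝ) (p : J → E) (x : E) : E :=
  ∑ j, gibbs w p x j • p j

variable {w : J → ℝ} {p : J → E}

theorem expSum_pos (hw : ∀ j, 0 ≤ w j) (h : ∃ j, 0 < w j) (x : E) : 0 < expSum w p x := by
  obtain ⟨j, hj⟩ := h
  exact Finset.sum_pos' (fun i _ => mul_nonneg (hw i) (Real.exp_pos _).le)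
    ⟨j, Finset.mem_univ j, mul_pos hj (Real.exp_pos _)⟩

theorem gibbs_nonneg (hw : ∀ j, 0 ≤ w j) (x : E) (j : J) : 0 ≤ gibbs w p x j :=
  div_nonneg (mul_nonneg (hw j) (Real.exp_pos _).le)
    (Finset.sum_nonneg fun i _ => mul_nonneg (hw i) (Real.exp_pos _).le)

theorem sum_gibbs (hw : ∀ j, 0 ≤ w j) (h : ∃ j, 0 < w j) (x : E) : ∑ j, gibbs w p x j = 1 := by
  simp only [gibbs]
  rw [← Finset.sum_div]
  exact div_self (expSum_pos hw h x).ne'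

theorem gibbsMean_mem_convexHull (hw : ∀ j, 0 ≤ w j) (h : ∃ j, 0 < w j) (x : E) :
    gibbsMean w p x ∈ convexHull ℝ (p '' {j | 0 < w j}) := by
  classical
  have hz : ∀ j, j ∉ Finset.univ.filter (fun j => 0 < w j) → gibbs w p x j = 0 := by
    intro j hj
    have : w j = 0 := le_antisymm (by simpa using hj) (hw j)
    simp [gibbs, this]
  have h1 : ∑ j ∈ Finset.univ.filter (fun j => 0 < w j), gibbs w p x j = 1 := by
    rw [← sum_gibbs hw h x]
    exact Finset.sum_subset (Finset.subset_univ _) fun j _ hj => hz j hj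
  have h2 : ∑ j ∈ Finset.univ.filter (fun j => 0 < w j), gibbs w p x j • p j =
      gibbsMean w p x :=
    Finset.sum_subset (Finset.subset_univ _) fun j _ hj => by rw [hz j hj, zero_smul]
  rw [← h2]
  refine (convex_convexHull ℝ _).sum_mem (fun j _ => gibbs_nonneg hw x j) h1 fun j hj => ?_
  exact subset_convexHull ℝ _ ⟨j, by simpa using hj, rfl⟩

theorem hasFDerivAt_expSum (hw : ∀ j, 0 ≤ w j) (h : ∃ j, 0 < w j) (x : E) :
    HasFDerivAt (expSum w p) (expSum w p x • innerSL ℝ (gibbsMean w p x)) x := by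
  have h1 : HasFDerivAt (expSum w p)
      (∑ j, w j • (Real.exp ⟪p j, x⟫_ℝ • innerSL ℝ (p j))) x := by
    refine HasFDerivAt.fun_sum fun j _ => ?_
    exact (((innerSL ℝ (p j)).hasFDerivAt (x := x)).exp).const_mul (w j)
  refine h1.congr_fderiv (Eq.symm ?_)
  have hne := (expSum_pos (p := p) hw h x).ne'
  ext y
  simp only [gibbsMean, smul_apply, innerSL_apply_apply, sum_inner,
    inner_smul_left, sum_apply, smul_eq_mul, gibbs]
  rw [Finset.mul_sum]
  refine Finset.sum_congr rfl fun j _ => ?_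
  simp only [map_div₀, map_mul, conj_trivial]
  field_simp

theorem hasFDerivAt_log_expSum (hw : ∀ j, 0 ≤ w j) (h : ∃ j, 0 < w j) (x : E) :
    HasFDerivAt (fun y => Real.log (expSum w p y)) (innerSL ℝ (gibbsMean w p x)) x := by
  have hne := (expSum_pos (p := p) hw h x).ne'
  refine ((hasFDerivAt_expSum (p := p) hw h x).log hne).congr_fderiv ?_
  rw [smul_smul, inv_mul_cancel₀ hne, one_smul]

/-- Writing the weight as w_j exp(⟨p_j, y⟩ - log Z(y)) replaces the quotient rule by the known
gradient of log Z. -/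
theorem hasFDerivAt_gibbs (hw : ∀ j, 0 ≤ w j) (h : ∃ j, 0 < w j) (x : E) (j : J) :
    HasFDerivAt (fun y => gibbs w p y j)
      (gibbs w p x j • innerSL ℝ (p j - gibbsMean w p x)) x := by
  have hne : ∀ y, expSum w p y ≠ 0 := fun y => (expSum_pos (p := p) hw h y).ne'
  have hf : (fun y => gibbs w p y j) =
      fun y => w j * Real.exp (⟪p j, y⟫_ℝ - Real.log (expSum w p y)) := by
    ext y
    rw [Real.exp_sub, Real.exp_log (expSum_pos hw h y), gibbs, mul_div_assoc]
  rw [hf]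
  have h1 := ((((innerSL ℝ (p j)).hasFDerivAt (x := x)).sub
    (hasFDerivAt_log_expSum (p := p) hw h x)).exp).const_mul (w j)
  refine h1.congr_fderiv (Eq.symm ?_)
  ext y
  simp only [gibbs, Pi.sub_apply, smul_apply, innerSL_apply_apply,
    sub_apply, inner_sub_left, smul_eq_mul]
  rw [Real.exp_sub, Real.exp_log (expSum_pos hw h x)]
  ring

/-- The derivative is the covariance operator of the Gibbs measure. Differentiation leaves one
factor p_j uncentred; centring it changes nothing because the centred points have mean zero. -/
theorem hasFDerivAt_gibbsMean (hw : ∀ j, 0 ≤ w j) (h : ∃ j, 0 < w j) (x : E) :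
    HasFDerivAt (gibbsMean w p) (∑ j, gibbs w p x j •
      (innerSL ℝ (p j - gibbsMean w p x)).smulRight (p j - gibbsMean w p x)) x := by
  have h1 : HasFDerivAt (gibbsMean w p) (∑ j, (gibbs w p x j •
      innerSL ℝ (p j - gibbsMean w p x)).smulRight (p j)) x :=
    HasFDerivAt.fun_sum fun j _ => (hasFDerivAt_gibbs hw h x j).smul_const (p j)
  refine h1.congr_fderiv (Eq.symm ?_)
  ext y
  have h2 : ∑ j, (gibbs w p x j * ⟪p j - gibbsMean w p x, y⟫_ℝ) = 0 := by
    have h3 : ⟪gibbsMean w p x, y⟫_ℝ = ∑ j, gibbs w p x j * ⟪p j, y⟫_ℝ := by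
      simp [gibbsMean, sum_inner, inner_smul_left]
    simp only [inner_sub_left, mul_sub, Finset.sum_sub_distrib]
    rw [← Finset.sum_mul, sum_gibbs hw h, one_mul, h3, sub_self]
  simp only [sum_apply, smul_apply,
    ContinuousLinearMap.smulRight_apply, innerSL_apply_apply, smul_eq_mul, smul_smul, smul_sub,
    Finset.sum_sub_distrib]
  rw [← Finset.sum_smul, h2, zero_smul, sub_zero]

/-- The partition function dominates each of its terms, so log Z dominates the support function of
the polytope up to a constant. This is the source of coercivity in `interior_subset_range_gibbsMap`.
-/
theorem inner_le_log_expSum (hw : ∀ j, 0 ≤ w j) :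
    ∃ C, ∀ x, ∀ y ∈ convexHull ℝ (p '' {j | 0 < w j}), ⟪y, x⟫_ℝ ≤ Real.log (expSum w p x) + C := by
  classical
  refine ⟨∑ j, |Real.log (w j)|, fun x y hy => ?_⟩
  set c := Real.log (expSum w p x) + ∑ j, |Real.log (w j)|
  have hconv : Convex ℝ {y : E | ⟪y, x⟫_ℝ ≤ c} := by
    refine convex_halfSpace_le ⟨fun a b => inner_add_left _ _ _, fun a b => ?_⟩ c
    rw [inner_smul_left]; rfl
  refine convexHull_min ?_ hconv hy
  rintro _ ⟨j, hj, rfl⟩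
  have hj' : 0 < w j := hj
  have h1 : w j * Real.exp ⟪p j, x⟫_ℝ ≤ expSum w p x :=
    Finset.single_le_sum (f := fun j => w j * Real.exp ⟪p j, x⟫_ℝ)
      (fun i _ => mul_nonneg (hw i) (Real.exp_pos _).le) (Finset.mem_univ j)
  have h2 := Real.log_le_log (mul_pos hj' (Real.exp_pos _)) h1
  rw [Real.log_mul hj'.ne' (Real.exp_pos _).ne', Real.log_exp] at h2
  have h3 : |Real.log (w j)| ≤ ∑ j, |Real.log (w j)| :=
    Finset.single_le_sum (f := fun j => |Real.log (w j)|) (fun _ _ => abs_nonneg _)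
      (Finset.mem_univ j)
  have h4 := neg_abs_le (Real.log (w j))
  change ⟪p j, x⟫_ℝ ≤ c
  simp only [c]
  linarith

end Gibbs

/-! ### The gradient map covers the interior of a Minkowski combination of polytopes. -/

section GibbsMap

open scoped InnerProductSpace Pointwise

variable {E : Type*} [NormedAddCommGroup E] [InnerProductSpace ℝ E]
variable {κ J : Type*} [Fintype κ] [Fintype J]

/-- A point of a Minkowski combination of convex bodies. -/
theorem mem_sum_smul {K : κ → ConvexBody E} {t : κ → ℝ≥0} {y : E} :
    y ∈ ∑ a, t a • K a ↔ ∃ k : κ → E, (∀ a, k a ∈ K a) ∧ ∑ a, (t a : ℝ) • k a = y := by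
  classical
  have h : ∀ (s : Finset κ) (y : E), y ∈ ∑ a ∈ s, t a • K a ↔
      ∃ k : κ → E, (∀ a, k a ∈ K a) ∧ ∑ a ∈ s, (t a : ℝ) • k a = y := by
    intro s
    induction s using Finset.induction_on with
    | empty =>
      intro y
      simp only [Finset.sum_empty]
      constructor
      · intro hy
        choose k hk using fun a => (K a).nonempty
        exact ⟨k, hk, (show y = 0 from hy).symm⟩
      · rintro ⟨_, _, rfl⟩
        exact rfl
    | insert a s ha ih =>
      intro y
      rw [Finset.sum_insert ha]
      constructor
      · intro hy
        obtain ⟨u, hu, v, hv, rfl⟩ := Set.mem_add.1 (show y ∈ ((t a • K a : ConvexBody E) : Set E) +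
          ((∑ a ∈ s, t a • K a : ConvexBody E) : Set E) from hy)
        obtain ⟨k, hk, rfl⟩ := (ih v).1 hv
        obtain ⟨z, hz, rfl⟩ := Set.mem_smul_set.1 hu
        refine ⟨Function.update k a z, fun b => ?_, ?_⟩
        · rcases eq_or_ne b a with rfl | hb
          · simpa using hz
          · simpa [hb] using hk b
        · rw [Finset.sum_insert ha, Function.update_self]
          congr 1
          refine Finset.sum_congr rfl fun b hb => ?_
          rw [Function.update_of_ne (by rintro rfl; exact ha hb)]
      · rintro ⟨k, hk, rfl⟩
        rw [Finset.sum_insert ha]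
        exact Set.add_mem_add (Set.smul_mem_smul_set (hk a)) ((ih _).2 ⟨k, hk, rfl⟩)
  exact h _ _

/-- The map `x ↦ ∑ a, t a • gibbsMean (w a) (p a) x`. -/
noncomputable def gibbsMap (w : κ → J → ℝ) (p : κ → J → E) (t : κ → ℝ≥0) (x : E) : E :=
  ∑ a, (t a : ℝ) • gibbsMean (w a) (p a) x

/-- The derivative of `gibbsMap`, a weighted sum of rank one positive operators. -/
noncomputable def gibbsMapDeriv (w : κ → J → ℝ) (p : κ → J → E) (t : κ → ℝ≥0) (x : E) :
    E →L[ℝ] E :=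
  ∑ c : κ × J, ((t c.1 : ℝ) * gibbs (w c.1) (p c.1) x c.2) •
    (innerSL ℝ (p c.1 c.2 - gibbsMean (w c.1) (p c.1) x)).smulRight
      (p c.1 c.2 - gibbsMean (w c.1) (p c.1) x)

variable {w : κ → J → ℝ} {p : κ → J → E} {K : κ → ConvexBody E} {t : κ → ℝ≥0}

omit [Fintype κ] [Fintype J] in
theorem exists_weight_pos (hK : ∀ a, (K a : Set E) = convexHull ℝ (p a '' {j | 0 < w a j})) (a : κ) :
    ∃ j, 0 < w a j := by
  obtain ⟨_, j, hj, _⟩ := convexHull_nonempty_iff.1 (hK a ▸ (K a).nonempty)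
  exact ⟨j, hj⟩

theorem hasFDerivAt_gibbsMap (hw : ∀ a j, 0 ≤ w a j) (h : ∀ a, ∃ j, 0 < w a j) (x : E) :
    HasFDerivAt (gibbsMap w p t) (gibbsMapDeriv w p t x) x := by
  have h1 := HasFDerivAt.fun_sum (u := Finset.univ) fun a _ =>
    (hasFDerivAt_gibbsMean (p := p a) (hw a) (h a) x).const_smul (t a : ℝ)
  refine h1.congr_fderiv (Eq.symm ?_)
  rw [gibbsMapDeriv, Fintype.sum_prod_type]
  refine Finset.sum_congr rfl fun a _ => ?_
  rw [Finset.smul_sum]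
  simp only [smul_smul]

theorem gibbsMap_mem (hw : ∀ a j, 0 ≤ w a j)
    (hK : ∀ a, (K a : Set E) = convexHull ℝ (p a '' {j | 0 < w a j})) (x : E) :
    gibbsMap w p t x ∈ ∑ a, t a • K a :=
  mem_sum_smul.2 ⟨fun a => gibbsMean (w a) (p a) x, fun a => by
    have := gibbsMean_mem_convexHull (p := p a) (hw a) (exists_weight_pos hK a) x
    rwa [← hK a] at this, rfl⟩

theorem inner_gibbsMapDeriv (x y : E) : ⟪gibbsMapDeriv w p t x y, y⟫_ℝ =
    ∑ c : κ × J, ((t c.1 : ℝ) * gibbs (w c.1) (p c.1) x c.2) *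
      ⟪p c.1 c.2 - gibbsMean (w c.1) (p c.1) x, y⟫_ℝ ^ 2 := by
  simp only [gibbsMapDeriv, sum_apply, smul_apply,
    ContinuousLinearMap.smulRight_apply, innerSL_apply_apply, sum_inner, inner_smul_left]
  refine Finset.sum_congr rfl fun c _ => ?_
  simp only [map_mul, conj_trivial]
  ring

/-- The quadratic form is a weighted sum of variances of ⟨·, y⟩. If it vanished, ⟨·, y⟩ would be
constant on every summand with nonzero coefficient, hence on the whole combination, which is
impossible on a set with interior. -/
theorem inner_gibbsMapDeriv_pos (hw : ∀ a j, 0 ≤ w a j)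
    (hK : ∀ a, (K a : Set E) = convexHull ℝ (p a '' {j | 0 < w a j}))
    (hint : (interior (↑(∑ a, t a • K a) : Set E)).Nonempty) (x : E) {y : E} (hy : y ≠ 0) :
    0 < ⟪gibbsMapDeriv w p t x y, y⟫_ℝ := by
  have hnn : ∀ c : κ × J, 0 ≤ ((t c.1 : ℝ) * gibbs (w c.1) (p c.1) x c.2) *
      ⟪p c.1 c.2 - gibbsMean (w c.1) (p c.1) x, y⟫_ℝ ^ 2 := fun c =>
    mul_nonneg (mul_nonneg (t c.1).2 (gibbs_nonneg (hw c.1) x c.2)) (sq_nonneg _)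
  rw [inner_gibbsMapDeriv]
  refine (Finset.sum_nonneg fun c _ => hnn c).lt_of_ne fun h0 => ?_
  have h1 := (Finset.sum_eq_zero_iff_of_nonneg fun c _ => hnn c).1 h0.symm
  have h2 : ∀ z ∈ ∑ a, t a • K a, ⟪z, y⟫_ℝ = ⟪gibbsMap w p t x, y⟫_ℝ := by
    intro z hz
    obtain ⟨k, hk, rfl⟩ := mem_sum_smul.1 hz
    simp only [gibbsMap, sum_inner, inner_smul_left]
    refine Finset.sum_congr rfl fun a _ => ?_
    rcases eq_or_ne (t a) 0 with ha | ha
    · simp [ha]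
    congr 1
    have hconv : Convex ℝ {z : E | ⟪z, y⟫_ℝ = ⟪gibbsMean (w a) (p a) x, y⟫_ℝ} :=
      convex_hyperplane ⟨fun a b => inner_add_left _ _ _, fun a b => by
        rw [inner_smul_left]; rfl⟩ _
    refine convexHull_min ?_ hconv ((hK a).subset (hk a))
    rintro _ ⟨j, hj, rfl⟩
    have h3 := h1 (a, j) (Finset.mem_univ _)
    have h4 : gibbs (w a) (p a) x j ≠ 0 :=
      (div_pos (mul_pos hj (Real.exp_pos _)) (expSum_pos (hw a) ⟨j, hj⟩ x)).ne'
    have h5 : ⟪p a j - gibbsMean (w a) (p a) x, y⟫_ℝ = 0 := by simpa [ha, h4] using h3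
    rw [inner_sub_left, sub_eq_zero] at h5
    exact h5
  obtain ⟨z, hz⟩ := hint
  obtain ⟨δ, hδ, hball⟩ := Metric.isOpen_iff.1 isOpen_interior z hz
  have hn : 0 < ‖y‖ := norm_pos_iff.2 hy
  have hmem : z + (δ / 2 / ‖y‖) • y ∈ ∑ a, t a • K a := by
    refine interior_subset (hball ?_)
    rw [mem_ball_iff_norm, add_sub_cancel_left, norm_smul, Real.norm_of_nonneg (by positivity),
      div_mul_cancel₀ _ hn.ne']
    linarith
  have h6 := (h2 _ hmem).trans (h2 z (interior_subset hz)).symm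
  rw [inner_add_left, inner_smul_left, real_inner_self_eq_norm_sq] at h6
  have : 0 < (δ / 2 / ‖y‖) * ‖y‖ ^ 2 := by positivity
  simp only [conj_trivial] at h6
  linarith

theorem gibbsMap_injective (hw : ∀ a j, 0 ≤ w a j)
    (hK : ∀ a, (K a : Set E) = convexHull ℝ (p a '' {j | 0 < w a j}))
    (hint : (interior (↑(∑ a, t a • K a) : Set E)).Nonempty) :
    Function.Injective (gibbsMap w p t) := by
  intro x y hxy
  by_contra hne
  have hd : y - x ≠ 0 := sub_ne_zero.2 (Ne.symm hne)
  have hder : ∀ s : ℝ, HasDerivAt (fun s : ℝ => ⟪gibbsMap w p t (x + s • (y - x)), y - x⟫_ℝ)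
      ⟪gibbsMapDeriv w p t (x + s • (y - x)) (y - x), y - x⟫_ℝ s := by
    intro s
    have h1 : HasDerivAt (fun s : ℝ => x + s • (y - x)) (y - x) s := by
      simpa using ((hasDerivAt_id s).smul_const (y - x)).const_add x
    have h2 := (hasFDerivAt_gibbsMap (p := p) (t := t) hw (exists_weight_pos hK)
      (x + s • (y - x))).comp_hasDerivAt s h1
    simpa using h2.inner ℝ (hasDerivAt_const s (y - x))
  -- A map with positive definite derivative is strictly monotone along the segment joining two
  -- points, so it separates them.
  have hmono : StrictMono fun s : ℝ => ⟪gibbsMap w p t (x + s • (y - x)), y - x⟫_ℝ :=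
    strictMono_of_deriv_pos fun s => by
      rw [(hder s).deriv]
      exact inner_gibbsMapDeriv_pos hw hK hint _ hd
  have := hmono (zero_lt_one (α := ℝ))
  simp [hxy] at this

/-- A preimage of y is a critical point of Σ t_a log Z_a(x) - ⟨y, x⟩. A minimum exists because y has
room to move inside the body in the direction of x, which forces growth at least linear in the norm
of x. -/
theorem interior_subset_range_gibbsMap [FiniteDimensional ℝ E] (hw : ∀ a j, 0 ≤ w a j)
    (hK : ∀ a, (K a : Set E) = convexHull ℝ (p a '' {j | 0 < w a j})) :
    interior (↑(∑ a, t a • K a) : Set E) ⊆ Set.range (gibbsMap w p t) := by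
  intro y hy
  have hpos := exists_weight_pos hK
  obtain ⟨δ, hδ, hball⟩ := Metric.isOpen_iff.1 isOpen_interior y hy
  choose C hC using fun a => inner_le_log_expSum (p := p a) (hw a)
  let Φ : E → ℝ := fun x => ∑ a, (t a : ℝ) * Real.log (expSum (w a) (p a) x) - ⟪y, x⟫_ℝ
  have hder : ∀ x, HasFDerivAt Φ (innerSL ℝ (gibbsMap w p t x - y)) x := by
    intro x
    have h1 := (HasFDerivAt.fun_sum (u := Finset.univ) fun a _ =>
      (hasFDerivAt_log_expSum (p := p a) (hw a) (hpos a) x).const_mul (t a : ℝ)).sub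
        ((innerSL ℝ y).hasFDerivAt (x := x))
    refine h1.congr_fderiv (Eq.symm ?_)
    simp [gibbsMap, map_sub, map_sum]
  have hlow : ∀ x, δ / 2 * ‖x‖ - ∑ a, (t a : ℝ) * C a ≤ Φ x := by
    intro x
    -- Half the radius keeps the point in the open ball; at x = 0 the coefficient is 0 by convention
    -- and the point is y itself.
    have hmem : y + (δ / 2 / ‖x‖) • x ∈ ∑ a, t a • K a := by
      refine interior_subset (hball ?_)
      rw [mem_ball_iff_norm, add_sub_cancel_left, norm_smul, Real.norm_of_nonneg (by positivity)]
      rcases eq_or_ne ‖x‖ 0 with h | h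
      · simp [h, hδ]
      · rw [div_mul_cancel₀ _ h]; linarith
    obtain ⟨k, hk, hsum⟩ := mem_sum_smul.1 hmem
    have h1 : ⟪y + (δ / 2 / ‖x‖) • x, x⟫_ℝ ≤
        ∑ a, (t a : ℝ) * (Real.log (expSum (w a) (p a) x) + C a) := by
      rw [← hsum, sum_inner]
      refine Finset.sum_le_sum fun a _ => ?_
      rw [inner_smul_left]
      exact mul_le_mul_of_nonneg_left (hC a x (k a) ((hK a).subset (hk a))) (t a).2
    have h2 : ⟪y + (δ / 2 / ‖x‖) • x, x⟫_ℝ = ⟪y, x⟫_ℝ + δ / 2 * ‖x‖ := by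
      rw [inner_add_left, inner_smul_left, real_inner_self_eq_norm_sq]
      rcases eq_or_ne ‖x‖ 0 with h | h
      · simp [h]
      · simp only [conj_trivial]; field_simp
    simp only [mul_add, Finset.sum_add_distrib] at h1
    simp only [Φ]
    linarith
  have htend : Tendsto Φ (cocompact E) atTop := by
    refine tendsto_atTop_mono hlow ?_
    exact tendsto_atTop_add_const_right _ _
      ((tendsto_norm_cocompact_atTop (E := E)).const_mul_atTop (half_pos hδ))
  have hcont : Continuous Φ := continuous_iff_continuousAt.2 fun x => (hder x).continuousAt
  obtain ⟨x, hx⟩ := hcont.exists_forall_le htend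
  have hmin : IsLocalMin Φ x := Filter.Eventually.of_forall hx
  have h0 := hmin.hasFDerivAt_eq_zero (hder x)
  refine ⟨x, sub_eq_zero.1 ?_⟩
  have h3 := congrArg (fun f => f (gibbsMap w p t x - y)) h0
  exact inner_self_eq_zero.1 (by simpa only [innerSL_apply_apply, zero_apply] using h3)

end GibbsMap

/-! ### Volume as the integral of a mixed discriminant. -/

section GibbsVolume

open scoped InnerProductSpace Pointwise

variable {E : Type*} [NormedAddCommGroup E] [InnerProductSpace ℝ E]
variable {ι κ J : Type*} [Fintype ι] [DecidableEq ι] [Fintype κ] [Fintype J]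

/-- The matrix of coordinates of the vectors `v i` in an orthonormal basis. -/
noncomputable def coordMatrix {κ : Type*} (b : OrthonormalBasis ι ℝ E) (v : κ → E) :
    Matrix κ ι ℝ :=
  Matrix.of fun i k => ⟪b k, v i⟫_ℝ

theorem factorial_mul_det_sum_smulRight {C : Type*} [Fintype C] (b : OrthonormalBasis ι ℝ E)
    (s : C → ℝ) (q : C → E) :
    (Nat.factorial (Fintype.card ι) : ℝ) *
        (∑ c, s c • (innerSL ℝ (q c)).smulRight (q c) : E →L[ℝ] E).det =
      ∑ f : ι → C, (∏ i, s (f i)) * (coordMatrix b (q ∘ f)).det ^ 2 := by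
  classical
  have h1 : LinearMap.toMatrix b.toBasis b.toBasis
      ((∑ c, s c • (innerSL ℝ (q c)).smulRight (q c) : E →L[ℝ] E) : E →ₗ[ℝ] E) =
      (coordMatrix b q).transpose * Matrix.diagonal s * coordMatrix b q := by
    ext i k
    rw [LinearMap.toMatrix_apply, b.coe_toBasis_repr_apply, b.coe_toBasis, b.repr_apply_apply]
    simp only [ContinuousLinearMap.coe_coe, sum_apply, smul_apply,
      ContinuousLinearMap.smulRight_apply, innerSL_apply_apply, inner_sum, inner_smul_right]
    rw [Matrix.mul_apply]
    simp only [Matrix.mul_diagonal, Matrix.transpose_apply, coordMatrix, Matrix.of_apply]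
    refine Finset.sum_congr rfl fun c _ => ?_
    rw [real_inner_comm (q c) (b k)]
    ring
  rw [ContinuousLinearMap.det, ← LinearMap.det_toMatrix b.toBasis, h1,
    factorial_mul_det_transpose_mul_diagonal_mul]
  rfl

/-- The mixed discriminant of the Hessians of `log ∘ expSum (w i) (p i)`. -/
noncomputable def gibbsDensity (b : OrthonormalBasis ι ℝ E) (w : ι → J → ℝ) (p : ι → J → E)
    (x : E) : ℝ :=
  (∑ f : ι → J, (∏ i, gibbs (w i) (p i) x (f i)) *
    (coordMatrix b fun i => p i (f i) - gibbsMean (w i) (p i) x).det ^ 2) /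
      (Nat.factorial (Fintype.card ι) : ℝ)

theorem gibbsDensity_nonneg (b : OrthonormalBasis ι ℝ E) {w : ι → J → ℝ} (p : ι → J → E)
    (hw : ∀ i j, 0 ≤ w i j) (x : E) : 0 ≤ gibbsDensity b w p x :=
  div_nonneg (Finset.sum_nonneg fun _ _ => mul_nonneg
    (Finset.prod_nonneg fun i _ => gibbs_nonneg (hw i) x _) (sq_nonneg _)) (Nat.cast_nonneg _)

/-- A choice of n rank one terms is a choice α of n summands together with one vertex in each.
Grouping by α exhibits the Hessian determinant as a polynomial in t with nonnegative coefficients.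
-/
theorem det_gibbsMapDeriv (b : OrthonormalBasis ι ℝ E) (w : κ → J → ℝ) (p : κ → J → E)
    (t : κ → ℝ≥0) (x : E) : (gibbsMapDeriv w p t x).det =
      ∑ α : ι → κ, (∏ i, (t (α i) : ℝ)) * gibbsDensity b (fun i => w (α i)) (fun i => p (α i)) x := by
  have h0 : (Nat.factorial (Fintype.card ι) : ℝ) ≠ 0 := by exact_mod_cast Nat.factorial_ne_zero _
  rw [← mul_right_inj' h0, gibbsMapDeriv,
    factorial_mul_det_sum_smulRight b
      (fun c : κ × J => (t c.1 : ℝ) * gibbs (w c.1) (p c.1) x c.2)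
      (fun c : κ × J => p c.1 c.2 - gibbsMean (w c.1) (p c.1) x),
    ← (Equiv.arrowProdEquivProdArrow ι (fun _ => κ) (fun _ => J)).symm.sum_comp,
    Fintype.sum_prod_type, Finset.mul_sum]
  refine Finset.sum_congr rfl fun α _ => ?_
  rw [gibbsDensity, mul_div_assoc', mul_div_assoc', mul_div_cancel_left₀ _ h0, Finset.mul_sum]
  refine Finset.sum_congr rfl fun f _ => ?_
  simp only [Finset.prod_mul_distrib, mul_assoc]
  rfl

theorem continuous_gibbsDensity (b : OrthonormalBasis ι ℝ E) {w : ι → J → ℝ} {p : ι → J → E}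
    (hw : ∀ i j, 0 ≤ w i j) (h : ∀ i, ∃ j, 0 < w i j) : Continuous (gibbsDensity b w p) := by
  have h1 : ∀ i j, Continuous fun x => gibbs (w i) (p i) x j := fun i j =>
    continuous_iff_continuousAt.2 fun x => (hasFDerivAt_gibbs (hw i) (h i) x j).continuousAt
  have h2 : ∀ i, Continuous (gibbsMean (w i) (p i)) := fun i =>
    continuous_iff_continuousAt.2 fun x => (hasFDerivAt_gibbsMean (hw i) (h i) x).continuousAt
  refine Continuous.div_const (continuous_finsetSum _ fun f _ => ?_) _
  refine Continuous.mul (continuous_finsetProd _ fun i _ => h1 i _) (Continuous.pow ?_ 2)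
  refine Continuous.matrix_det (continuous_matrix fun i k => ?_)
  exact continuous_const.inner (continuous_const.sub (h2 i))

variable [FiniteDimensional ℝ E] [MeasurableSpace E] [BorelSpace E]

/-- Change of variables gives the volume of the range of the gradient map. The range lies between
the interior and the body, and the frontier of a convex set is null. -/
theorem volume_sum_smul_eq_lintegral {w : κ → J → ℝ} {p : κ → J → E} {K : κ → ConvexBody E}
    {t : κ → ℝ≥0} (hw : ∀ a j, 0 ≤ w a j)
    (hK : ∀ a, (K a : Set E) = convexHull ℝ (p a '' {j | 0 < w a j}))
    (hint : (interior (↑(∑ a, t a • K a) : Set E)).Nonempty) :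
    volume (↑(∑ a, t a • K a) : Set E) =
      ∫⁻ x : E, ENNReal.ofReal |(gibbsMapDeriv w p t x).det| := by
  have h1 := lintegral_abs_det_fderiv_eq_addHaar_image (volume : Measure E) MeasurableSet.univ
    (fun x _ => (hasFDerivAt_gibbsMap (p := p) (t := t) hw
      (exists_weight_pos hK) x).hasFDerivWithinAt)
    (gibbsMap_injective hw hK hint).injOn
  rw [Measure.restrict_univ] at h1
  rw [h1, Set.image_univ]
  set S : ConvexBody E := ∑ a, t a • K a
  apply le_antisymm
  · calc volume (S : Set E) ≤ volume (interior (S : Set E) ∪ frontier (S : Set E)) := by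
          refine measure_mono fun x hx => ?_
          rw [← closure_eq_interior_union_frontier]
          exact subset_closure hx
      _ ≤ volume (interior (S : Set E)) + volume (frontier (S : Set E)) := measure_union_le _ _
      _ = volume (interior (S : Set E)) := by
          rw [S.convex.addHaar_frontier volume, add_zero]
      _ ≤ _ := measure_mono (interior_subset_range_gibbsMap hw hK)
  · refine measure_mono ?_
    rintro _ ⟨x, rfl⟩
    exact gibbsMap_mem hw hK x

/-- At t = 1 the density is one of the nonnegative terms of the Hessian determinant, whose integral
is the finite volume of the sum of all the polytopes. -/
theorem integrable_gibbsDensity (b : OrthonormalBasis ι ℝ E) {w : κ → J → ℝ} {p : κ → J → E}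
    {K : κ → ConvexBody E} (hw : ∀ a j, 0 ≤ w a j)
    (hK : ∀ a, (K a : Set E) = convexHull ℝ (p a '' {j | 0 < w a j}))
    (hint : (interior (↑(∑ a, K a) : Set E)).Nonempty) (α : ι → κ) :
    Integrable (gibbsDensity b (fun i => w (α i)) (fun i => p (α i))) := by
  have hs : ∑ a, (1 : κ → ℝ≥0) a • K a = ∑ a, K a := by simp
  have h1 := volume_sum_smul_eq_lintegral (t := 1) hw hK (by rwa [hs])
  refine ⟨(continuous_gibbsDensity b (fun i => hw (α i))
    fun i => exists_weight_pos hK (α i)).aestronglyMeasurable, ?_⟩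
  rw [hasFiniteIntegral_iff_ofReal (Eventually.of_forall
    (gibbsDensity_nonneg b _ fun i => hw (α i)))]
  refine lt_of_le_of_lt (lintegral_mono fun x => ENNReal.ofReal_le_ofReal ?_)
    (h1 ▸ (ConvexBody.isCompact _).measure_lt_top)
  refine le_trans ?_ (le_abs_self _)
  rw [det_gibbsMapDeriv b]
  refine le_trans (le_of_eq ?_) (Finset.single_le_sum
    (f := fun α : ι → κ => (∏ i, (((1 : κ → ℝ≥0) (α i) : ℝ≥0) : ℝ)) *
      gibbsDensity b (fun i => w (α i)) (fun i => p (α i)) x)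
    (fun β _ => mul_nonneg (Finset.prod_nonneg fun i _ => NNReal.coe_nonneg _)
      (gibbsDensity_nonneg b _ (fun i => hw (β i)) x)) (Finset.mem_univ α))
  simp

/-- The volume of a Minkowski combination of polytopes is a polynomial in the coefficients. -/
theorem volume_sum_smul_eq_sum_integral (b : OrthonormalBasis ι ℝ E) {w : κ → J → ℝ}
    {p : κ → J → E} {K : κ → ConvexBody E} {t : κ → ℝ≥0} (hw : ∀ a j, 0 ≤ w a j)
    (hK : ∀ a, (K a : Set E) = convexHull ℝ (p a '' {j | 0 < w a j}))
    (hint : (interior (↑(∑ a, K a) : Set E)).Nonempty)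
    (hint' : (interior (↑(∑ a, t a • K a) : Set E)).Nonempty) :
    (volume : Measure E).real (↑(∑ a, t a • K a) : Set E) =
      ∑ α : ι → κ, (∏ i, (t (α i) : ℝ)) *
        ∫ x, gibbsDensity b (fun i => w (α i)) (fun i => p (α i)) x := by
  have hnn : ∀ x, 0 ≤ (gibbsMapDeriv w p t x).det := fun x => by
    rw [det_gibbsMapDeriv b]
    exact Finset.sum_nonneg fun β _ => mul_nonneg
      (Finset.prod_nonneg fun i _ => NNReal.coe_nonneg _)
      (gibbsDensity_nonneg b _ (fun i => hw (β i)) x)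
  have hi : ∀ α : ι → κ, Integrable fun x => (∏ i, (t (α i) : ℝ)) *
      gibbsDensity b (fun i => w (α i)) (fun i => p (α i)) x := fun α =>
    (integrable_gibbsDensity b hw hK hint α).const_mul _
  have h2 : (fun x => (gibbsMapDeriv w p t x).det) = fun x => ∑ α : ι → κ,
      (∏ i, (t (α i) : ℝ)) * gibbsDensity b (fun i => w (α i)) (fun i => p (α i)) x :=
    funext fun x => det_gibbsMapDeriv b w p t x
  have hint2 : Integrable fun x => (gibbsMapDeriv w p t x).det := by
    rw [h2]; exact integrable_finsetSum _ fun α _ => hi α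
  rw [Measure.real, volume_sum_smul_eq_lintegral hw hK hint']
  simp only [abs_of_nonneg (hnn _)]
  rw [← integral_eq_lintegral_of_nonneg_ae (Eventually.of_forall hnn)
    hint2.aestronglyMeasurable, h2, integral_finsetSum _ fun α _ => hi α]
  simp only [integral_const_mul]

end GibbsVolume

/-! ### Hausdorff continuity of Minkowski operations and volume; density of polytopes. -/

section BodyTopology

open scoped InnerProductSpace Pointwise

variable {E : Type*} [NormedAddCommGroup E] [InnerProductSpace ℝ E]

theorem exists_dist_lt_of_dist_lt {K L : ConvexBody E} {r : ℝ} (h : dist K L < r) {x : E}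
    (hx : x ∈ K) : ∃ y ∈ L, dist x y < r :=
  Metric.exists_dist_lt_of_hausdorffDist_lt hx h ConvexBody.hausdorffEDist_ne_top

theorem body_dist_le {K L : ConvexBody E} {r : ℝ} (hr : 0 ≤ r)
    (h1 : ∀ x ∈ K, ∃ y ∈ L, dist x y ≤ r) (h2 : ∀ y ∈ L, ∃ x ∈ K, dist y x ≤ r) :
    dist K L ≤ r :=
  Metric.hausdorffDist_le_of_mem_dist hr h1 h2

theorem exists_dist_le_dist (K L : ConvexBody E) {x : E} (hx : x ∈ K) :
    ∃ y ∈ L, dist x y ≤ dist K L := by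
  obtain ⟨y, hy, h⟩ := L.isCompact.exists_infDist_eq_dist L.nonempty x
  exact ⟨y, hy, h ▸ Metric.infDist_le_hausdorffDist_of_mem hx ConvexBody.hausdorffEDist_ne_top⟩

theorem body_dist_add_le (K L K' L' : ConvexBody E) :
    dist (K + K') (L + L') ≤ dist K L + dist K' L' := by
  have h : ∀ K L K' L' : ConvexBody E, ∀ x ∈ K + K', ∃ y ∈ L + L',
      dist x y ≤ dist K L + dist K' L' := by
    rintro K L K' L' _ ⟨a, ha, a', ha', rfl⟩
    obtain ⟨b, hb, hab⟩ := exists_dist_le_dist K L ha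
    obtain ⟨b', hb', hab'⟩ := exists_dist_le_dist K' L' ha'
    exact ⟨b + b', Set.add_mem_add hb hb', (dist_add_add_le _ _ _ _).trans (add_le_add hab hab')⟩
  refine body_dist_le (by positivity) (h K L K' L') ?_
  rw [dist_comm K, dist_comm K']
  exact h L K L' K'

instance instContinuousAddConvexBody : ContinuousAdd (ConvexBody E) where
  continuous_add := by
    refine Metric.continuous_iff.2 fun a ε hε => ⟨ε / 2, half_pos hε, fun b hb => ?_⟩
    refine (body_dist_add_le b.1 a.1 b.2 a.2).trans_lt ?_
    have h1 := (le_max_left _ _).trans_lt hb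
    have h2 := (le_max_right _ _).trans_lt hb
    have h3 : dist b.1 a.1 < ε / 2 := h1
    have h4 : dist b.2 a.2 < ε / 2 := h2
    linarith

theorem dist_image_le (A : E →L[ℝ] E) (K L : ConvexBody E) :
    dist (image A K) (image A L) ≤ ‖A‖ * dist K L := by
  have h : ∀ K L : ConvexBody E, ∀ x ∈ image A K, ∃ y ∈ image A L,
      dist x y ≤ ‖A‖ * dist K L := by
    rintro K L _ ⟨a, ha, rfl⟩
    obtain ⟨b, hb, hab⟩ := exists_dist_le_dist K L ha
    refine ⟨A b, ⟨b, hb, rfl⟩, ?_⟩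
    rw [dist_eq_norm, ← map_sub]
    refine (A.le_opNorm _).trans ?_
    rw [← dist_eq_norm]
    gcongr
  refine body_dist_le (by positivity) (h K L) ?_
  rw [dist_comm K]
  exact h L K

theorem continuous_image (A : E →L[ℝ] E) : Continuous (image A) :=
  (LipschitzWith.of_dist_le_mul (K := ‖A‖₊) fun K L => dist_image_le A K L).continuous

theorem smul_eq_image (t : ℝ≥0) (K : ConvexBody E) :
    t • K = image ((t : ℝ) • ContinuousLinearMap.id ℝ E) K := by
  refine ConvexBody.ext ?_
  rfl

theorem continuous_smul_body (t : ℝ≥0) : Continuous fun K : ConvexBody E => t • K := by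
  simp only [smul_eq_image]
  exact continuous_image _

theorem continuous_sum_smul_body {κ : Type*} [Fintype κ] (t : κ → ℝ≥0) :
    Continuous fun K : κ → ConvexBody E => ∑ a, t a • K a :=
  continuous_finsetSum _ fun a _ => (continuous_smul_body (t a)).comp (continuous_apply a)

/-- The convex body spanned by finitely many points. -/
def hullBody (s : Finset E) (hs : s.Nonempty) : ConvexBody E where
  carrier := convexHull ℝ (s : Set E)
  convex' := convex_convexHull ℝ _
  isCompact' := s.finite_toSet.isCompact_convexHull ℝ
  nonempty' := by simpa using hs

/-- If x were outside L, push it by δ straight away from its nearest point y in L. The new point is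
still in K, but the supporting hyperplane of L at y keeps it further than δ from L. -/
theorem mem_of_closedBall_subset {K L : ConvexBody E} {x : E} {δ : ℝ}
    (hx : Metric.closedBall x δ ⊆ K) (h : dist K L < δ) : x ∈ L := by
  by_contra hxL
  obtain ⟨y, hy, hmin⟩ := exists_norm_eq_iInf_of_complete_convex L.nonempty
    L.isCompact.isComplete L.convex x
  have hin := (norm_eq_iInf_iff_real_inner_le_zero L.convex hy).1 hmin
  have hne : x - y ≠ 0 := fun h0 => hxL (by rw [sub_eq_zero.1 h0]; exact hy)
  have hn : 0 < ‖x - y‖ := norm_pos_iff.2 hne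
  have hδ : 0 < δ := dist_nonneg.trans_lt h
  obtain ⟨z, hz, hdist⟩ := exists_dist_lt_of_dist_lt h (x := x + (δ / ‖x - y‖) • (x - y)) (hx (by
    rw [mem_closedBall_iff_norm, add_sub_cancel_left, norm_smul,
      Real.norm_of_nonneg (by positivity), div_mul_cancel₀ _ hn.ne']))
  have h1 := hin z hz
  have h2 : ⟪x - y, x + (δ / ‖x - y‖) • (x - y) - z⟫_ℝ =
      ‖x - y‖ ^ 2 + δ * ‖x - y‖ - ⟪x - y, z - y⟫_ℝ := by
    have : x + (δ / ‖x - y‖) • (x - y) - z =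
      (x - y) + (δ / ‖x - y‖) • (x - y) - (z - y) := by abel
    rw [this, inner_sub_right, inner_add_right, inner_smul_right, real_inner_self_eq_norm_sq]
    field_simp
  have h3 := real_inner_le_norm (x - y) (x + (δ / ‖x - y‖) • (x - y) - z)
  rw [← dist_eq_norm (x + (δ / ‖x - y‖) • (x - y)) z] at h3
  have h4 := mul_lt_mul_of_pos_left hdist hn
  nlinarith [pow_pos hn 2]

variable [FiniteDimensional ℝ E]

/-- With a countable base, the product σ-algebra on tuples of bodies contains the open sets, so
continuous functions of tuples are measurable. -/
instance instSecondCountableConvexBody : SecondCountableTopology (ConvexBody E) := by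
  let f : ConvexBody E → TopologicalSpace.NonemptyCompacts E := fun K =>
    ⟨⟨K, K.isCompact⟩, K.nonempty⟩
  have hf : Isometry f := by
    intro K L
    rw [← ConvexBody.hausdorffEDist_coe]
    rfl
  exact hf.isEmbedding.secondCountableTopology

theorem dist_hullBody_le {K : ConvexBody E} {s : Finset E} (hs : s.Nonempty) {ε : ℝ}
    (hε : 0 ≤ ε) (h1 : ∀ x ∈ s, ∃ y ∈ K, dist x y ≤ ε) (h2 : ∀ y ∈ K, ∃ x ∈ s, dist y x ≤ ε) :
    dist (hullBody s hs) K ≤ ε := by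
  refine body_dist_le hε (fun x hx => ?_) fun y hy => ?_
  · have h3 : convexHull ℝ (s : Set E) ⊆ Metric.cthickening ε (K : Set E) := by
      refine convexHull_min (fun z hz => ?_) (K.convex.cthickening ε)
      obtain ⟨y, hy, hzy⟩ := h1 z hz
      exact Metric.mem_cthickening_of_dist_le z y ε _ hy hzy
    have h4 := h3 hx
    rw [K.isCompact.cthickening_eq_biUnion_closedBall hε] at h4
    obtain ⟨y, hy, hxy⟩ := Set.mem_iUnion₂.1 h4
    exact ⟨y, hy, hxy⟩
  · obtain ⟨x, hx, hyx⟩ := h2 y hy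
    exact ⟨x, subset_convexHull ℝ _ hx, hyx⟩

/-- Convex bodies are approximated by polytopes with non-empty interior. -/
theorem exists_finset_approx (K : ConvexBody E) {ε : ℝ} (hε : 0 < ε) :
    ∃ s : Finset E, s.Nonempty ∧ (∀ x ∈ s, ∃ y ∈ K, dist x y ≤ ε) ∧
      (∀ y ∈ K, ∃ x ∈ s, dist y x ≤ ε) ∧ (interior (convexHull ℝ (s : Set E))).Nonempty := by
  classical
  obtain ⟨x₀, hx₀⟩ := K.nonempty
  obtain ⟨t, htK, htf, hcov⟩ := K.isCompact.finite_cover_balls hε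
  -- The extra vertices of a small simplex around a point of K give the polytope interior points
  -- even when K is flat.
  obtain ⟨b, hb, hbs⟩ := exists_mem_interior_convexHull_affineBasis (Metric.ball_mem_nhds x₀ hε)
  refine ⟨htf.toFinset ∪ Finset.univ.image b, ?_, ?_, ?_, ?_⟩
  · exact ⟨b 0, by simp⟩
  · intro x hx
    rcases Finset.mem_union.1 hx with hx | hx
    · exact ⟨x, htK (by simpa using hx), by simp [hε.le]⟩
    · obtain ⟨i, _, rfl⟩ := Finset.mem_image.1 hx
      exact ⟨x₀, hx₀, (Metric.mem_ball.1 (hbs (subset_convexHull ℝ _ ⟨i, rfl⟩))).le⟩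
  · intro y hy
    obtain ⟨x, hx, hyx⟩ := Set.mem_iUnion₂.1 (hcov hy)
    exact ⟨x, Finset.mem_union_left _ (by simpa using hx), (Metric.mem_ball.1 hyx).le⟩
  · refine ⟨x₀, interior_mono (convexHull_mono ?_) hb⟩
    rintro _ ⟨i, rfl⟩
    simp

variable [MeasurableSpace E] [BorelSpace E]

theorem continuous_volume_body :
    Continuous fun K : ConvexBody E => (volume : Measure E).real K := by
  refine continuous_iff_continuousAt.2 fun K => ?_
  refine (ENNReal.tendsto_toReal K.isCompact.measure_lt_top.ne).comp ?_
  refine tendsto_order.2 ⟨fun a ha => ?_, fun a ha => ?_⟩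
  · have hK : volume (interior (K : Set E)) = volume (K : Set E) := by
      refine le_antisymm (measure_mono interior_subset) ?_
      calc volume (K : Set E) ≤ volume (interior (K : Set E) ∪ frontier (K : Set E)) := by
            refine measure_mono fun x hx => ?_
            rw [← closure_eq_interior_union_frontier]
            exact subset_closure hx
        _ ≤ volume (interior (K : Set E)) + volume (frontier (K : Set E)) := measure_union_le _ _
        _ = volume (interior (K : Set E)) := by
            rw [K.convex.addHaar_frontier volume, add_zero]
    -- Lower semicontinuity: these inner parts of K exhaust its interior, and each is contained in
    -- all bodies close enough to K. Upper semicontinuity below uses the thickenings of K instead.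
    let U : ℕ → Set E := fun n => {x | Metric.closedBall x (1 / ((n : ℝ) + 1)) ⊆ K}
    have hU : Monotone U := fun m n hmn x hx =>
      (Metric.closedBall_subset_closedBall (one_div_le_one_div_of_le (by positivity)
        (by exact_mod_cast Nat.succ_le_succ hmn))).trans hx
    have hUnion : interior (K : Set E) ⊆ ⋃ n, U n := by
      intro x hx
      obtain ⟨δ, hδ, hball⟩ := Metric.isOpen_iff.1 isOpen_interior x hx
      obtain ⟨n, hn⟩ := exists_nat_one_div_lt hδ
      exact Set.mem_iUnion.2 ⟨n, ((Metric.closedBall_subset_ball hn).trans hball).trans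
        interior_subset⟩
    have hlim := tendsto_measure_iUnion_atTop (μ := (volume : Measure E)) hU
    have ha' : a < volume (⋃ n, U n) := ha.trans_le (hK ▸ measure_mono hUnion)
    obtain ⟨n, hn⟩ := (hlim.eventually (lt_mem_nhds ha')).exists
    have hn0 : (0 : ℝ) < 1 / ((n : ℝ) + 1) := by positivity
    filter_upwards [Metric.ball_mem_nhds K hn0] with L hL
    refine hn.trans_le (measure_mono fun x hx => ?_)
    exact mem_of_closedBall_subset hx (by rwa [dist_comm])
  · have hlim := tendsto_measure_cthickening_of_isCompact (μ := (volume : Measure E)) K.isCompact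
    obtain ⟨δ, hδ, hlt⟩ := Metric.eventually_nhds_iff.1 (hlim.eventually (gt_mem_nhds ha))
    have hd : volume (Metric.cthickening (δ / 2) (K : Set E)) < a := by
      refine hlt ?_
      rw [Real.dist_eq, sub_zero, abs_of_pos (half_pos hδ)]
      linarith
    filter_upwards [Metric.ball_mem_nhds K (half_pos hδ)] with L hL
    refine lt_of_le_of_lt (measure_mono fun x hx => ?_) hd
    obtain ⟨y, hy, hxy⟩ := exists_dist_lt_of_dist_lt hL hx
    exact Metric.mem_cthickening_of_dist_le x y _ _ hy hxy.le

end BodyTopology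

/-! ### Extracting the multilinear coefficient of a symmetric expansion. -/

section Combinatorics

variable {ι : Type*} [Fintype ι] [DecidableEq ι]

theorem sum_ite_surjective {M : Type*} [AddCommMonoid M] (f : (ι → ι) → M)
    [DecidablePred fun β : ι → ι => Function.Surjective β] :
    ∑ β : ι → ι, (if Function.Surjective β then f β else 0) = ∑ σ : Equiv.Perm ι, f σ := by
  symm
  refine Finset.sum_of_injOn (fun σ : Equiv.Perm ι => (σ : ι → ι)) (fun σ _ τ _ h =>
    Equiv.coe_fn_injective h) (fun _ _ => Finset.mem_coe.2 (Finset.mem_univ _)) ?_ ?_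
  · intro β _ hβ
    rw [if_neg]
    intro h
    exact hβ ⟨Equiv.ofBijective β (Finite.injective_iff_bijective.1
      (Finite.injective_iff_surjective.2 h)), by simp, rfl⟩
  · intro σ _
    rw [if_pos σ.surjective]

/-- Inclusion–exclusion detects surjective maps. -/
theorem sum_neg_one_pow_card_mul_prod (β : ι → ι) [Decidable (Function.Surjective β)] :
    ∑ T : Finset ι, (-1 : ℝ) ^ T.card * ∏ j, (if β j ∈ T then (0 : ℝ) else 1) =
      if Function.Surjective β then 1 else 0 := by
  -- Only the sets T disjoint from the range of β survive, and the alternating sum over subsets of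
  -- the complement of the range vanishes unless that complement is empty.
  have h1 : ∀ T : Finset ι, (-1 : ℝ) ^ T.card * ∏ j, (if β j ∈ T then (0 : ℝ) else 1) =
      if T ∈ (Finset.univ.image β)ᶜ.powerset then (-1 : ℝ) ^ T.card else 0 := by
    intro T
    by_cases hT : T ∈ (Finset.univ.image β)ᶜ.powerset
    · rw [if_pos hT, Finset.prod_eq_one, mul_one]
      intro j _
      rw [if_neg]
      intro hj
      have := Finset.mem_powerset.1 hT hj
      simp at this
    · rw [if_neg hT]
      obtain ⟨a, ha, ha'⟩ : ∃ a ∈ T, a ∉ (Finset.univ.image β)ᶜ := by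
        simpa [Finset.subset_iff] using hT
      obtain ⟨j, rfl⟩ : ∃ j, β j = a := by simpa using ha'
      have h0 : ∏ j, (if β j ∈ T then (0 : ℝ) else 1) = 0 :=
        Finset.prod_eq_zero (Finset.mem_univ j) (if_pos ha)
      rw [h0, mul_zero]
  have h2 := congrArg (Int.cast : ℤ → ℝ)
    (Finset.sum_powerset_neg_one_pow_card (x := (Finset.univ.image β)ᶜ))
  push_cast at h2
  simp only [h1]
  rw [Finset.sum_ite_mem, Finset.univ_inter, h2]
  refine if_congr ?_ rfl rfl
  simp [Finset.eq_univ_iff_forall, Function.Surjective]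

theorem sum_single_eq_one_iff (α : ι → ι) :
    ∑ i, Finsupp.single (α i) 1 = (Finsupp.equivFunOnFinite.symm fun _ => 1 : ι →₀ ℕ) ↔
      Function.Surjective α := by
  constructor
  · intro h a
    have h1 := DFunLike.congr_fun h a
    by_contra hne
    push Not at hne
    simp [Finsupp.finsetSum_apply, hne] at h1
  · intro h
    have hb : Function.Bijective α :=
      Finite.injective_iff_bijective.1 (Finite.injective_iff_surjective.2 h)
    ext a
    rw [Finsupp.finsetSum_apply]
    refine ((Equiv.ofBijective α hb).sum_comp
      (fun b => (Finsupp.single b 1 : ι →₀ ℕ) a)).trans ?_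
    simp [Finsupp.single_apply]

variable {E : Type*} [NormedAddCommGroup E] [InnerProductSpace ℝ E]

/-- The polarization of a functional with a symmetric expansion along Minkowski combinations. -/
theorem polarization_eq_of_expansion {F : ConvexBody E → ℝ} {L : ι → ConvexBody E}
    (M : (ι → ι) → ℝ) (hM : ∀ (α : ι → ι) (σ : Equiv.Perm ι), M (α ∘ σ) = M α)
    (h : ∀ t : ι → ℝ≥0, F (∑ a, t a • L a) = ∑ α : ι → ι, (∏ i, (t (α i) : ℝ)) * M α) :
    polarization F L = M id := by
  classical
  have hP : IsMinkowskiPolynomial F L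
      (∑ α : ι → ι, MvPolynomial.monomial (∑ i, Finsupp.single (α i) 1) (M α)) := by
    intro t
    rw [h, map_sum]
    refine Finset.sum_congr rfl fun α _ => ?_
    rw [MvPolynomial.eval_monomial, mul_comm, ← Finsupp.prod_finsetSum_index (by simp)
      (fun _ _ _ => pow_add _ _ _)]
    simp
  rw [polarization_eq hP, MvPolynomial.coeff_sum]
  simp only [MvPolynomial.coeff_monomial, sum_single_eq_one_iff]
  -- The squarefree monomial collects one equal contribution from each permutation, which cancels
  -- the factorial in the polarization.
  rw [sum_ite_surjective]
  have h1 : ∀ σ : Equiv.Perm ι, M σ = M id := fun σ => hM id σ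
  simp only [h1]
  rw [Finset.sum_const, Finset.card_univ, Fintype.card_perm, nsmul_eq_mul,
    mul_div_cancel_left₀ _ (by exact_mod_cast Nat.factorial_ne_zero _)]

end Combinatorics

/-! ### Polarization of volume by inclusion–exclusion. -/

section VolumePolarization

variable {E : Type*} [NormedAddCommGroup E] [InnerProductSpace ℝ E] [FiniteDimensional ℝ E]
  [MeasurableSpace E] [BorelSpace E]
variable {ι κ : Type*} [Fintype ι] [DecidableEq ι] [Fintype κ]

/-- The alternating sum of volumes of partial Minkowski sums. -/
noncomputable def volumeDifference (K : ι → ConvexBody E) : ℝ :=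
  (∑ T : Finset ι, (-1 : ℝ) ^ T.card *
    (volume : Measure E).real (↑(∑ i, (if i ∈ T then (0 : ℝ≥0) else 1) • K i) : Set E)) /
      (Nat.factorial (Fintype.card ι) : ℝ)

/-- This is the reason for the finite-difference formula: it makes sense before polynomiality is
known and is visibly continuous, so identities pass from polytopes to all bodies. -/
theorem continuous_volumeDifference :
    Continuous (volumeDifference : (ι → ConvexBody E) → ℝ) := by
  refine Continuous.div_const (continuous_finsetSum _ fun T _ => continuous_const.mul ?_) _
  exact continuous_volume_body.comp (continuous_sum_smul_body _)

/-- If the volume of the combinations of `K` has a symmetric expansion of degree `card ι`, then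
`volumeDifference` is multilinear in these combinations. -/
theorem volumeDifference_sum_smul {K : κ → ConvexBody E} {M : (ι → κ) → ℝ}
    (hM : ∀ (α : ι → κ) (σ : Equiv.Perm ι), M (α ∘ σ) = M α)
    (h : ∀ t : κ → ℝ≥0, (volume : Measure E).real (↑(∑ a, t a • K a) : Set E) =
      ∑ α : ι → κ, (∏ i, (t (α i) : ℝ)) * M α) (s : ι → κ → ℝ≥0) :
    volumeDifference (fun i => ∑ a, s i a • K a) = ∑ α : ι → κ, (∏ i, (s i (α i) : ℝ)) * M α := by
  classical
  have h1 : ∀ T : Finset ι,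
      (volume : Measure E).real (↑(∑ i, (if i ∈ T then (0 : ℝ≥0) else 1) • ∑ a, s i a • K a) : Set E) =
      ∑ α : ι → κ, (∑ β : ι → ι, (∏ j, (if β j ∈ T then (0 : ℝ) else 1)) *
        ∏ j, (s (β j) (α j) : ℝ)) * M α := by
    intro T
    have h2 : ∑ i, (if i ∈ T then (0 : ℝ≥0) else 1) • ∑ a, s i a • K a =
        ∑ a, (∑ i, (if i ∈ T then (0 : ℝ≥0) else 1) * s i a) • K a := by
      simp only [Finset.smul_sum, smul_smul, Finset.sum_smul]
      exact Finset.sum_comm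
    rw [h2, h]
    refine Finset.sum_congr rfl fun α _ => ?_
    congr 1
    push_cast
    rw [Finset.prod_univ_sum]
    simp only [Fintype.piFinset_univ, Finset.prod_mul_distrib]
    refine Finset.sum_congr rfl fun β _ => ?_
    congr 1
    refine Finset.prod_congr rfl fun j _ => ?_
    split_ifs <;> simp
  have h3 : ∑ T : Finset ι, (-1 : ℝ) ^ T.card * (volume : Measure E).real
      (↑(∑ i, (if i ∈ T then (0 : ℝ≥0) else 1) • ∑ a, s i a • K a) : Set E) =
      ∑ α : ι → κ, (∑ β : ι → ι, (∑ T : Finset ι, (-1 : ℝ) ^ T.card *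
        ∏ j, (if β j ∈ T then (0 : ℝ) else 1)) * ∏ j, (s (β j) (α j) : ℝ)) * M α := by
    simp only [h1, Finset.mul_sum, Finset.sum_mul]
    rw [Finset.sum_comm]
    refine Finset.sum_congr rfl fun α _ => ?_
    rw [Finset.sum_comm]
    refine Finset.sum_congr rfl fun β _ => Finset.sum_congr rfl fun T _ => ?_
    ring
  -- Inclusion–exclusion leaves only the permutations β; by the symmetry of M they all contribute
  -- the same sum.
  have h4 : ∀ σ : Equiv.Perm ι, ∑ α : ι → κ, (∏ j, (s (σ j) (α j) : ℝ)) * M α =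
      ∑ α : ι → κ, (∏ i, (s i (α i) : ℝ)) * M α := by
    intro σ
    rw [← (Equiv.arrowCongr σ (Equiv.refl κ)).sum_comp
      (fun α : ι → κ => (∏ i, (s i (α i) : ℝ)) * M α)]
    refine Finset.sum_congr rfl fun α _ => ?_
    have h5 : (Equiv.arrowCongr σ (Equiv.refl κ)) α = α ∘ σ.symm := rfl
    rw [h5, hM, ← Equiv.prod_comp σ (fun i => (s i ((α ∘ σ.symm) i) : ℝ))]
    simp
  rw [volumeDifference, h3]
  simp only [sum_neg_one_pow_card_mul_prod, ite_mul, one_mul, zero_mul]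
  have h6 : ∀ α : ι → κ, (∑ β : ι → ι, if Function.Surjective β then
      ∏ j, (s (β j) (α j) : ℝ) else 0) * M α = ∑ σ : Equiv.Perm ι,
        (∏ j, (s (σ j) (α j) : ℝ)) * M α := by
    intro α
    rw [sum_ite_surjective (fun β : ι → ι => ∏ j, (s (β j) (α j) : ℝ)),
      Finset.sum_mul]
  simp only [h6]
  rw [Finset.sum_comm]
  simp only [h4]
  rw [Finset.sum_const, Finset.card_univ, Fintype.card_perm, nsmul_eq_mul,
    mul_div_cancel_left₀ _ (by exact_mod_cast Nat.factorial_ne_zero _)]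

theorem volumeDifference_comp {K : κ → ConvexBody E} {M : (ι → κ) → ℝ}
    (hM : ∀ (α : ι → κ) (σ : Equiv.Perm ι), M (α ∘ σ) = M α)
    (h : ∀ t : κ → ℝ≥0, (volume : Measure E).real (↑(∑ a, t a • K a) : Set E) =
      ∑ α : ι → κ, (∏ i, (t (α i) : ℝ)) * M α) (α : ι → κ) :
    volumeDifference (fun i => K (α i)) = M α := by
  classical
  have h1 := volumeDifference_sum_smul hM h fun i a => if a = α i then 1 else 0
  have h2 : ∀ i, ∑ a, (if a = α i then (1 : ℝ≥0) else 0) • K a = K (α i) := by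
    intro i
    simp [ite_smul]
  simp only [h2] at h1
  rw [h1, Finset.sum_eq_single α]
  · simp
  · intro β _ hβ
    obtain ⟨i, hi⟩ := Function.ne_iff.1 hβ
    rw [Finset.prod_eq_zero (Finset.mem_univ i) (by simp [hi]), zero_mul]
  · simp

end VolumePolarization

/-! ### Minkowski's theorem, positivity and monotonicity. -/

section Minkowski

variable {E : Type*} [NormedAddCommGroup E] [InnerProductSpace ℝ E]
variable {ι κ J : Type*} [Fintype ι] [DecidableEq ι] [Fintype κ] [Fintype J]

/-- Moving only the point chosen in the summand `K a`, at scale 1 / t_a, already fills a ball of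
radius t_a δ. -/
theorem interior_sum_smul_nonempty {K : κ → ConvexBody E} {t : κ → ℝ≥0} {a : κ} (ha : t a ≠ 0)
    (hK : (interior (K a : Set E)).Nonempty) :
    (interior (↑(∑ a, t a • K a) : Set E)).Nonempty := by
  classical
  obtain ⟨y, hy⟩ := hK
  obtain ⟨δ, hδ, hball⟩ := Metric.isOpen_iff.1 isOpen_interior y hy
  choose k₀ hk₀ using fun a => (K a).nonempty
  have hta : 0 < (t a : ℝ) := by exact_mod_cast pos_iff_ne_zero.2 ha
  set x := ∑ b, (t b : ℝ) • Function.update k₀ a y b with hx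
  refine ⟨x, mem_interior_iff_mem_nhds.2 (Filter.mem_of_superset
    (Metric.ball_mem_nhds x (mul_pos hta hδ)) fun z hz => ?_)⟩
  refine mem_sum_smul.2 ⟨Function.update k₀ a (y + (t a : ℝ)⁻¹ • (z - x)), fun b => ?_, ?_⟩
  · rcases eq_or_ne b a with rfl | hb
    · rw [Function.update_self]
      refine interior_subset (hball ?_)
      rw [mem_ball_iff_norm, add_sub_cancel_left, norm_smul, norm_inv,
        Real.norm_of_nonneg hta.le, inv_mul_lt_iff₀ hta]
      exact mem_ball_iff_norm.1 hz
    · rw [Function.update_of_ne hb]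
      exact hk₀ b
  · have h1 : ∀ b, (t b : ℝ) • Function.update k₀ a (y + (t a : ℝ)⁻¹ • (z - x)) b =
        (t b : ℝ) • Function.update k₀ a y b + (if b = a then z - x else 0) := by
      intro b
      rcases eq_or_ne b a with rfl | hb
      · simp [smul_add, smul_smul, hta.ne']
      · simp [hb]
    simp only [h1, Finset.sum_add_distrib, ← hx]
    simp

theorem gibbsDensity_comp_perm (b : OrthonormalBasis ι ℝ E) (w : ι → J → ℝ) (p : ι → J → E)
    (σ : Equiv.Perm ι) (x : E) :
    gibbsDensity b (fun i => w (σ i)) (fun i => p (σ i)) x = gibbsDensity b w p x := by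
  rw [gibbsDensity, gibbsDensity]
  congr 1
  rw [← (Equiv.arrowCongr σ (Equiv.refl J)).symm.sum_comp]
  refine Finset.sum_congr rfl fun f _ => ?_
  have h1 : (Equiv.arrowCongr σ (Equiv.refl J)).symm f = f ∘ σ := rfl
  rw [h1]
  congr 1
  · exact Equiv.prod_comp σ fun i => gibbs (w i) (p i) x (f i)
  · have h2 : (coordMatrix b fun i => p (σ i) ((f ∘ σ) i) - gibbsMean (w (σ i)) (p (σ i)) x) =
        (coordMatrix b fun i => p i (f i) - gibbsMean (w i) (p i) x).submatrix σ id := rfl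
    rw [h2, Matrix.det_permute, mul_pow]
    have h3 : ((Equiv.Perm.sign σ : ℤ) : ℝ) ^ 2 = 1 := by
      rcases Int.units_eq_one_or (Equiv.Perm.sign σ) with h | h <;> simp [h]
    rw [h3, one_mul]

variable [FiniteDimensional ℝ E] [MeasurableSpace E] [BorelSpace E]

theorem volume_expansion_of_weights (b : OrthonormalBasis ι ℝ E) {w : κ → J → ℝ}
    {p : κ → J → E} {K : κ → ConvexBody E} (hw : ∀ a j, 0 ≤ w a j)
    (hK : ∀ a, (K a : Set E) = convexHull ℝ (p a '' {j | 0 < w a j}))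
    (hint : ∀ a, (interior (K a : Set E)).Nonempty) (t : κ → ℝ≥0) :
    (volume : Measure E).real (↑(∑ a, t a • K a) : Set E) =
      ∑ α : ι → κ, (∏ i, (t (α i) : ℝ)) *
        ∫ x, gibbsDensity b (fun i => w (α i)) (fun i => p (α i)) x := by
  have hcard : finrank ℝ E = Fintype.card ι := finrank_eq_card_basis b.toBasis
  have hone : ∑ a, (1 : κ → ℝ≥0) a • K a = ∑ a, K a := by simp
  -- The case t = 0 must be treated apart because the body degenerates to a point. In dimension zero
  -- a point has interior, and the general formula applies.
  rcases isEmpty_or_nonempty ι with hι | hι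
  · have hE : Subsingleton E := finrank_zero_iff.1 (hcard.trans (Fintype.card_eq_zero))
    have hu : ∀ L : ConvexBody E, (interior (L : Set E)).Nonempty := fun L => by
      rw [Subsingleton.eq_univ_of_nonempty L.nonempty, interior_univ]
      exact ⟨0, trivial⟩
    exact volume_sum_smul_eq_sum_integral b hw hK (hu _) (hu _)
  by_cases ht : ∃ a, t a ≠ 0
  · obtain ⟨a, ha⟩ := ht
    refine volume_sum_smul_eq_sum_integral b hw hK ?_ (interior_sum_smul_nonempty ha (hint a))
    rw [← hone]
    exact interior_sum_smul_nonempty (a := a) (by simp) (hint a)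
  · push Not at ht
    have hE : Nontrivial E := finrank_pos_iff.1 (hcard ▸ Fintype.card_pos)
    have h0 : ((∑ a, t a • K a : ConvexBody E) : Set E) = {0} := by
      simp [ht, Set.singleton_zero]
    rw [h0, Finset.sum_eq_zero]
    · simp [Measure.real]
    · intro α _
      rw [Finset.prod_eq_zero (Finset.mem_univ (Classical.arbitrary ι)) (by simp [ht]), zero_mul]

theorem volumeDifference_eq_integral (b : OrthonormalBasis ι ℝ E) {w : κ → J → ℝ}
    {p : κ → J → E} {K : κ → ConvexBody E} (hw : ∀ a j, 0 ≤ w a j)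
    (hK : ∀ a, (K a : Set E) = convexHull ℝ (p a '' {j | 0 < w a j}))
    (hint : ∀ a, (interior (K a : Set E)).Nonempty) (α : ι → κ) :
    volumeDifference (fun i => K (α i)) =
      ∫ x, gibbsDensity b (fun i => w (α i)) (fun i => p (α i)) x :=
  volumeDifference_comp
    (M := fun α => ∫ x, gibbsDensity b (fun i => w (α i)) (fun i => p (α i)) x)
    (fun α σ => integral_congr_ae (Eventually.of_forall fun x =>
      gibbsDensity_comp_perm b (fun i => w (α i)) (fun i => p (α i)) σ x))
    (volume_expansion_of_weights b hw hK hint) α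

/-- The weights of the points of a finite set `s` among those of a larger set: `1` on `s` and `ε`
elsewhere on `s'`. -/
noncomputable def finsetWeight {U : Finset E} (s s' : Finset E) (ε : ℝ) (x : U) : ℝ :=
  open Classical in if (x : E) ∈ s then 1 else if (x : E) ∈ s' then ε else 0

omit [InnerProductSpace ℝ E] [FiniteDimensional ℝ E] [MeasurableSpace E] [BorelSpace E] in
theorem finsetWeight_nonneg {U : Finset E} (s s' : Finset E) {ε : ℝ} (hε : 0 ≤ ε) (x : U) :
    0 ≤ finsetWeight s s' ε x := by
  unfold finsetWeight
  split_ifs <;> simp [hε]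

omit [FiniteDimensional ℝ E] [MeasurableSpace E] [BorelSpace E] in
theorem coe_hullBody_eq_of_pos {U s s' : Finset E} (hs : s'.Nonempty) (hss : s ⊆ s') (hU : s' ⊆ U)
    {ε : ℝ} (hε : 0 < ε) : (hullBody s' hs : Set E) =
      convexHull ℝ ((fun x : U => (x : E)) '' {x | 0 < finsetWeight s s' ε x}) := by
  change convexHull ℝ (s' : Set E) = _
  congr 1
  ext x
  constructor
  · intro hx
    refine ⟨⟨x, hU hx⟩, ?_, rfl⟩
    simp only [Set.mem_ofPred_eq, finsetWeight]
    rw [if_pos (show x ∈ s' from hx)]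
    split_ifs
    · exact one_pos
    · exact hε
  · rintro ⟨y, hy, rfl⟩
    simp only [Set.mem_ofPred_eq, finsetWeight] at hy
    split_ifs at hy with h1 h2
    · exact hss h1
    · exact h2
    · exact absurd hy (lt_irrefl _)

omit [FiniteDimensional ℝ E] [MeasurableSpace E] [BorelSpace E] in
theorem coe_hullBody_eq_of_zero {U s s' : Finset E} (hs : s.Nonempty) (hU : s ⊆ U) :
    (hullBody s hs : Set E) =
      convexHull ℝ ((fun x : U => (x : E)) '' {x | 0 < finsetWeight s s' 0 x}) := by
  change convexHull ℝ (s : Set E) = _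
  congr 1
  ext x
  constructor
  · intro hx
    refine ⟨⟨x, hU hx⟩, ?_, rfl⟩
    simp only [Set.mem_ofPred_eq, finsetWeight]
    rw [if_pos (show x ∈ s from hx)]
    exact one_pos
  · rintro ⟨y, hy, rfl⟩
    simp only [Set.mem_ofPred_eq, finsetWeight] at hy
    split_ifs at hy with h1 h2
    · exact h1
    · exact absurd hy (lt_irrefl _)
    · exact absurd hy (lt_irrefl _)

theorem exists_polytopes_approx (K : κ → ConvexBody E) {ε : ℝ} (hε : 0 < ε) :
    ∃ (s : κ → Finset E) (hs : ∀ a, (s a).Nonempty),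
      dist (fun a => hullBody (s a) (hs a)) K ≤ ε ∧
      ∀ a, (interior (hullBody (s a) (hs a) : Set E)).Nonempty := by
  choose s hs h1 h2 h3 using fun a => exists_finset_approx (K a) hε
  exact ⟨s, hs, (dist_pi_le_iff hε.le).2 fun a => dist_hullBody_le (hs a) hε.le (h1 a) (h2 a), h3⟩

/-- **Minkowski's theorem**: the volume of a Minkowski combination of convex bodies is a polynomial
in the coefficients. -/
theorem volume_sum_smul (b : OrthonormalBasis ι ℝ E) (K : κ → ConvexBody E) (t : κ → ℝ≥0) :
    (volume : Measure E).real (↑(∑ a, t a • K a) : Set E) =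
      ∑ α : ι → κ, (∏ i, (t (α i) : ℝ)) * volumeDifference fun i => K (α i) := by
  classical
  have hclosed : IsClosed {K : κ → ConvexBody E |
      (volume : Measure E).real (↑(∑ a, t a • K a) : Set E) =
        ∑ α : ι → κ, (∏ i, (t (α i) : ℝ)) * volumeDifference fun i => K (α i)} := by
    refine isClosed_eq (continuous_volume_body.comp (continuous_sum_smul_body t)) ?_
    refine continuous_finsetSum _ fun α _ => continuous_const.mul ?_
    exact continuous_volumeDifference.comp (continuous_pi fun i => continuous_apply (α i))
  have hK : K ∈ closure {K : κ → ConvexBody E |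
      (volume : Measure E).real (↑(∑ a, t a • K a) : Set E) =
        ∑ α : ι → κ, (∏ i, (t (α i) : ℝ)) * volumeDifference fun i => K (α i)} := by
    refine Metric.mem_closure_iff.2 fun ε hε => ?_
    obtain ⟨s, hs, hdist, hint⟩ := exists_polytopes_approx K (half_pos hε)
    refine ⟨fun a => hullBody (s a) (hs a), ?_, ?_⟩
    · have hw : ∀ a (x : ↥(Finset.univ.biUnion s)), 0 ≤ finsetWeight (s a) (s a) 0 x :=
        fun a x => finsetWeight_nonneg _ _ le_rfl x
      have hK := fun a => coe_hullBody_eq_of_zero (s' := s a) (hs a)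
        (Finset.subset_biUnion_of_mem s (Finset.mem_univ a))
      refine (volume_expansion_of_weights b hw hK hint t).trans ?_
      refine Finset.sum_congr rfl fun α _ => ?_
      rw [volumeDifference_eq_integral b hw hK hint α]
    · rw [dist_comm]
      exact hdist.trans_lt (half_lt_self hε)
  exact hclosed.closure_subset hK

theorem interior_sum_nonempty_of_basis (b : OrthonormalBasis ι ℝ E) {K : ι → ConvexBody E}
    (hint : ∀ a, (interior (K a : Set E)).Nonempty) :
    (interior (↑(∑ a, K a) : Set E)).Nonempty := by
  have hone : ∑ a, (1 : ι → ℝ≥0) a • K a = ∑ a, K a := by simp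
  rcases isEmpty_or_nonempty ι with hι | hι
  · have hE : Subsingleton E := finrank_zero_iff.1
      ((finrank_eq_card_basis b.toBasis).trans Fintype.card_eq_zero)
    rw [Subsingleton.eq_univ_of_nonempty (ConvexBody.nonempty _), interior_univ]
    exact ⟨0, trivial⟩
  · rw [← hone]
    exact interior_sum_smul_nonempty (a := Classical.arbitrary ι) (by simp) (hint _)

theorem tendsto_gibbsDensity (b : OrthonormalBasis ι ℝ E) {X : Type*} {l : Filter X}
    {w : X → ι → J → ℝ} {w₀ : ι → J → ℝ} (p : ι → J → E)
    (hw₀ : ∀ i j, 0 ≤ w₀ i j) (hpos : ∀ i, ∃ j, 0 < w₀ i j)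
    (hlim : ∀ i j, Tendsto (fun n => w n i j) l (𝓝 (w₀ i j))) (x : E) :
    Tendsto (fun n => gibbsDensity b (w n) p x) l (𝓝 (gibbsDensity b w₀ p x)) := by
  have h1 : ∀ i, Tendsto (fun n => expSum (w n i) (p i) x) l (𝓝 (expSum (w₀ i) (p i) x)) :=
    fun i => tendsto_finsetSum _ fun j _ => (hlim i j).mul_const _
  have h2 : ∀ i j, Tendsto (fun n => gibbs (w n i) (p i) x j) l (𝓝 (gibbs (w₀ i) (p i) x j)) :=
    fun i j => ((hlim i j).mul_const _).div (h1 i) (expSum_pos (hw₀ i) (hpos i) x).ne'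
  have h3 : ∀ i, Tendsto (fun n => gibbsMean (w n i) (p i) x) l
      (𝓝 (gibbsMean (w₀ i) (p i) x)) :=
    fun i => tendsto_finsetSum _ fun j _ => (h2 i j).smul_const _
  refine Tendsto.div_const (tendsto_finsetSum _ fun f _ => ?_) _
  refine Tendsto.mul (tendsto_finsetProd _ fun i _ => h2 i _) (Tendsto.pow ?_ 2)
  refine ((Continuous.matrix_det continuous_id).tendsto _).comp ?_
  refine tendsto_pi_nhds.2 fun i => tendsto_pi_nhds.2 fun k => ?_
  exact tendsto_const_nhds.inner (tendsto_const_nhds.sub (h3 i))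

/-- The integral attached to `K'` is the same for every `n`, because its value depends on the
polytopes and not on the weights. The densities converge pointwise to the one attached to `K`, so
Fatou's lemma gives the inequality. -/
theorem volumeDifference_le_of_weights (b : OrthonormalBasis ι ℝ E) {w : ℕ → ι → J → ℝ}
    {w₀ : ι → J → ℝ} {p : ι → J → E} {K K' : ι → ConvexBody E} (hw : ∀ n a j, 0 ≤ w n a j)
    (hw₀ : ∀ a j, 0 ≤ w₀ a j)
    (hlim : ∀ i j, Tendsto (fun n => w n i j) atTop (𝓝 (w₀ i j)))
    (hK : ∀ a, (K a : Set E) = convexHull ℝ (p a '' {j | 0 < w₀ a j}))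
    (hK' : ∀ n a, (K' a : Set E) = convexHull ℝ (p a '' {j | 0 < w n a j}))
    (hint : ∀ a, (interior (K a : Set E)).Nonempty)
    (hint' : ∀ a, (interior (K' a : Set E)).Nonempty) :
    volumeDifference K ≤ volumeDifference K' := by
  have h0 : volumeDifference K = ∫ x, gibbsDensity b w₀ p x :=
    volumeDifference_eq_integral b hw₀ hK hint id
  have h1 : ∀ n, volumeDifference K' = ∫ x, gibbsDensity b (w n) p x := fun n =>
    volumeDifference_eq_integral b (hw n) (hK' n) hint' id
  have hi0 : Integrable (gibbsDensity b w₀ p) :=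
    integrable_gibbsDensity b hw₀ hK (interior_sum_nonempty_of_basis b hint) id
  have hi1 : ∀ n, Integrable (gibbsDensity b (w n) p) := fun n =>
    integrable_gibbsDensity b (hw n) (hK' n) (interior_sum_nonempty_of_basis b hint') id
  have hn0 : ∀ x, 0 ≤ gibbsDensity b w₀ p x := gibbsDensity_nonneg b p hw₀
  have hn1 : ∀ n x, 0 ≤ gibbsDensity b (w n) p x := fun n => gibbsDensity_nonneg b p (hw n)
  have hnn : 0 ≤ volumeDifference K' := h1 0 ▸ integral_nonneg (hn1 0)
  rw [← ENNReal.ofReal_le_ofReal_iff hnn]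
  have h2 : ∀ n, ∫⁻ x, ENNReal.ofReal (gibbsDensity b (w n) p x) =
      ENNReal.ofReal (volumeDifference K') := fun n => by
    rw [h1 n, ofReal_integral_eq_lintegral_ofReal (hi1 n) (Eventually.of_forall (hn1 n))]
  have h3 : ∀ x, liminf (fun n => ENNReal.ofReal (gibbsDensity b (w n) p x)) atTop =
      ENNReal.ofReal (gibbsDensity b w₀ p x) := fun x =>
    (ENNReal.tendsto_ofReal
      (tendsto_gibbsDensity b p hw₀ (exists_weight_pos hK) hlim x)).liminf_eq
  calc ENNReal.ofReal (volumeDifference K)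
      = ∫⁻ x, ENNReal.ofReal (gibbsDensity b w₀ p x) := by
        rw [h0, ofReal_integral_eq_lintegral_ofReal hi0 (Eventually.of_forall hn0)]
    _ = ∫⁻ x, liminf (fun n => ENNReal.ofReal (gibbsDensity b (w n) p x)) atTop := by
        simp only [h3]
    _ ≤ liminf (fun n => ∫⁻ x, ENNReal.ofReal (gibbsDensity b (w n) p x)) atTop :=
        lintegral_liminf_le fun n => (continuous_gibbsDensity b (hw n)
          (exists_weight_pos (hK' n))).measurable.ennreal_ofReal
    _ = ENNReal.ofReal (volumeDifference K') := by simp only [h2, liminf_const]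

theorem volumeDifference_hullBody_nonneg (b : OrthonormalBasis ι ℝ E) {s : ι → Finset E}
    (hs : ∀ i, (s i).Nonempty) (hint : ∀ i, (interior (hullBody (s i) (hs i) : Set E)).Nonempty) :
    0 ≤ volumeDifference (fun i => hullBody (s i) (hs i)) := by
  classical
  have hw : ∀ a (x : ↥(Finset.univ.biUnion s)), 0 ≤ finsetWeight (s a) (s a) 0 x :=
    fun a x => finsetWeight_nonneg _ _ le_rfl x
  have hK := fun a => coe_hullBody_eq_of_zero (s' := s a) (hs a)
    (Finset.subset_biUnion_of_mem s (Finset.mem_univ a))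
  exact le_of_le_of_eq (integral_nonneg (gibbsDensity_nonneg b _ hw))
    (volumeDifference_eq_integral b hw hK hint id).symm

/-- Vertices of `s' i` outside `s i` get weight 1 / (n + 1): positive weights all span the larger
polytope, while the limiting weights span the smaller one. -/
theorem volumeDifference_hullBody_mono (b : OrthonormalBasis ι ℝ E) {s s' : ι → Finset E}
    (hs : ∀ i, (s i).Nonempty) (hs' : ∀ i, (s' i).Nonempty) (hss : ∀ i, s i ⊆ s' i)
    (hint : ∀ i, (interior (hullBody (s i) (hs i) : Set E)).Nonempty) :
    volumeDifference (fun i => hullBody (s i) (hs i)) ≤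
      volumeDifference fun i => hullBody (s' i) (hs' i) := by
  classical
  have hU : ∀ i, s' i ⊆ Finset.univ.biUnion s' := fun i =>
    Finset.subset_biUnion_of_mem s' (Finset.mem_univ i)
  refine volumeDifference_le_of_weights (J := ↥(Finset.univ.biUnion s')) b
    (w := fun n i => finsetWeight (s i) (s' i) (1 / ((n : ℝ) + 1)))
    (w₀ := fun i => finsetWeight (s i) (s' i) 0) (p := fun _ x => (x : E))
    (fun n i x => finsetWeight_nonneg _ _ (by positivity) x)
    (fun i x => finsetWeight_nonneg _ _ le_rfl x) (fun i x => ?_)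
    (fun i => coe_hullBody_eq_of_zero (hs i) ((hss i).trans (hU i)))
    (fun n i => coe_hullBody_eq_of_pos (hs' i) (hss i) (hU i) (by positivity)) hint
    fun i => (hint i).mono (interior_mono (convexHull_mono (hss i)))
  unfold finsetWeight
  split_ifs
  · exact tendsto_const_nhds
  · exact tendsto_one_div_add_atTop_nhds_zero_nat
  · exact tendsto_const_nhds

theorem volumeDifference_mono (b : OrthonormalBasis ι ℝ E) {K K' : ι → ConvexBody E}
    (h : ∀ i, (K i : Set E) ⊆ K' i) :
    volumeDifference K ≤ volumeDifference K' := by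
  classical
  have hclosed : IsClosed {P : (ι → ConvexBody E) × (ι → ConvexBody E) |
      volumeDifference P.1 ≤ volumeDifference P.2} :=
    isClosed_le (continuous_volumeDifference.comp continuous_fst)
      (continuous_volumeDifference.comp continuous_snd)
  suffices hK : (K, K') ∈ closure {P : (ι → ConvexBody E) × (ι → ConvexBody E) |
      volumeDifference P.1 ≤ volumeDifference P.2} by
    have h1 := hclosed.closure_subset hK
    rwa [Set.mem_ofPred_eq] at h1
  refine Metric.mem_closure_iff.2 fun ε hε => ?_
  choose s hs h1 h2 h3 using fun a => exists_finset_approx (K a) (half_pos hε)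
  choose s' hs' h1' h2' h3' using fun a => exists_finset_approx (K' a) (half_pos hε)
  have hu : ∀ i, (s i ∪ s' i).Nonempty := fun i => (hs i).mono Finset.subset_union_left
  -- Adding the vertices of the first polytope to the second preserves the inclusion, and costs no
  -- accuracy since they lie near `K i`, which is contained in `K' i`.
  refine ⟨(fun i => hullBody (s i) (hs i), fun i => hullBody (s i ∪ s' i) (hu i)),
    volumeDifference_hullBody_mono b hs hu (fun i => Finset.subset_union_left) h3, ?_⟩
  rw [dist_comm]
  refine lt_of_le_of_lt (max_le ?_ ?_) (half_lt_self hε)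
  · exact (dist_pi_le_iff (half_pos hε).le).2 fun a =>
      dist_hullBody_le (hs a) (half_pos hε).le (h1 a) (h2 a)
  · refine (dist_pi_le_iff (half_pos hε).le).2 fun a =>
      dist_hullBody_le (hu a) (half_pos hε).le (fun x hx => ?_) fun y hy => ?_
    · rcases Finset.mem_union.1 hx with hx | hx
      · obtain ⟨y, hy, hxy⟩ := h1 a x hx
        exact ⟨y, h a hy, hxy⟩
      · exact h1' a x hx
    · obtain ⟨x, hx, hxy⟩ := h2' a y hy
      exact ⟨x, Finset.mem_union_right _ hx, hxy⟩

theorem volumeDifference_nonneg (b : OrthonormalBasis ι ℝ E) (K : ι → ConvexBody E) :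
    0 ≤ volumeDifference K := by
  have hclosed : IsClosed {K : ι → ConvexBody E | 0 ≤ volumeDifference K} :=
    isClosed_le continuous_const continuous_volumeDifference
  suffices hK : K ∈ closure {K : ι → ConvexBody E | 0 ≤ volumeDifference K} by
    have h1 := hclosed.closure_subset hK
    rwa [Set.mem_ofPred_eq] at h1
  refine Metric.mem_closure_iff.2 fun ε hε => ?_
  obtain ⟨s, hs, hdist, hint⟩ := exists_polytopes_approx K (half_pos hε)
  refine ⟨_, volumeDifference_hullBody_nonneg b hs hint, ?_⟩
  rw [dist_comm]
  exact hdist.trans_lt (half_lt_self hε)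

end Minkowski

/-! ### Symmetry, multilinearity and invariance of mixed volumes. -/

section MixedVolume

open scoped InnerProductSpace Pointwise

variable {E : Type*} [NormedAddCommGroup E] [InnerProductSpace ℝ E]

/-- The convex body consisting of one point. -/
def pointBody (x : E) : ConvexBody E where
  carrier := {x}
  convex' := convex_singleton x
  isCompact' := isCompact_singleton
  nonempty' := Set.singleton_nonempty x

/-- The segment from `0` to `v`. -/
def segmentBody (v : E) : ConvexBody E where
  carrier := segment ℝ 0 v
  convex' := convex_segment 0 v
  isCompact' := by
    rw [segment_eq_image]
    exact isCompact_Icc.image (by fun_prop)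
  nonempty' := ⟨0, left_mem_segment ℝ 0 v⟩

theorem image_sum_smul {κ : Type*} [Fintype κ] (A : E →L[ℝ] E) (t : κ → ℝ≥0)
    (K : κ → ConvexBody E) : image A (∑ a, t a • K a) = ∑ a, t a • image A (K a) := by
  ext x
  constructor
  · rintro ⟨y, hy, rfl⟩
    obtain ⟨k, hk, rfl⟩ := mem_sum_smul.1 hy
    refine mem_sum_smul.2 ⟨fun a => A (k a), fun a => ⟨k a, hk a, rfl⟩, ?_⟩
    simp
  · intro hx
    obtain ⟨k, hk, rfl⟩ := mem_sum_smul.1 hx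
    choose y hy hyk using hk
    refine ⟨∑ a, (t a : ℝ) • y a, mem_sum_smul.2 ⟨y, hy, rfl⟩, ?_⟩
    simp only [map_sum, map_smul]
    exact Finset.sum_congr rfl fun a _ => by rw [← hyk a]

theorem pointBody_sum_smul {κ : Type*} [Fintype κ] (t : κ → ℝ≥0) (x : κ → E) :
    ∑ a, t a • pointBody (x a) = pointBody (∑ a, (t a : ℝ) • x a) := by
  ext y
  constructor
  · intro hy
    obtain ⟨k, hk, rfl⟩ := mem_sum_smul.1 hy
    have : k = x := funext fun a => hk a
    rw [this]
    exact rfl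
  · intro hy
    exact mem_sum_smul.2 ⟨x, fun a => rfl, (show y = _ from hy).symm⟩

variable [FiniteDimensional ℝ E] [MeasurableSpace E] [BorelSpace E]
variable {ι ι' κ : Type*} [Fintype ι] [Fintype ι'] [Fintype κ]

theorem volume_image_body (A : E →L[ℝ] E) (K : ConvexBody E) :
    (volume : Measure E).real (image A K : Set E) = |A.det| * (volume : Measure E).real K := by
  have h := Measure.addHaar_image_continuousLinearMap (volume : Measure E) A (K : Set E)
  change (volume (A '' (K : Set E))).toReal = _
  rw [h, ENNReal.toReal_mul, ENNReal.toReal_ofReal (abs_nonneg _)]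
  rfl

theorem volume_add_pointBody (K : ConvexBody E) (x : E) :
    (volume : Measure E).real (↑(K + pointBody x) : Set E) = (volume : Measure E).real K := by
  change (volume ((K : Set E) + {x})).toReal = _
  rw [Set.add_singleton, Set.image_add_right, measure_preimage_add_right]
  rfl

theorem exists_orthonormalBasis (hι : Fintype.card ι = finrank ℝ E) :
    Nonempty (OrthonormalBasis ι ℝ E) :=
  ⟨(stdOrthonormalBasis ℝ E).reindex (Fintype.equivOfCardEq (by simp [hι]))⟩

theorem volumeDifference_comp_equiv [DecidableEq ι] [DecidableEq ι'] (e : ι ≃ ι')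
    (K : ι' → ConvexBody E) : volumeDifference (fun i => K (e i)) = volumeDifference K := by
  rw [volumeDifference, volumeDifference, Fintype.card_congr e]
  congr 1
  rw [← (Equiv.finsetCongr e).sum_comp]
  refine Finset.sum_congr rfl fun T _ => ?_
  have h1 : ∑ i, (if i ∈ T then (0 : ℝ≥0) else 1) • K (e i) =
      ∑ i, (if i ∈ Equiv.finsetCongr e T then (0 : ℝ≥0) else 1) • K i := by
    rw [← e.sum_comp]
    simp
  rw [h1]
  simp

theorem mixedVolume_eq_volumeDifference [DecidableEq ι] (hι : Fintype.card ι = finrank ℝ E)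
    (K : ι → ConvexBody E) : mixedVolume K = volumeDifference K := by
  obtain ⟨b⟩ := exists_orthonormalBasis hι
  exact polarization_eq_of_expansion (fun α : ι → ι => volumeDifference fun i => K (α i))
    (fun α σ => volumeDifference_comp_equiv σ fun i => K (α i)) fun t => volume_sum_smul b K t

theorem mixedVolume_comp_equiv (hι : Fintype.card ι = finrank ℝ E) (e : ι ≃ ι')
    (K : ι' → ConvexBody E) : mixedVolume (fun i => K (e i)) = mixedVolume K := by
  classical
  rw [mixedVolume_eq_volumeDifference hι,
    mixedVolume_eq_volumeDifference ((Fintype.card_congr e).symm.trans hι),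
    volumeDifference_comp_equiv]

theorem continuous_mixedVolume (hι : Fintype.card ι = finrank ℝ E) :
    Continuous (mixedVolume : (ι → ConvexBody E) → ℝ) := by
  classical
  rw [show (mixedVolume : (ι → ConvexBody E) → ℝ) = volumeDifference from
    funext (mixedVolume_eq_volumeDifference hι)]
  exact continuous_volumeDifference

theorem mixedVolume_nonneg (hι : Fintype.card ι = finrank ℝ E) (K : ι → ConvexBody E) :
    0 ≤ mixedVolume K := by
  classical
  obtain ⟨b⟩ := exists_orthonormalBasis hι
  rw [mixedVolume_eq_volumeDifference hι]
  exact volumeDifference_nonneg b K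

theorem mixedVolume_mono (hι : Fintype.card ι = finrank ℝ E) {K K' : ι → ConvexBody E}
    (h : ∀ i, (K i : Set E) ⊆ K' i) : mixedVolume K ≤ mixedVolume K' := by
  classical
  obtain ⟨b⟩ := exists_orthonormalBasis hι
  rw [mixedVolume_eq_volumeDifference hι, mixedVolume_eq_volumeDifference hι]
  exact volumeDifference_mono b h

theorem mixedVolume_sum_smul [DecidableEq ι] (hι : Fintype.card ι = finrank ℝ E) (K : κ → ConvexBody E)
    (s : ι → κ → ℝ≥0) : mixedVolume (fun i => ∑ a, s i a • K a) =
      ∑ α : ι → κ, (∏ i, (s i (α i) : ℝ)) * mixedVolume fun i => K (α i) := by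
  classical
  obtain ⟨b⟩ := exists_orthonormalBasis hι
  simp only [mixedVolume_eq_volumeDifference hι]
  exact volumeDifference_sum_smul (M := fun α => volumeDifference fun i => K (α i))
    (fun α σ => volumeDifference_comp_equiv σ fun i => K (α i)) (volume_sum_smul b K) s

theorem mixedVolume_smul (hι : Fintype.card ι = finrank ℝ E) (K : ι → ConvexBody E)
    (c : ι → ℝ≥0) : mixedVolume (fun i => c i • K i) = (∏ i, (c i : ℝ)) * mixedVolume K := by
  classical
  have h := mixedVolume_sum_smul hι K fun i a => if a = i then c i else 0
  simp only [ite_smul, zero_smul, Finset.sum_ite_eq', Finset.mem_univ, if_true] at h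
  rw [h, Finset.sum_eq_single id]
  · simp
  · intro β _ hβ
    obtain ⟨i, hi⟩ := Function.ne_iff.1 hβ
    rw [Finset.prod_eq_zero (Finset.mem_univ i) (by simp [show β i ≠ i from hi]), zero_mul]
  · simp

theorem mixedVolume_sum [DecidableEq ι] (hι : Fintype.card ι = finrank ℝ E) (K : ι → κ → ConvexBody E) :
    mixedVolume (fun i => ∑ a, K i a) = ∑ c : ι → κ, mixedVolume fun i => K i (c i) := by
  classical
  -- All summands form a single family indexed by pairs, and the 0–1 coefficients let slot i see
  -- only its own summands.
  have h := mixedVolume_sum_smul hι (fun x : ι × κ => K x.1 x.2) fun i x => if x.1 = i then 1 else 0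
  have h1 : ∀ i, ∑ x : ι × κ, (if x.1 = i then (1 : ℝ≥0) else 0) • K x.1 x.2 = ∑ a, K i a := by
    intro i
    rw [Fintype.sum_prod_type, Finset.sum_eq_single i]
    · simp
    · intro j _ hj
      simp [hj]
    · simp
  simp only [h1] at h
  rw [h, ← (Equiv.arrowProdEquivProdArrow ι (fun _ => ι) (fun _ => κ)).symm.sum_comp,
    Fintype.sum_prod_type, Finset.sum_eq_single id]
  · simp [Equiv.arrowProdEquivProdArrow]
  · intro β _ hβ
    obtain ⟨i, hi⟩ := Function.ne_iff.1 hβ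
    refine Finset.sum_eq_zero fun c _ => ?_
    rw [Finset.prod_eq_zero (Finset.mem_univ i)
      (by simp [Equiv.arrowProdEquivProdArrow, show β i ≠ i from hi]), zero_mul]
  · simp

theorem mixedVolume_image (hι : Fintype.card ι = finrank ℝ E) (A : E →L[ℝ] E)
    (K : ι → ConvexBody E) : mixedVolume (fun i => image A (K i)) = |A.det| * mixedVolume K := by
  classical
  rw [mixedVolume_eq_volumeDifference hι, mixedVolume_eq_volumeDifference hι, volumeDifference,
    volumeDifference, mul_div_assoc', Finset.mul_sum]
  congr 1
  refine Finset.sum_congr rfl fun T _ => ?_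
  rw [← image_sum_smul, volume_image_body]
  ring

theorem mixedVolume_translate (hι : Fintype.card ι = finrank ℝ E) (K : ι → ConvexBody E)
    (x : ι → E) : mixedVolume (fun i => K i + pointBody (x i)) = mixedVolume K := by
  classical
  rw [mixedVolume_eq_volumeDifference hι, mixedVolume_eq_volumeDifference hι, volumeDifference,
    volumeDifference]
  congr 1
  refine Finset.sum_congr rfl fun T _ => ?_
  simp only [smul_add, Finset.sum_add_distrib]
  rw [pointBody_sum_smul, volume_add_pointBody]

/-- A combination of n segments is a parallelotope of volume t₁⋯t_n |det v|. This polynomial has a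
single monomial, so its symmetric expansion is supported on the permutations. -/
theorem mixedVolume_segmentBody [DecidableEq ι] (b : OrthonormalBasis ι ℝ E) (v : ι → E) :
    mixedVolume (fun i => segmentBody (v i)) =
      |(coordMatrix b v).det| / (Nat.factorial (Fintype.card ι) : ℝ) := by
  have h0 : (Nat.factorial (Fintype.card ι) : ℝ) ≠ 0 := by exact_mod_cast Nat.factorial_ne_zero _
  have hvol : ∀ t : ι → ℝ≥0, (volume : Measure E).real (↑(∑ a, t a • segmentBody (v a)) : Set E) =
      (∏ a, (t a : ℝ)) * |(coordMatrix b v).det| := by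
    intro t
    have h1 : (↑(∑ a, t a • segmentBody (v a)) : Set E) =
        parallelepiped fun a => (t a : ℝ) • v a := by
      ext y
      rw [mem_parallelepiped_iff]
      constructor
      · intro hy
        obtain ⟨k, hk, rfl⟩ := mem_sum_smul.1 hy
        have h2 : ∀ a, ∃ r ∈ Set.Icc (0 : ℝ) 1, r • v a = k a := fun a => by
          have h3 : k a ∈ segment ℝ 0 (v a) := hk a
          rw [segment_eq_image] at h3
          simpa using h3
        choose r hr hrk using h2
        refine ⟨r, ⟨fun a => (hr a).1, fun a => (hr a).2⟩, ?_⟩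
        refine Finset.sum_congr rfl fun a _ => ?_
        rw [← hrk a, smul_comm]
      · rintro ⟨r, hr, rfl⟩
        refine mem_sum_smul.2 ⟨fun a => r a • v a, fun a => ?_, ?_⟩
        · change r a • v a ∈ segment ℝ 0 (v a)
          rw [segment_eq_image]
          exact ⟨r a, ⟨hr.1 a, hr.2 a⟩, by simp⟩
        · exact Finset.sum_congr rfl fun a _ => smul_comm _ _ _
    rw [h1, Measure.real, ← b.addHaar_eq_volume, Measure.addHaar_parallelepiped,
      ENNReal.toReal_ofReal (abs_nonneg _)]
    have h4 : b.toBasis.det (fun a => (t a : ℝ) • v a) = (∏ a, (t a : ℝ)) * b.toBasis.det v := by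
      simpa using b.toBasis.det.map_smul_univ (fun a => (t a : ℝ)) v
    have h5 : b.toBasis.det v = (coordMatrix b v).det := by
      rw [Basis.det_apply, ← Matrix.det_transpose]
      congr 1
      ext i k
      simp [coordMatrix, Basis.toMatrix_apply, b.repr_apply_apply]
    rw [h4, h5, abs_mul, Finset.abs_prod]
    simp
  classical
  refine (polarization_eq_of_expansion (fun α : ι → ι => if Function.Surjective α then
    |(coordMatrix b v).det| / (Nat.factorial (Fintype.card ι) : ℝ) else 0) ?_ fun t => ?_).trans ?_
  · intro α σ
    exact if_congr ⟨fun h => h.of_comp, fun h => h.comp σ.surjective⟩ rfl rfl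
  · rw [hvol]
    simp only [mul_ite, mul_zero]
    rw [sum_ite_surjective (fun α : ι → ι => (∏ i, (t (α i) : ℝ)) *
      (|(coordMatrix b v).det| / (Nat.factorial (Fintype.card ι) : ℝ)))]
    have h1 : ∀ σ : Equiv.Perm ι, ∏ i, (t (σ i) : ℝ) = ∏ i, (t i : ℝ) := fun σ =>
      Equiv.prod_comp σ fun i => (t i : ℝ)
    simp only [h1]
    rw [Finset.sum_const, Finset.card_univ, Fintype.card_perm, nsmul_eq_mul]
    field_simp
  · rw [if_pos Function.surjective_id]

end MixedVolume

/-! ### Bounds for determinants with two groups of rows. -/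

section LaplaceBounds

/-- The alternating map obtained by fixing the second group of arguments. -/
def fixRight {R M N σ τ : Type*} [CommRing R] [AddCommGroup M] [Module R M] [AddCommGroup N]
    [Module R N] [DecidableEq σ] [DecidableEq τ] (f : M [⋀^σ ⊕ τ]→ₗ[R] N) (q : τ → M) :
    M [⋀^σ]→ₗ[R] N where
  toFun p := f (Sum.elim p q)
  map_update_add' p i x y := by
    simp only [← Sum.update_elim_inl, f.map_update_add]
  map_update_smul' p i c x := by
    simp only [← Sum.update_elim_inl, f.map_update_smul]
  map_eq_zero_of_eq' p i j h hij :=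
    f.map_eq_zero_of_eq _ (i := Sum.inl i) (j := Sum.inl j) h (by simpa using hij)

variable {σ τ : Type*} [Fintype σ] [DecidableEq σ] [Fintype τ] [DecidableEq τ]

/-- With Q fixed the determinant is alternating in the rows of P, so it expands over standard basis
rows with the minors of P as coefficients. The factorial from the expansion is at least 1 and is
dropped. -/
theorem abs_det_fromRows_le (P : Matrix σ (σ ⊕ τ) ℝ) (Q : Matrix τ (σ ⊕ τ) ℝ) :
    |(P.fromRows Q).det| ≤ ∑ f : σ → σ ⊕ τ, |(P.submatrix id f).det| *
      |(((1 : Matrix (σ ⊕ τ) (σ ⊕ τ) ℝ).submatrix f id).fromRows Q).det| := by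
  have h := factorial_smul_alternatingMap_sum
    (fixRight (Matrix.detRowAlternating (n := σ ⊕ τ) (R := ℝ)) Q) P
    (fun j => (1 : Matrix (σ ⊕ τ) (σ ⊕ τ) ℝ) j)
  have h1 : (fun i => ∑ j, P i j • (fun j => (1 : Matrix (σ ⊕ τ) (σ ⊕ τ) ℝ) j) j) = P := by
    ext i k
    simp [Matrix.one_apply]
  rw [h1] at h
  have h2 : ∀ A : Matrix σ (σ ⊕ τ) ℝ,
      fixRight (Matrix.detRowAlternating (n := σ ⊕ τ) (R := ℝ)) Q A = (A.fromRows Q).det :=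
    fun A => rfl
  have h3 : (Nat.factorial (Fintype.card σ) : ℝ) * (P.fromRows Q).det =
      ∑ f : σ → σ ⊕ τ, (P.submatrix id f).det *
        (((1 : Matrix (σ ⊕ τ) (σ ⊕ τ) ℝ).submatrix f id).fromRows Q).det := h
  have h4 : (1 : ℝ) ≤ (Nat.factorial (Fintype.card σ) : ℝ) := by
    exact_mod_cast Nat.succ_le_of_lt (Nat.factorial_pos _)
  calc |(P.fromRows Q).det| ≤ (Nat.factorial (Fintype.card σ) : ℝ) * |(P.fromRows Q).det| :=
        le_mul_of_one_le_left (abs_nonneg _) h4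
    _ = |∑ f : σ → σ ⊕ τ, (P.submatrix id f).det *
        (((1 : Matrix (σ ⊕ τ) (σ ⊕ τ) ℝ).submatrix f id).fromRows Q).det| := by
        rw [← h3, abs_mul, abs_of_nonneg (zero_le_one.trans h4)]
    _ ≤ _ := by
        refine (Finset.abs_sum_le_sum_abs _ _).trans (le_of_eq ?_)
        simp only [abs_mul]

/-- A Laplace type bound of a determinant by its two groups of rows. -/
theorem abs_det_fromRows_le_mul (P : Matrix σ (σ ⊕ τ) ℝ) (Q : Matrix τ (σ ⊕ τ) ℝ) :
    |(P.fromRows Q).det| ≤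
      (∑ f' : τ → σ ⊕ τ,
        |(P.fromRows ((1 : Matrix (σ ⊕ τ) (σ ⊕ τ) ℝ).submatrix f' id)).det|) *
      ∑ f : σ → σ ⊕ τ, |(((1 : Matrix (σ ⊕ τ) (σ ⊕ τ) ℝ).submatrix f id).fromRows Q).det| := by
  refine (abs_det_fromRows_le P Q).trans ?_
  rw [Finset.mul_sum]
  exact Finset.sum_le_sum fun f _ =>
    mul_le_mul_of_nonneg_right (abs_minor_le_sum_abs_det P f) (abs_nonneg _)

theorem abs_det_one_submatrix_le {ι : Type*} [Fintype ι] [DecidableEq ι] (g : ι → ι) :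
    |((1 : Matrix ι ι ℝ).submatrix g id).det| ≤ 1 := by
  by_cases hg : Function.Injective g
  · have h := Matrix.det_permute (Equiv.ofBijective g (Finite.injective_iff_bijective.1 hg))
      (1 : Matrix ι ι ℝ)
    simp only [Matrix.det_one, mul_one] at h
    change ((1 : Matrix ι ι ℝ).submatrix g id).det = _ at h
    rw [h]
    rcases Int.units_eq_one_or (Equiv.Perm.sign
      (Equiv.ofBijective g (Finite.injective_iff_bijective.1 hg))) with h' | h' <;> simp [h']
  · obtain ⟨i, j, hij, hne⟩ : ∃ i j, g i = g j ∧ i ≠ j := by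
      simpa [Function.Injective] using hg
    rw [Matrix.det_zero_of_row_eq hne (by ext k; rw [Matrix.submatrix_apply, Matrix.submatrix_apply, hij]), abs_zero]
    exact zero_le_one

/-- A converse of `abs_minor_le_sum_abs_det`: together they make maximal minors and determinants
completed by identity rows comparable. -/
theorem abs_det_fromRows_one_le (P : Matrix σ (σ ⊕ τ) ℝ) (f' : τ → σ ⊕ τ) :
    |(P.fromRows ((1 : Matrix (σ ⊕ τ) (σ ⊕ τ) ℝ).submatrix f' id)).det| ≤
      ∑ f : σ → σ ⊕ τ, |(P.submatrix id f).det| := by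
  refine (abs_det_fromRows_le P _).trans (Finset.sum_le_sum fun f _ => ?_)
  refine mul_le_of_le_one_right (abs_nonneg _) ?_
  have h : ((1 : Matrix (σ ⊕ τ) (σ ⊕ τ) ℝ).submatrix f id).fromRows
      ((1 : Matrix (σ ⊕ τ) (σ ⊕ τ) ℝ).submatrix f' id) =
      (1 : Matrix (σ ⊕ τ) (σ ⊕ τ) ℝ).submatrix (Sum.elim f f') id := by
    ext (i | i) j <;> rfl
  rw [h]
  exact abs_det_one_submatrix_le _

end LaplaceBounds

/-! ### Zonotopes, and comparison of bodies with parallelotopes. -/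

section Zonotope

open scoped InnerProductSpace Pointwise

variable {E : Type*} [NormedAddCommGroup E] [InnerProductSpace ℝ E]
variable {ι : Type*} [Fintype ι]

/-- The Minkowski sum of the segments from `0` to `v a`. -/
noncomputable def zonotope (v : ι → E) : ConvexBody E := ∑ a, segmentBody (v a)

theorem mem_zonotope {v : ι → E} {x : E} :
    x ∈ zonotope v ↔ ∃ r : ι → ℝ, (∀ a, r a ∈ Set.Icc (0 : ℝ) 1) ∧ ∑ a, r a • v a = x := by
  have h0 : zonotope v = ∑ a, (1 : ι → ℝ≥0) a • segmentBody (v a) := by simp [zonotope]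
  have h1 : ∀ a k, k ∈ segmentBody (v a) ↔ ∃ r ∈ Set.Icc (0 : ℝ) 1, r • v a = k := fun a k => by
    change k ∈ segment ℝ 0 (v a) ↔ _
    rw [segment_eq_image]
    simp
  rw [h0, mem_sum_smul]
  constructor
  · rintro ⟨k, hk, rfl⟩
    choose r hr hrk using fun a => (h1 a (k a)).1 (hk a)
    exact ⟨r, hr, by simp [hrk]⟩
  · rintro ⟨r, hr, rfl⟩
    exact ⟨fun a => r a • v a, fun a => (h1 a _).2 ⟨r a, hr a, rfl⟩, by simp⟩

theorem mem_smul_add_pointBody {K : ConvexBody E} {c : ℝ≥0} {x y : E} :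
    y ∈ c • K + pointBody x ↔ ∃ z ∈ K, y = (c : ℝ) • z + x := by
  constructor
  · rintro ⟨_, ⟨z, hz, rfl⟩, _, rfl, rfl⟩
    exact ⟨z, hz, rfl⟩
  · rintro ⟨z, hz, rfl⟩
    exact ⟨_, ⟨z, hz, rfl⟩, x, rfl, rfl⟩

theorem image_zonotope (A : E →L[ℝ] E) (v : ι → E) :
    image A (zonotope v) = zonotope fun a => A (v a) := by
  ext x
  constructor
  · rintro ⟨y, hy, rfl⟩
    obtain ⟨r, hr, rfl⟩ := mem_zonotope.1 hy
    exact mem_zonotope.2 ⟨r, hr, by simp⟩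
  · intro hx
    obtain ⟨r, hr, rfl⟩ := mem_zonotope.1 hx
    exact ⟨_, mem_zonotope.2 ⟨r, hr, rfl⟩, by simp⟩

variable [FiniteDimensional ℝ E]

theorem unitBall_subset_zonotope (b : OrthonormalBasis ι ℝ E) :
    (unitBall E : Set E) ⊆ ↑((2 : ℝ≥0) • zonotope b + pointBody (-∑ a, b a)) := by
  intro x hx
  have hx1 : ‖x‖ ≤ 1 := mem_closedBall_zero_iff.1 hx
  have hc : ∀ a, |⟪b a, x⟫_ℝ| ≤ 1 := fun a => by
    refine (abs_real_inner_le_norm _ _).trans ?_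
    rw [b.norm_eq_one, one_mul]
    exact hx1
  refine mem_smul_add_pointBody.2 ⟨∑ a, ((1 + ⟪b a, x⟫_ℝ) / 2) • b a,
    mem_zonotope.2 ⟨_, fun a => ?_, rfl⟩, ?_⟩
  · have := abs_le.1 (hc a)
    constructor <;> linarith
  · conv_lhs => rw [← b.sum_repr' x]
    rw [Finset.smul_sum, ← sub_eq_add_neg, ← Finset.sum_sub_distrib]
    refine Finset.sum_congr rfl fun a _ => ?_
    rw [smul_smul, NNReal.coe_ofNat]
    module

theorem zonotope_subset_unitBall (b : OrthonormalBasis ι ℝ E) :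
    (zonotope b : Set E) ⊆ ↑((Fintype.card ι + 1 : ℝ≥0) • unitBall E + pointBody (0 : E)) := by
  intro x hx
  obtain ⟨r, hr, rfl⟩ := mem_zonotope.1 hx
  have hN : (0 : ℝ) < Fintype.card ι + 1 := by positivity
  refine mem_smul_add_pointBody.2 ⟨((Fintype.card ι : ℝ) + 1)⁻¹ • ∑ a, r a • b a, ?_, ?_⟩
  · change _ ∈ Metric.closedBall (0 : E) 1
    rw [mem_closedBall_zero_iff, norm_smul, norm_inv, Real.norm_of_nonneg hN.le,
      inv_mul_le_iff₀ hN]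
    calc ‖∑ a, r a • b a‖ ≤ ∑ a, ‖r a • b a‖ := norm_sum_le _ _
      _ ≤ ∑ _a : ι, (1 : ℝ) := by
        refine Finset.sum_le_sum fun a _ => ?_
        rw [norm_smul, b.norm_eq_one, mul_one, Real.norm_of_nonneg (hr a).1]
        exact (hr a).2
      _ ≤ _ := by simp
  · rw [smul_smul, add_zero]
    push_cast
    rw [mul_inv_cancel₀ hN.ne', one_smul]

theorem det_toBasis_eq_det_coordMatrix [DecidableEq ι] (b : OrthonormalBasis ι ℝ E) (v : ι → E) :
    b.toBasis.det v = (coordMatrix b v).det := by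
  rw [Basis.det_apply, ← Matrix.det_transpose]
  congr 1
  ext i k
  simp [coordMatrix, Basis.toMatrix_apply, b.repr_apply_apply]

/-- A convex body with interior points is comparable to the parallelotope spanned by an inscribed
simplex of maximal volume. -/
theorem exists_zonotope_comparable [DecidableEq ι] (b : OrthonormalBasis ι ℝ E) (K : ConvexBody E)
    (hint : (interior (K : Set E)).Nonempty) : ∃ (v : ι → E) (x y : E),
      (K : Set E) ⊆ ↑((2 : ℝ≥0) • zonotope v + pointBody x) ∧
      (zonotope v : Set E) ⊆ ↑((Fintype.card ι + 1 : ℝ≥0) • K + pointBody y) := by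
  obtain ⟨y₀, hy₀⟩ := hint
  obtain ⟨B, -, hBK⟩ := exists_mem_interior_convexHull_affineBasis
    (mem_interior_iff_mem_nhds.1 hy₀)
  have hB : ∀ i, B i ∈ K := fun i => hBK (subset_convexHull ℝ _ ⟨i, rfl⟩)
  set x₀ := B 0 with hx₀
  let e := (B.basisOf 0).indexEquiv b.toBasis
  let c := (B.basisOf 0).reindex e
  have hcont : Continuous fun u : ι → E => |b.toBasis.det fun i => u i - x₀| := by
    simp only [det_toBasis_eq_det_coordMatrix]
    refine (Continuous.matrix_det (continuous_matrix fun i k => ?_)).abs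
    exact continuous_const.inner ((continuous_apply i).sub continuous_const)
  -- The vertex x₀ stays fixed and only the other n vertices vary over K; this restricted maximum
  -- suffices, and it is nonzero because K contains an affine basis with vertex x₀.
  obtain ⟨u, hu, hmax⟩ := (isCompact_univ_pi fun _ : ι => K.isCompact).exists_isMaxOn
    ⟨fun _ => x₀, fun i _ => hB 0⟩ hcont.continuousOn
  have hu' : ∀ i, u i ∈ K := fun i => hu i (Set.mem_univ i)
  set v : ι → E := fun i => u i - x₀ with hv
  have hD : b.toBasis.det v ≠ 0 := by
    have h1 : |b.toBasis.det fun i => (c i + x₀) - x₀| ≤ |b.toBasis.det v| :=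
      hmax (fun i _ => by
        have : c i + x₀ = B (e.symm i) := by
          simp [c, hx₀]
        rw [this]
        exact hB _)
    simp only [add_sub_cancel_right] at h1
    have h2 : 0 < |b.toBasis.det c| := abs_pos.2 (b.toBasis.isUnit_det c).ne_zero
    exact abs_pos.1 (h2.trans_le h1)
  obtain ⟨hli, hspan⟩ := (Basis.is_basis_iff_det b.toBasis).2 (isUnit_iff_ne_zero.2 hD)
  let vb := Basis.mk hli hspan.ge
  have hrepr : ∀ w, ∑ i, vb.repr w i • v i = w := fun w => by
    simpa [vb] using vb.sum_repr w
  refine ⟨v, x₀ - ∑ i, v i, -(Fintype.card ι + 1 : ℝ) • x₀, fun z hz => ?_, fun z hz => ?_⟩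
  · have hr : ∀ i, |vb.repr (z - x₀) i| ≤ 1 := by
      intro i
      have h1 : b.toBasis.det (Function.update v i (z - x₀)) =
          vb.repr (z - x₀) i * b.toBasis.det v := by
        conv_lhs => rw [← hrepr (z - x₀)]
        have h2 := b.toBasis.det.toMultilinearMap.map_update_sum Finset.univ i
          (fun j => vb.repr (z - x₀) j • v j) v
        simp only [AlternatingMap.coe_multilinearMap] at h2
        rw [h2, Finset.sum_eq_single i]
        · rw [AlternatingMap.map_update_smul, Function.update_eq_self, smul_eq_mul]
        · intro j _ hj
          rw [AlternatingMap.map_update_smul, AlternatingMap.map_update_self _ _ hj.symm, smul_zero]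
        · simp
      have h3 : |b.toBasis.det fun j => Function.update u i z j - x₀| ≤ |b.toBasis.det v| :=
        hmax (fun j _ => by
          rcases eq_or_ne j i with rfl | hj
          · simpa using hz
          · simpa [hj] using hu' j)
      have h4 : (fun j => Function.update u i z j - x₀) = Function.update v i (z - x₀) := by
        ext j
        rcases eq_or_ne j i with rfl | hj
        · simp
        · simp [hj, hv]
      rw [h4, h1, abs_mul] at h3
      exact le_of_mul_le_mul_right (by simpa using h3) (abs_pos.2 hD)
    refine mem_smul_add_pointBody.2 ⟨∑ a, ((1 + vb.repr (z - x₀) a) / 2) • v a,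
      mem_zonotope.2 ⟨_, fun a => ?_, rfl⟩, ?_⟩
    · have := abs_le.1 (hr a)
      constructor <;> linarith
    · have h5 : z = ∑ i, vb.repr (z - x₀) i • v i + x₀ := by rw [hrepr]; abel
      conv_lhs => rw [h5]
      have h6 : ∑ i, vb.repr (z - x₀) i • v i =
          ((2 : ℝ≥0) : ℝ) • ∑ a, ((1 + vb.repr (z - x₀) a) / 2) • v a - ∑ i, v i := by
        rw [Finset.smul_sum, ← Finset.sum_sub_distrib]
        refine Finset.sum_congr rfl fun a _ => ?_
        rw [smul_smul, NNReal.coe_ofNat]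
        module
      rw [h6]
      abel
  · obtain ⟨r, hr, rfl⟩ := mem_zonotope.1 hz
    have hN : (0 : ℝ) < Fintype.card ι + 1 := by positivity
    set N : ℝ := Fintype.card ι + 1 with hNdef
    have hsum : ∑ i, r i / N ≤ 1 := by
      rw [← Finset.sum_div, div_le_one hN]
      calc ∑ i, r i ≤ ∑ _i : ι, (1 : ℝ) := Finset.sum_le_sum fun i _ => (hr i).2
        _ ≤ N := by simp [hNdef]
    -- Shrunk by N = n + 1, the parallelotope translated to x₀ fits in the simplex with vertices x₀
    -- and the u_i. Taking n + 1 instead of n keeps N positive in dimension zero.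
    refine mem_smul_add_pointBody.2 ⟨∑ i, (r i / N) • u i + (1 - ∑ i, r i / N) • x₀, ?_, ?_⟩
    · have h1 := K.convex.sum_mem (t := (Finset.univ : Finset (Option ι)))
        (w := fun o => o.elim (1 - ∑ i, r i / N) fun i => r i / N)
        (z := fun o => o.elim x₀ u) (fun o _ => by
          cases o with
          | none => simpa using hsum
          | some i => exact div_nonneg (hr i).1 hN.le) (by simp [Fintype.sum_option])
        (fun o _ => by
          cases o with
          | none => exact hB 0
          | some i => exact hu' i)
      rw [Fintype.sum_option] at h1
      simp only [Option.elim] at h1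
      rwa [add_comm] at h1
    · have h2 : ∀ i, r i • v i = N • (r i / N) • u i - N • (r i / N) • x₀ := fun i => by
        rw [smul_smul, smul_smul, mul_div_cancel₀ _ hN.ne', ← smul_sub]
      have h3 : ((Fintype.card ι + 1 : ℝ≥0) : ℝ) = N := by simp [hNdef]
      rw [h3]
      simp only [h2, Finset.sum_sub_distrib, ← Finset.smul_sum, ← Finset.sum_smul]
      module

variable [MeasurableSpace E] [BorelSpace E]

theorem mixedVolume_le_of_subset (hι : Fintype.card ι = finrank ℝ E) {K K' : ι → ConvexBody E}
    {c : ℝ≥0} (x : ι → E) (h : ∀ i, (K i : Set E) ⊆ ↑(c • K' i + pointBody (x i))) :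
    mixedVolume K ≤ (c : ℝ) ^ Fintype.card ι * mixedVolume K' := by
  refine (mixedVolume_mono hι h).trans (le_of_eq ?_)
  rw [mixedVolume_translate hι (fun i => c • K' i) x, mixedVolume_smul hι K' fun _ => c]
  simp

/-- Multilinearity selects one segment from each zonotope, and a mixed volume of segments is an
absolute determinant. -/
theorem mixedVolume_zonotope [DecidableEq ι] (b : OrthonormalBasis ι ℝ E) {κ : Type*} [Fintype κ]
    (v : ι → κ → E) : mixedVolume (fun i => zonotope (v i)) =
      (∑ c : ι → κ, |(coordMatrix b fun i => v i (c i)).det|) /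
        (Nat.factorial (Fintype.card ι) : ℝ) := by
  have hι : Fintype.card ι = finrank ℝ E := (finrank_eq_card_basis b.toBasis).symm
  simp only [zonotope]
  rw [mixedVolume_sum hι fun i a => segmentBody (v i a), Finset.sum_div]
  exact Finset.sum_congr rfl fun c _ => mixedVolume_segmentBody b fun i => v i (c i)

end Zonotope

/-! ### The reverse Khovanskii–Teissier inequality and mixed volumes of ellipsoids. -/

section ReverseInequality

open scoped InnerProductSpace

variable {E : Type*} [NormedAddCommGroup E] [InnerProductSpace ℝ E] [FiniteDimensional ℝ E]
  [MeasurableSpace E] [BorelSpace E]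
variable {σ τ : Type*} [Fintype σ] [Fintype τ]

theorem sum_sum_arrow {α M : Type*} [DecidableEq σ] [DecidableEq τ] [Fintype α] [AddCommMonoid M]
    (F : (σ ⊕ τ → α) → M) :
    ∑ c : σ ⊕ τ → α, F c = ∑ f : σ → α, ∑ f' : τ → α, F (Sum.elim f f') := by
  rw [← (Equiv.sumArrowEquivProdArrow σ τ α).symm.sum_comp, Fintype.sum_prod_type]
  rfl

theorem coordMatrix_sum_elim (b : OrthonormalBasis (σ ⊕ τ) ℝ E) (p : σ → E) (q : τ → E) :
    coordMatrix b (Sum.elim p q) = (coordMatrix b p).fromRows (coordMatrix b q) := by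
  ext (i | i) k <;> rfl

theorem coordMatrix_basis_comp {ι κ : Type*} [Fintype ι] [DecidableEq ι]
    (b : OrthonormalBasis ι ℝ E) (f : κ → ι) :
    coordMatrix b (b ∘ f) = (1 : Matrix ι ι ℝ).submatrix f id := by
  ext i k
  simp [coordMatrix, Matrix.one_apply, b.inner_eq_ite, eq_comm]

theorem mixedVolume_zonotope_left [DecidableEq σ] [DecidableEq τ]
    (b : OrthonormalBasis (σ ⊕ τ) ℝ E) (p : σ → σ ⊕ τ → E) :
    mixedVolume (Sum.elim (fun i => zonotope (p i)) fun _ : τ => zonotope b) =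
      (∑ f : σ → σ ⊕ τ, ∑ f' : τ → σ ⊕ τ, |((coordMatrix b fun i => p i (f i)).fromRows
        ((1 : Matrix (σ ⊕ τ) (σ ⊕ τ) ℝ).submatrix f' id)).det|) /
          (Nat.factorial (Fintype.card (σ ⊕ τ)) : ℝ) := by
  have h1 : (Sum.elim (fun i => zonotope (p i)) fun _ : τ => zonotope b) =
      fun i => zonotope ((Sum.elim p fun _ => b : σ ⊕ τ → σ ⊕ τ → E) i) := by
    ext1 (i | i) <;> rfl
  rw [h1, mixedVolume_zonotope b, sum_sum_arrow]
  congr 1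
  refine Finset.sum_congr rfl fun f _ => Finset.sum_congr rfl fun f' _ => ?_
  rw [← coordMatrix_basis_comp b f', ← coordMatrix_sum_elim]
  congr 3
  ext1 (i | i) <;> rfl

theorem mixedVolume_zonotope_right [DecidableEq σ] [DecidableEq τ]
    (b : OrthonormalBasis (σ ⊕ τ) ℝ E) (q : τ → σ ⊕ τ → E) :
    mixedVolume (Sum.elim (fun _ : σ => zonotope b) fun i => zonotope (q i)) =
      (∑ f : σ → σ ⊕ τ, ∑ f' : τ → σ ⊕ τ,
        |(((1 : Matrix (σ ⊕ τ) (σ ⊕ τ) ℝ).submatrix f id).fromRows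
          (coordMatrix b fun i => q i (f' i))).det|) /
            (Nat.factorial (Fintype.card (σ ⊕ τ)) : ℝ) := by
  have h1 : (Sum.elim (fun _ : σ => zonotope b) fun i => zonotope (q i)) =
      fun i => zonotope ((Sum.elim (fun _ => b) q : σ ⊕ τ → σ ⊕ τ → E) i) := by
    ext1 (i | i) <;> rfl
  rw [h1, mixedVolume_zonotope b, sum_sum_arrow]
  congr 1
  refine Finset.sum_congr rfl fun f _ => Finset.sum_congr rfl fun f' _ => ?_
  rw [← coordMatrix_basis_comp b f, ← coordMatrix_sum_elim]
  congr 3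
  ext1 (i | i) <;> rfl

/-- The reverse Khovanskii–Teissier inequality for parallelotopes. -/
theorem mixedVolume_zonotope_le [DecidableEq σ] [DecidableEq τ]
    (b : OrthonormalBasis (σ ⊕ τ) ℝ E) (v : σ ⊕ τ → σ ⊕ τ → E) :
    mixedVolume (fun i => zonotope (v i)) ≤ (Nat.factorial (Fintype.card (σ ⊕ τ)) : ℝ) *
      mixedVolume (Sum.elim (fun i => zonotope (v (Sum.inl i))) fun _ : τ => zonotope b) *
      mixedVolume (Sum.elim (fun _ : σ => zonotope b) fun i => zonotope (v (Sum.inr i))) := by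
  have h0 : (0 : ℝ) < (Nat.factorial (Fintype.card (σ ⊕ τ)) : ℝ) := by
    exact_mod_cast Nat.factorial_pos _
  rw [mixedVolume_zonotope_left, mixedVolume_zonotope_right, mixedVolume_zonotope b,
    mul_div_cancel₀ _ h0.ne', mul_div_assoc']
  refine div_le_div_of_nonneg_right ?_ h0.le
  rw [sum_sum_arrow, Finset.sum_mul]
  refine Finset.sum_le_sum fun f _ => ?_
  rw [Finset.sum_comm (γ := σ → σ ⊕ τ), Finset.mul_sum]
  refine Finset.sum_le_sum fun f' _ => ?_
  have h1 : (fun i => v i ((Sum.elim f f' : σ ⊕ τ → σ ⊕ τ) i)) =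
      Sum.elim (fun i => v (Sum.inl i) (f i)) fun i => v (Sum.inr i) (f' i) := by
    ext1 (i | i) <;> rfl
  rw [h1, coordMatrix_sum_elim]
  exact abs_det_fromRows_le_mul _ _

/-- A reverse Khovanskii–Teissier inequality: the mixed volume of two groups of convex bodies is
bounded by the product of their mixed volumes with balls. -/
theorem exists_mixedVolume_le_mul (h : Fintype.card σ + Fintype.card τ = finrank ℝ E) :
    ∃ C : ℝ, 0 < C ∧ ∀ (L : σ → ConvexBody E) (K : τ → ConvexBody E),
      mixedVolume (Sum.elim L K) ≤ C * mixedVolume (Sum.elim L fun _ : τ => unitBall E) *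
        mixedVolume (Sum.elim (fun _ : σ => unitBall E) K) := by
  classical
  have hι : Fintype.card (σ ⊕ τ) = finrank ℝ E := by rw [Fintype.card_sum, h]
  obtain ⟨b⟩ := exists_orthonormalBasis hι
  set N : ℝ≥0 := Fintype.card (σ ⊕ τ) + 1 with hN
  set n := Fintype.card (σ ⊕ τ)
  have hNpos : (0 : ℝ) < (N : ℝ) := by rw [hN]; positivity
  have hfac : (0 : ℝ) < (Nat.factorial n : ℝ) := by exact_mod_cast Nat.factorial_pos _
  -- The factor 2 ^ n comes from replacing bodies by parallelotopes, n! from the inequality for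
  -- parallelotopes, and each N ^ n from returning to bodies and balls in one of the two factors.
  refine ⟨2 ^ n * (Nat.factorial n * (N ^ n * N ^ n)), by positivity, fun L K => ?_⟩
  have hclosed : IsClosed {X : σ ⊕ τ → ConvexBody E | mixedVolume X ≤
      2 ^ n * (Nat.factorial n * (N ^ n * N ^ n)) *
        mixedVolume (Sum.elim (fun i => X (Sum.inl i)) fun _ : τ => unitBall E) *
        mixedVolume (Sum.elim (fun _ : σ => unitBall E) fun i => X (Sum.inr i))} := by
    refine isClosed_le (continuous_mixedVolume hι) ((continuous_const.mul
      ((continuous_mixedVolume hι).comp ?_)).mul ((continuous_mixedVolume hι).comp ?_))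
    · refine continuous_pi fun i => ?_
      rcases i with i | i
      · exact continuous_apply (Sum.inl i)
      · exact continuous_const
    · refine continuous_pi fun i => ?_
      rcases i with i | i
      · exact continuous_const
      · exact continuous_apply (Sum.inr i)
  suffices hX : Sum.elim L K ∈ closure {X : σ ⊕ τ → ConvexBody E | mixedVolume X ≤
      2 ^ n * (Nat.factorial n * (N ^ n * N ^ n)) *
        mixedVolume (Sum.elim (fun i => X (Sum.inl i)) fun _ : τ => unitBall E) *
        mixedVolume (Sum.elim (fun _ : σ => unitBall E) fun i => X (Sum.inr i))} by
    have h1 := hclosed.closure_subset hX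
    rwa [Set.mem_ofPred_eq] at h1
  refine Metric.mem_closure_iff.2 fun ε hε => ?_
  -- Both sides are continuous, so approximants with interior suffice; flat bodies would have no
  -- nondegenerate inscribed simplex.
  obtain ⟨s, hs, hdist, hint⟩ := exists_polytopes_approx (Sum.elim L K) (half_pos hε)
  refine ⟨_, ?_, by rw [dist_comm]; exact hdist.trans_lt (half_lt_self hε)⟩
  rw [Set.mem_ofPred_eq]
  set X : σ ⊕ τ → ConvexBody E := fun a => hullBody (s a) (hs a)
  choose v x y hv1 hv2 using fun i => exists_zonotope_comparable b (X i) (hint i)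
  have h1 : mixedVolume X ≤ 2 ^ n * mixedVolume fun i => zonotope (v i) :=
    mixedVolume_le_of_subset hι x hv1
  have hQ := zonotope_subset_unitBall b
  have h2 : mixedVolume (Sum.elim (fun i => zonotope (v (Sum.inl i))) fun _ : τ => zonotope b) ≤
      N ^ n * mixedVolume (Sum.elim (fun i => X (Sum.inl i)) fun _ : τ => unitBall E) := by
    refine mixedVolume_le_of_subset hι (Sum.elim (fun i => y (Sum.inl i)) fun _ => 0) fun i => ?_
    rcases i with i | i
    · exact hv2 (Sum.inl i)
    · exact hQ
  have h3 : mixedVolume (Sum.elim (fun _ : σ => zonotope b) fun i => zonotope (v (Sum.inr i))) ≤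
      N ^ n * mixedVolume (Sum.elim (fun _ : σ => unitBall E) fun i => X (Sum.inr i)) := by
    refine mixedVolume_le_of_subset hι (Sum.elim (fun _ => 0) fun i => y (Sum.inr i)) fun i => ?_
    rcases i with i | i
    · exact hQ
    · exact hv2 (Sum.inr i)
  calc mixedVolume X ≤ 2 ^ n * mixedVolume fun i => zonotope (v i) := h1
    _ ≤ 2 ^ n * (Nat.factorial n *
        mixedVolume (Sum.elim (fun i => zonotope (v (Sum.inl i))) fun _ : τ => zonotope b) *
        mixedVolume (Sum.elim (fun _ : σ => zonotope b) fun i => zonotope (v (Sum.inr i)))) :=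
        mul_le_mul_of_nonneg_left (mixedVolume_zonotope_le b v) (by positivity)
    _ ≤ 2 ^ n * (Nat.factorial n *
        (N ^ n * mixedVolume (Sum.elim (fun i => X (Sum.inl i)) fun _ : τ => unitBall E)) *
        (N ^ n * mixedVolume (Sum.elim (fun _ : σ => unitBall E) fun i => X (Sum.inr i)))) := by
        have h4 := mixedVolume_nonneg hι
          (Sum.elim (fun _ : σ => zonotope b) fun i => zonotope (v (Sum.inr i)))
        have h5 := mixedVolume_nonneg hι
          (Sum.elim (fun i => X (Sum.inl i)) fun _ : τ => unitBall E)
        gcongr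
    _ = _ := by ring

/-- The sum of the absolute values of the minors of order `card σ`. -/
noncomputable def minorSum (σ : Type*) [Fintype σ] [DecidableEq σ] {J : Type*} [Fintype J]
    (A : Matrix J J ℝ) : ℝ :=
  ∑ f : σ → J, ∑ g : σ → J, |(A.submatrix f g).det|

/-- The mixed volume of balls and ellipsoids is comparable to the minors of the linear map. -/
theorem exists_mixedVolume_image_comparable [DecidableEq σ] [DecidableEq τ]
    (b : OrthonormalBasis (σ ⊕ τ) ℝ E) :
    ∃ c C : ℝ, 0 < c ∧ 0 < C ∧ ∀ A : E →L[ℝ] E,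
      c * minorSum σ (coordMatrix b fun a => A (b a)) ≤
        mixedVolume (Sum.elim (fun _ : σ => image A (unitBall E)) fun _ : τ => unitBall E) ∧
      mixedVolume (Sum.elim (fun _ : σ => image A (unitBall E)) fun _ : τ => unitBall E) ≤
        C * minorSum σ (coordMatrix b fun a => A (b a)) := by
  have hι : Fintype.card (σ ⊕ τ) = finrank ℝ E := (finrank_eq_card_basis b.toBasis).symm
  set N : ℝ≥0 := Fintype.card (σ ⊕ τ) + 1 with hN
  set n := Fintype.card (σ ⊕ τ)
  have hNpos : (0 : ℝ) < (N : ℝ) := by rw [hN]; positivity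
  have hfac : (0 : ℝ) < (Nat.factorial n : ℝ) := by exact_mod_cast Nat.factorial_pos _
  set a := Fintype.card (σ → σ ⊕ τ)
  set a' := Fintype.card (τ → σ ⊕ τ)
  refine ⟨(N ^ n * (a + 1) * Nat.factorial n)⁻¹, 2 ^ n * (a' + 1) / Nat.factorial n,
    by positivity, by positivity, fun A => ?_⟩
  set H := coordMatrix b fun a => A (b a) with hH
  -- Up to n!, `D` is the mixed volume with cubes in place of balls. It mediates between the
  -- ellipsoids, through inclusions, and the minors, through the determinant bounds.
  set D : ℝ := ∑ f : σ → σ ⊕ τ, ∑ f' : τ → σ ⊕ τ, |((H.submatrix f id).fromRows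
    ((1 : Matrix (σ ⊕ τ) (σ ⊕ τ) ℝ).submatrix f' id)).det| with hD
  have hDnn : 0 ≤ D := by positivity
  have hQ : mixedVolume (Sum.elim (fun _ : σ => image A (zonotope b)) fun _ : τ => zonotope b) =
      D / Nat.factorial n := by
    have h1 := mixedVolume_zonotope_left b fun _ : σ => fun a => A (b a)
    simp only [image_zonotope]
    exact h1
  have himage : ∀ (K K' : ConvexBody E) (c : ℝ≥0) (x : E), (K : Set E) ⊆ ↑(c • K' + pointBody x) →
      (image A K : Set E) ⊆ ↑(c • image A K' + pointBody (A x)) := by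
    rintro K K' c x h _ ⟨z, hz, rfl⟩
    obtain ⟨u, hu, rfl⟩ := mem_smul_add_pointBody.1 (h hz)
    exact mem_smul_add_pointBody.2 ⟨A u, ⟨u, hu, rfl⟩, by simp⟩
  have hlow : D / Nat.factorial n ≤ N ^ n *
      mixedVolume (Sum.elim (fun _ : σ => image A (unitBall E)) fun _ : τ => unitBall E) := by
    rw [← hQ]
    refine mixedVolume_le_of_subset hι (Sum.elim (fun _ => A 0) fun _ => 0) fun i => ?_
    rcases i with i | i
    · exact himage _ _ _ _ (zonotope_subset_unitBall b)
    · exact zonotope_subset_unitBall b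
  have hup : mixedVolume (Sum.elim (fun _ : σ => image A (unitBall E)) fun _ : τ => unitBall E) ≤
      2 ^ n * (D / Nat.factorial n) := by
    rw [← hQ]
    refine (mixedVolume_le_of_subset hι (c := 2)
      (K' := Sum.elim (fun _ : σ => image A (zonotope b)) fun _ : τ => zonotope b)
      (Sum.elim (fun _ => A (-∑ a, b a)) fun _ => -∑ a, b a) fun i => ?_).trans_eq
      (by rw [NNReal.coe_ofNat])
    rcases i with i | i
    · exact himage _ _ _ _ (unitBall_subset_zonotope b)
    · exact unitBall_subset_zonotope b
  have hD1 : D ≤ (a' + 1) * minorSum σ H := by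
    have h1 : D ≤ a' * minorSum σ H := by
      rw [hD, minorSum, Finset.mul_sum]
      refine Finset.sum_le_sum fun f _ => ?_
      calc _ ≤ ∑ _f' : τ → σ ⊕ τ, ∑ g : σ → σ ⊕ τ, |(H.submatrix f g).det| :=
            Finset.sum_le_sum fun f' _ => abs_det_fromRows_one_le (H.submatrix f id) f'
        _ = _ := by rw [Finset.sum_const, Finset.card_univ, nsmul_eq_mul]
    have h2 : 0 ≤ minorSum σ H := by unfold minorSum; positivity
    linarith
  have hD2 : minorSum σ H ≤ (a + 1) * D := by
    have h1 : minorSum σ H ≤ a * D := by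
      rw [hD, minorSum, Finset.mul_sum]
      refine Finset.sum_le_sum fun f _ => ?_
      calc _ ≤ ∑ _g : σ → σ ⊕ τ, ∑ f' : τ → σ ⊕ τ, |((H.submatrix f id).fromRows
            ((1 : Matrix (σ ⊕ τ) (σ ⊕ τ) ℝ).submatrix f' id)).det| :=
            Finset.sum_le_sum fun g _ => abs_minor_le_sum_abs_det (H.submatrix f id) g
        _ = _ := by rw [Finset.sum_const, Finset.card_univ, nsmul_eq_mul]
    linarith
  constructor
  · rw [inv_mul_le_iff₀ (by positivity)]
    have h1 : D ≤ N ^ n * mixedVolume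
        (Sum.elim (fun _ : σ => image A (unitBall E)) fun _ : τ => unitBall E) *
          Nat.factorial n := (div_le_iff₀ hfac).1 hlow
    calc minorSum σ H ≤ (a + 1) * D := hD2
      _ ≤ (a + 1) * (N ^ n * mixedVolume
        (Sum.elim (fun _ : σ => image A (unitBall E)) fun _ : τ => unitBall E) *
          Nat.factorial n) := mul_le_mul_of_nonneg_left h1 (by positivity)
      _ = _ := by ring
  · calc _ ≤ 2 ^ n * (D / Nat.factorial n) := hup
      _ ≤ 2 ^ n * ((a' + 1) * minorSum σ H / Nat.factorial n) := by gcongr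
      _ = _ := by ring

end ReverseInequality

/-! ### Polarization, bounds and group action on the cones of valuations. -/

section Valuations

variable {E : Type*} [NormedAddCommGroup E] [InnerProductSpace ℝ E] [FiniteDimensional ℝ E]
  [MeasurableSpace E] [BorelSpace E]

/-- Full multilinearity is applied with block diagonal coefficients, the identity on the second
group; the only index maps that survive are α on the first group and the identity on the second. -/
theorem mixedVolume_sum_smul_left {σ τ κ : Type*} [Fintype σ] [DecidableEq σ] [Fintype τ]
    [Fintype κ] (h : Fintype.card σ + Fintype.card τ = finrank ℝ E) (L : κ → ConvexBody E)
    (K : τ → ConvexBody E) (s : σ → κ → ℝ≥0) :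
    mixedVolume (Sum.elim (fun i => ∑ a, s i a • L a) K) =
      ∑ α : σ → κ, (∏ i, (s i (α i) : ℝ)) * mixedVolume (Sum.elim (fun i => L (α i)) K) := by
  classical
  have hι : Fintype.card (σ ⊕ τ) = finrank ℝ E := by rw [Fintype.card_sum, h]
  let S : σ ⊕ τ → κ ⊕ τ → ℝ≥0 := Sum.elim (fun i => Sum.elim (s i) fun _ => 0)
    fun j => Sum.elim (fun _ => 0) fun j' => if j' = j then 1 else 0
  have h1 := mixedVolume_sum_smul hι (Sum.elim L K) S
  have h2 : (fun i => ∑ a, S i a • Sum.elim L K a) =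
      Sum.elim (fun i => ∑ a, s i a • L a) K := by
    ext1 (i | i)
    · simp [S, Fintype.sum_sum_type]
    · simp [S, Fintype.sum_sum_type, ite_smul]
  rw [h2] at h1
  rw [h1]
  symm
  refine Finset.sum_of_injOn (fun α : σ → κ => (Sum.map α id : σ ⊕ τ → κ ⊕ τ)) ?_
    (fun _ _ => Finset.mem_coe.2 (Finset.mem_univ _)) ?_ ?_
  · intro α _ β _ hαβ
    funext i
    exact Sum.inl_injective (congrFun hαβ (Sum.inl i))
  · intro β _ hβ
    suffices h0 : ∏ i, ((S i (β i) : ℝ≥0) : ℝ) = 0 by rw [h0, zero_mul]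
    by_contra hne
    have h3 := fun i => Finset.prod_ne_zero_iff.1 hne i (Finset.mem_univ i)
    have h4 : ∀ i : σ, ∃ a, β (Sum.inl i) = Sum.inl a := fun i => by
      rcases hb : β (Sum.inl i) with a | a
      · exact ⟨a, rfl⟩
      · exact absurd (by simp [S, hb]) (h3 (Sum.inl i))
    choose α hα using h4
    refine hβ ⟨α, by simp, ?_⟩
    ext1 (i | i)
    · exact (hα i).symm
    · rcases hb : β (Sum.inr i) with a | a
      · exact absurd (by simp [S, hb]) (h3 (Sum.inr i))
      · by_cases ha : a = i
        · simp [ha]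
        · exact absurd (by simp [S, hb, ha]) (h3 (Sum.inr i))
  · intro α _
    have h5 : (fun i => Sum.elim L K ((Sum.map α id : σ ⊕ τ → κ ⊕ τ) i)) =
        Sum.elim (fun i => L (α i)) K := by
      ext1 (i | i) <;> rfl
    rw [h5]
    congr 1
    rw [Fintype.prod_sum_type]
    simp [S]

theorem mixedVolume_elim_swap {σ τ : Type*} [Fintype σ] [Fintype τ]
    (h : Fintype.card σ + Fintype.card τ = finrank ℝ E) (L : σ → ConvexBody E)
    (K : τ → ConvexBody E) : mixedVolume (Sum.elim L K) = mixedVolume (Sum.elim K L) := by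
  rw [← mixedVolume_comp_equiv (by rw [Fintype.card_sum, h]) (Equiv.sumComm σ τ) (Sum.elim K L)]
  congr 1
  ext1 (i | i) <;> rfl

theorem mixedVolume_elim_comp_equiv {σ σ' τ τ' : Type*} [Fintype σ] [Fintype σ'] [Fintype τ]
    [Fintype τ'] (h : Fintype.card σ + Fintype.card τ = finrank ℝ E) (e : σ ≃ σ') (e' : τ ≃ τ')
    (L : σ' → ConvexBody E) (K : τ' → ConvexBody E) :
    mixedVolume (Sum.elim (fun i => L (e i)) fun i => K (e' i)) = mixedVolume (Sum.elim L K) := by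
  rw [← mixedVolume_comp_equiv (by rw [Fintype.card_sum, h]) (Equiv.sumCongr e e') (Sum.elim L K)]
  congr 1
  ext1 (i | i) <;> rfl

omit [MeasurableSpace E] [BorelSpace E] in
/-- Near a tuple of convex bodies, all tuples are contained in a fixed multiple of the ball. -/
theorem eventually_subset_smul_unitBall {σ : Type*} [Finite σ] (L₀ : σ → ConvexBody E) :
    ∃ R : ℝ≥0, ∀ᶠ L in 𝓝 L₀, ∀ j, (L j : Set E) ⊆ ↑(R • unitBall E) := by
  cases nonempty_fintype σ
  choose r hr using fun j => (L₀ j).isBounded.exists_norm_le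
  let R : ℝ := ∑ j, |r j| + 1
  have hR : 0 < R := by positivity
  refine ⟨⟨R, hR.le⟩, ?_⟩
  filter_upwards [Metric.ball_mem_nhds L₀ one_pos] with L hL j x hx
  have h1 : dist (L j) (L₀ j) < 1 := (dist_le_pi_dist L L₀ j).trans_lt hL
  obtain ⟨y, hy, hxy⟩ := exists_dist_lt_of_dist_lt h1 hx
  have h2 : ‖y‖ ≤ |r j| := (hr j y hy).trans (le_abs_self _)
  have h3 : |r j| ≤ ∑ j, |r j| :=
    Finset.single_le_sum (f := fun j => |r j|) (fun _ _ => abs_nonneg _) (Finset.mem_univ j)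
  have h4 : ‖x‖ ≤ R := by
    rw [dist_eq_norm] at hxy
    have := norm_le_norm_add_norm_sub' x y
    simp only [R]
    linarith
  refine ⟨R⁻¹ • x, ?_, ?_⟩
  · change R⁻¹ • x ∈ Metric.closedBall (0 : E) 1
    rw [mem_closedBall_zero_iff, norm_smul, norm_inv, Real.norm_of_nonneg hR.le,
      inv_mul_le_iff₀ hR, mul_one]
    exact h4
  · change R • R⁻¹ • x = x
    rw [smul_smul, mul_inv_cancel₀ hR.ne', one_smul]

theorem mixedVolume_le_pow_mul {σ τ : Type*} [Fintype σ] [Fintype τ]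
    (h : Fintype.card σ + Fintype.card τ = finrank ℝ E) {R : ℝ≥0} {L : σ → ConvexBody E}
    (hL : ∀ j, (L j : Set E) ⊆ ↑(R • unitBall E)) (K : τ → ConvexBody E) :
    mixedVolume (Sum.elim L K) ≤ (R : ℝ) ^ Fintype.card σ *
      mixedVolume (Sum.elim (fun _ : σ => unitBall E) K) := by
  have hι : Fintype.card (σ ⊕ τ) = finrank ℝ E := by rw [Fintype.card_sum, h]
  refine (mixedVolume_mono hι (K' := fun i => (Sum.elim (fun _ => R) fun _ => 1 : σ ⊕ τ → ℝ≥0) i •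
    (Sum.elim (fun _ => unitBall E) K : σ ⊕ τ → ConvexBody E) i) fun i => ?_).trans_eq ?_
  · rcases i with i | i
    · exact hL i
    · simp
  · rw [mixedVolume_smul hι, Fintype.prod_sum_type]
    simp

variable {i : ℕ} {μ : Measure (Fin (finrank ℝ E - i) → ConvexBody E)} {φ : ConvexBody E → ℝ}

theorem card_fin_add_card_fin_sub (hi : i ≤ finrank ℝ E) :
    Fintype.card (Fin i) + Fintype.card (Fin (finrank ℝ E - i)) = finrank ℝ E := by
  simp only [Fintype.card_fin]
  omega

theorem continuous_mixedVolume_left {σ τ : Type*} [Fintype σ] [Fintype τ]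
    (h : Fintype.card σ + Fintype.card τ = finrank ℝ E) (K : τ → ConvexBody E) :
    Continuous fun L : σ → ConvexBody E => mixedVolume (Sum.elim L K) := by
  refine (continuous_mixedVolume (by rw [Fintype.card_sum, h])).comp (continuous_pi fun j => ?_)
  rcases j with j | j
  · exact continuous_apply j
  · exact continuous_const

theorem continuous_mixedVolume_right {σ τ : Type*} [Fintype σ] [Fintype τ]
    (h : Fintype.card σ + Fintype.card τ = finrank ℝ E) (L : σ → ConvexBody E) :
    Continuous fun K : τ → ConvexBody E => mixedVolume (Sum.elim L K) := by
  refine (continuous_mixedVolume (by rw [Fintype.card_sum, h])).comp (continuous_pi fun j => ?_)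
  rcases j with j | j
  · exact continuous_const
  · exact continuous_apply j

omit [FiniteDimensional ℝ E] [MeasurableSpace E] [BorelSpace E] in
theorem image_comp (A B : E →L[ℝ] E) (K : ConvexBody E) :
    image A (image B K) = image (A * B) K := by
  refine ConvexBody.ext ?_
  exact Set.image_image A B K

omit [FiniteDimensional ℝ E] [MeasurableSpace E] [BorelSpace E] in
theorem image_one (K : ConvexBody E) : image 1 K = K :=
  ConvexBody.ext (Set.image_id (K : Set E))

/-- The homeomorphism of the space of tuples of convex bodies induced by a linear isomorphism. -/
def imageHomeomorph (τ : Type*) (g : (E →L[ℝ] E)ˣ) :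
    (τ → ConvexBody E) ≃ₜ (τ → ConvexBody E) where
  toFun K j := image (g : E →L[ℝ] E) (K j)
  invFun K j := image (↑g⁻¹ : E →L[ℝ] E) (K j)
  left_inv K := funext fun j => by
    change image _ (image _ (K j)) = K j
    rw [image_comp, Units.inv_mul, image_one]
  right_inv K := funext fun j => by
    change image _ (image _ (K j)) = K j
    rw [image_comp, Units.mul_inv, image_one]
  continuous_toFun := continuous_pi fun j => (continuous_image _).comp (continuous_apply j)
  continuous_invFun := continuous_pi fun j => (continuous_image _).comp (continuous_apply j)

namespace Represents

/-- Every tuple of bodies lies in a common multiple of the ball, so monotonicity reduces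
integrability to the ball, where it is assumed. -/
theorem integrable_mixedVolume (hμ : Represents i μ φ) (hi : i ≤ finrank ℝ E)
    (L : Fin i → ConvexBody E) : Integrable (fun K => mixedVolume (Sum.elim L K)) μ := by
  have h := card_fin_add_card_fin_sub hi
  obtain ⟨R, hR⟩ := eventually_subset_smul_unitBall L
  refine (hμ.integrable.const_mul ((R : ℝ) ^ Fintype.card (Fin i))).mono'
    (continuous_mixedVolume_right h L).aestronglyMeasurable (Eventually.of_forall fun K => ?_)
  rw [Real.norm_of_nonneg (mixedVolume_nonneg (by rw [Fintype.card_sum, h]) _)]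
  exact mixedVolume_le_pow_mul h hR.self_of_nhds K

theorem polarization_eq_integral (hμ : Represents i μ φ) (hi : i ≤ finrank ℝ E)
    (L : Fin i → ConvexBody E) :
    polarization φ L = ∫ K, mixedVolume (Sum.elim L K) ∂μ := by
  have h := card_fin_add_card_fin_sub hi
  refine polarization_eq_of_expansion
    (fun α : Fin i → Fin i => ∫ K, mixedVolume (Sum.elim (fun j => L (α j)) K) ∂μ) ?_ ?_
  · intro α σ
    refine integral_congr_ae (Eventually.of_forall fun K => ?_)
    exact mixedVolume_elim_comp_equiv h σ (Equiv.refl _) (fun j => L (α j)) K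
  · intro t
    rw [hμ.eq_integral]
    simp only [mixedVolume_sum_smul_left h L _ fun _ => t]
    rw [integral_finsetSum _ fun α _ => (hμ.integrable_mixedVolume hi _).const_mul _]
    simp only [integral_const_mul]

theorem apply_eq_polarization (hμ : Represents i μ φ) (hi : i ≤ finrank ℝ E) (L : ConvexBody E) :
    φ L = polarization φ fun _ : Fin i => L := by
  rw [hμ.polarization_eq_integral hi, hμ.eq_integral]

/-- Dominated convergence: near a given tuple, all tuples lie in one multiple of the ball, which
provides the integrable bound. -/
theorem continuous_polarization (hμ : Represents i μ φ) (hi : i ≤ finrank ℝ E) :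
    Continuous (polarization φ : (Fin i → ConvexBody E) → ℝ) := by
  have h := card_fin_add_card_fin_sub hi
  rw [show (polarization φ : (Fin i → ConvexBody E) → ℝ) =
    fun L => ∫ K, mixedVolume (Sum.elim L K) ∂μ from funext (hμ.polarization_eq_integral hi)]
  refine continuous_iff_continuousAt.2 fun L₀ => ?_
  obtain ⟨R, hR⟩ := eventually_subset_smul_unitBall L₀
  refine continuousAt_of_dominated
    (bound := fun K => (R : ℝ) ^ Fintype.card (Fin i) *
      mixedVolume (Sum.elim (fun _ : Fin i => unitBall E) K))
    (Eventually.of_forall fun L => (continuous_mixedVolume_right h L).aestronglyMeasurable) ?_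
    (hμ.integrable.const_mul _)
    (Eventually.of_forall fun K => (continuous_mixedVolume_left h K).continuousAt)
  filter_upwards [hR] with L hL
  refine Eventually.of_forall fun K => ?_
  rw [Real.norm_of_nonneg (mixedVolume_nonneg (by rw [Fintype.card_sum, h]) _)]
  exact mixedVolume_le_pow_mul h hL K

/-- The reverse inequality, integrated over K, separates the dependence on L from the finite number
`I`. Using I + 1 keeps the constant positive when `I` vanishes. -/
theorem exists_polarization_le (hμ : Represents i μ φ) (hi : i ≤ finrank ℝ E) :
    ∃ C : ℝ, 0 < C ∧ ∀ L : Fin i → ConvexBody E, polarization φ L ≤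
      C * mixedVolume (Sum.elim (fun _ : Fin (finrank ℝ E - i) => unitBall E) L) := by
  have h := card_fin_add_card_fin_sub hi
  obtain ⟨C, hC, hle⟩ := exists_mixedVolume_le_mul h
  have hnn : ∀ X : Fin i ⊕ Fin (finrank ℝ E - i) → ConvexBody E, 0 ≤ mixedVolume X := fun X =>
    mixedVolume_nonneg (by rw [Fintype.card_sum, h]) X
  set I := ∫ K, mixedVolume (Sum.elim (fun _ : Fin i => unitBall E) K) ∂μ
  have hI : 0 ≤ I := integral_nonneg fun K => hnn _
  refine ⟨C * (I + 1), by positivity, fun L => ?_⟩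
  rw [hμ.polarization_eq_integral hi, ← mixedVolume_elim_swap h]
  calc ∫ K, mixedVolume (Sum.elim L K) ∂μ
      ≤ ∫ K, C * mixedVolume (Sum.elim L fun _ => unitBall E) *
        mixedVolume (Sum.elim (fun _ : Fin i => unitBall E) K) ∂μ :=
        integral_mono (hμ.integrable_mixedVolume hi L) (hμ.integrable.const_mul _) (hle L)
    _ = C * mixedVolume (Sum.elim L fun _ => unitBall E) * I := integral_const_mul _ _
    _ ≤ C * (I + 1) * mixedVolume (Sum.elim L fun _ => unitBall E) := by
        have := mul_nonneg hC.le (hnn (Sum.elim L fun _ => unitBall E))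
        linarith

/-- Since V(g⁻¹L, K) = |det g⁻¹| V(L, gK), the translate is represented by the pushforward of the
measure under g, scaled by |det g⁻¹|. In particular the action preserves the cone. -/
theorem act (hμ : Represents i μ φ) (hi : i ≤ finrank ℝ E) (g : (E →L[ℝ] E)ˣ) :
    Represents i (ENNReal.ofReal |(↑g⁻¹ : E →L[ℝ] E).det| • μ.map (imageHomeomorph _ g))
      (act g φ) := by
  have h := card_fin_add_card_fin_sub hi
  have hι : Fintype.card (Fin i ⊕ Fin (finrank ℝ E - i)) = finrank ℝ E := by
    rw [Fintype.card_sum, h]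
  have hV : ∀ (L : ConvexBody E) (K : Fin (finrank ℝ E - i) → ConvexBody E),
      mixedVolume (Sum.elim (fun _ : Fin i => image (↑g⁻¹ : E →L[ℝ] E) L) K) =
        |(↑g⁻¹ : E →L[ℝ] E).det| *
          mixedVolume (Sum.elim (fun _ : Fin i => L) (imageHomeomorph _ g K)) := by
    intro L K
    rw [← mixedVolume_image hι]
    congr 1
    ext1 (j | j)
    · rfl
    · change K j = image _ (image _ (K j))
      rw [image_comp, Units.inv_mul, image_one]
  have hdet : |(↑g⁻¹ : E →L[ℝ] E).det| ≠ 0 := by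
    rw [abs_ne_zero]
    have h1 : (↑g⁻¹ : E →L[ℝ] E).det * (g : E →L[ℝ] E).det = 1 := by
      rw [ContinuousLinearMap.det, ContinuousLinearMap.det, ← LinearMap.det_comp,
        ← ContinuousLinearMap.toLinearMap_comp]
      change LinearMap.det (((↑g⁻¹ : E →L[ℝ] E) * (g : E →L[ℝ] E) : E →L[ℝ] E) : E →ₗ[ℝ] E) = 1
      rw [Units.inv_mul]
      exact LinearMap.det_id
    exact left_ne_zero_of_mul_eq_one h1
  have hemb : MeasurableEmbedding (imageHomeomorph (Fin (finrank ℝ E - i)) g) :=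
    (imageHomeomorph _ g).measurableEmbedding
  have hreg := hμ.regular
  refine ⟨?_, ?_, fun L => ?_⟩
  · have := Measure.Regular.map (μ := μ) (imageHomeomorph (Fin (finrank ℝ E - i)) g)
    exact Measure.Regular.smul ENNReal.ofReal_ne_top
  · refine Integrable.smul_measure ?_ ENNReal.ofReal_ne_top
    rw [hemb.integrable_map_iff]
    have h2 := hμ.integrable_mixedVolume hi fun _ => image (↑g⁻¹ : E →L[ℝ] E) (unitBall E)
    simp only [hV] at h2
    exact (integrable_const_mul_iff (isUnit_iff_ne_zero.2 hdet) _).1 h2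
  · rw [integral_smul_measure, hemb.integral_map, ENNReal.toReal_ofReal (abs_nonneg _),
      smul_eq_mul, ← integral_const_mul]
    change φ (image _ L) = _
    rw [hμ.eq_integral]
    simp only [hV]

end Represents

theorem regular_dirac {X : Type*} [TopologicalSpace X] [MeasurableSpace X] [T1Space X]
    [OpensMeasurableSpace X] (x : X) : (Measure.dirac x).Regular where
  lt_top_of_isCompact _ _ := measure_lt_top _ _
  outerRegular A hA r hr := by
    by_cases hx : x ∈ A
    · refine ⟨Set.univ, Set.subset_univ _, isOpen_univ, ?_⟩
      rwa [Measure.dirac_apply_of_mem (Set.mem_univ x), ← Measure.dirac_apply_of_mem hx]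
    · refine ⟨{x}ᶜ, fun y hy h => hx (by rwa [← Set.mem_singleton_iff.1 h]),
        isOpen_compl_singleton, ?_⟩
      rw [Measure.dirac_apply' _ isOpen_compl_singleton.measurableSet]
      simpa using pos_of_gt hr
  innerRegular U hU r hr := by
    have hx : x ∈ U := by
      by_contra hx
      rw [Measure.dirac_apply' _ hU.measurableSet] at hr
      simp [hx] at hr
    refine ⟨{x}, by simpa using hx, isCompact_singleton, ?_⟩
    rwa [Measure.dirac_apply_of_mem (Set.mem_singleton x), ← Measure.dirac_apply_of_mem hx]

/-- The valuation `L ↦ V(L[i], B[n - i])` is strictly positive. -/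
theorem strictlyPPositive_mixedVolume_unitBall (hi : i ≤ finrank ℝ E) :
    StrictlyPPositive i fun L : ConvexBody E => mixedVolume
      (Sum.elim (fun _ : Fin i => L) fun _ : Fin (finrank ℝ E - i) => unitBall E) := by
  have h := card_fin_add_card_fin_sub hi
  have hrep : Represents i
      (Measure.dirac fun _ : Fin (finrank ℝ E - i) => unitBall E) fun L : ConvexBody E =>
        mixedVolume (Sum.elim (fun _ : Fin i => L) fun _ : Fin (finrank ℝ E - i) => unitBall E) :=
    ⟨regular_dirac _, (integrable_dirac (by simp)), fun L => 
      (integral_dirac (fun K => mixedVolume (Sum.elim (fun _ : Fin i => L) K)) _).symm⟩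
  refine ⟨⟨_, hrep⟩, 1, one_pos, fun L => ?_⟩
  rw [hrep.polarization_eq_integral hi, integral_dirac, one_mul, mixedVolume_elim_swap h]

end Valuations

/-! ### Growth rates of comparable sequences. -/

section RootAsymptotics

theorem tendsto_const_rpow_one_div {c : ℝ} (hc : 0 < c) :
    Tendsto (fun p : ℕ => c ^ (1 / (p : ℝ))) atTop (𝓝 1) := by
  simpa [Function.comp_def] using (Real.continuousAt_const_rpow (b := 0) hc.ne').tendsto.comp
    (tendsto_one_div_atTop_nhds_zero_nat (𝕜 := ℝ))

/-- Comparable sequences have the same exponential growth rate. -/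
theorem tendsto_rpow_one_div_of_comparable {x y : ℕ → ℝ} {c C r : ℝ} (hc : 0 < c) (hC : 0 < C)
    (hx : ∀ p, 0 ≤ x p) (hl : ∀ᶠ p in atTop, c * x p ≤ y p) (hu : ∀ᶠ p in atTop, y p ≤ C * x p)
    (h : Tendsto (fun p : ℕ => x p ^ (1 / (p : ℝ))) atTop (𝓝 r)) :
    Tendsto (fun p : ℕ => y p ^ (1 / (p : ℝ))) atTop (𝓝 r) := by
  have h1 := (tendsto_const_rpow_one_div hc).mul h
  have h2 := (tendsto_const_rpow_one_div hC).mul h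
  rw [one_mul] at h1 h2
  refine tendsto_of_tendsto_of_tendsto_of_le_of_le' h1 h2 ?_ ?_
  · filter_upwards [hl] with p hp
    rw [← Real.mul_rpow hc.le (hx p)]
    exact Real.rpow_le_rpow (mul_nonneg hc.le (hx p)) hp (by positivity)
  -- The lower bound is used here too: it makes `y p` nonnegative, as monotonicity of the root
  -- requires.
  · filter_upwards [hl, hu] with p hp hp'
    rw [← Real.mul_rpow hC.le (hx p)]
    exact Real.rpow_le_rpow ((mul_nonneg hc.le (hx p)).trans hp) hp' (by positivity)

end RootAsymptotics

/-! ### Gelfand's formula and continuity of the spectral radius. -/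

section SpectralRadius

attribute [local instance] Matrix.linftyOpNormedRing Matrix.linftyOpNormedAlgebra

variable {X : Type*} [Fintype X] [DecidableEq X]

/-- The largest absolute value of the eigenvalues of a complex matrix. -/
noncomputable def matrixSpectralRadius (M : Matrix X X ℂ) : ℝ :=
  (spectralRadius ℂ M).toReal

variable [Nonempty X]

theorem spectralRadius_ne_top (M : Matrix X X ℂ) : spectralRadius ℂ M ≠ ⊤ :=
  ((spectrum.spectralRadius_le_nnnorm M).trans_lt ENNReal.coe_lt_top).ne

theorem tendsto_norm_pow_matrixSpectralRadius (M : Matrix X X ℂ) :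
    Tendsto (fun p : ℕ => ‖M ^ p‖ ^ (1 / (p : ℝ))) atTop (𝓝 (matrixSpectralRadius M)) := by
  have h := (ENNReal.tendsto_toReal (spectralRadius_ne_top M)).comp
    (spectrum.pow_norm_pow_one_div_tendsto_nhds_spectralRadius M)
  refine h.congr fun p => ?_
  exact ENNReal.toReal_ofReal (by positivity)

theorem matrixSpectralRadius_le_norm_pow (M : Matrix X X ℂ) (p : ℕ) :
    matrixSpectralRadius M ≤ ‖M ^ (p + 1)‖ ^ (1 / ((p + 1 : ℕ) : ℝ)) := by
  have h := spectrum.spectralRadius_le_pow_nnnorm_pow_one_div ℂ M p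
  rw [nnnorm_one, ENNReal.coe_one, ENNReal.one_rpow, mul_one] at h
  have h2 := ENNReal.toReal_mono (ENNReal.rpow_ne_top_of_nonneg (by positivity)
    ENNReal.coe_ne_top) h
  rw [← ENNReal.toReal_rpow] at h2
  simpa [matrixSpectralRadius] using h2

theorem norm_le_matrixSpectralRadius {M : Matrix X X ℂ} {z : ℂ} (hz : z ∈ spectrum ℂ M) :
    ‖z‖ ≤ matrixSpectralRadius M := by
  have h : (‖z‖₊ : ENNReal) ≤ spectralRadius ℂ M :=
    le_iSup₂ (f := fun z (_ : z ∈ spectrum ℂ M) => (‖z‖₊ : ENNReal)) z hz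
  simpa [matrixSpectralRadius] using ENNReal.toReal_mono (spectralRadius_ne_top M) h

theorem exists_norm_eq_matrixSpectralRadius (M : Matrix X X ℂ) :
    ∃ z ∈ spectrum ℂ M, ‖z‖ = matrixSpectralRadius M := by
  obtain ⟨z, hz, h⟩ := spectrum.exists_nnnorm_eq_spectralRadius M
  exact ⟨z, hz, by rw [matrixSpectralRadius, ← h]; simp⟩

/-- The characteristic polynomial at z is the product of the z - r over the eigenvalues r, and each
factor has norm at least ‖z‖ - a. -/
theorem pow_le_norm_eval_charpoly (M : Matrix X X ℂ) {z : ℂ} {a : ℝ}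
    (h : matrixSpectralRadius M ≤ a) (ha : a ≤ ‖z‖) :
    (‖z‖ - a) ^ Fintype.card X ≤ ‖M.charpoly.eval z‖ := by
  have hs : M.charpoly.Splits := IsAlgClosed.splits _
  have hcard : M.charpoly.roots.card = Fintype.card X := by
    rw [← hs.natDegree_eq_card_roots, M.charpoly_natDegree_eq_dim]
  rw [hs.eval_eq_prod_roots_of_monic M.charpoly_monic, ← hcard]
  have h1 : ‖(M.charpoly.roots.map fun r => z - r).prod‖ =
      (M.charpoly.roots.map fun r => ‖z - r‖).prod := by
    refine (map_multiset_prod (normHom : ℂ →*₀ ℝ) _).trans ?_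
    rw [Multiset.map_map]
    rfl
  rw [h1, ← Multiset.card_map (fun _ : ℂ => ‖z‖ - a) M.charpoly.roots, ← Multiset.prod_replicate,
    ← Multiset.map_const', Multiset.map_map]
  refine Multiset.prod_map_le_prod_map₀ _ _ (fun r _ => sub_nonneg.2 ha) fun r hr => ?_
  have h2 : r ∈ spectrum ℂ M := Matrix.mem_spectrum_of_isRoot_charpoly
    ((Polynomial.mem_roots M.charpoly_monic.ne_zero).1 hr)
  have h3 := (norm_le_matrixSpectralRadius h2).trans h
  have h4 := norm_sub_norm_le z r
  simp only [Function.comp_apply]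
  linarith

/-- For lower semicontinuity, take z a dominant eigenvalue of M: a nearby matrix with all
eigenvalues of norm at most a < ‖z‖ would have characteristic polynomial bounded away from 0 at z.
For upper semicontinuity, the radius is bounded by each root ‖M ^ p‖ ^ (1 / p), which is continuous
in M. -/
theorem continuous_matrixSpectralRadius :
    Continuous (matrixSpectralRadius : Matrix X X ℂ → ℝ) := by
  refine continuous_iff_continuousAt.2 fun M => tendsto_order.2 ⟨fun a ha => ?_, fun a ha => ?_⟩
  · obtain ⟨z, hz, hzr⟩ := exists_norm_eq_matrixSpectralRadius M
    have h0 : M.charpoly.eval z = 0 := Matrix.mem_spectrum_iff_isRoot_charpoly.1 hz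
    have hcont : Continuous fun M' : Matrix X X ℂ => ‖M'.charpoly.eval z‖ := by
      simp only [Matrix.eval_charpoly]
      exact (Continuous.matrix_det (continuous_const.sub continuous_id)).norm
    have hpos : 0 < (‖z‖ - a) ^ Fintype.card X := pow_pos (by rw [hzr]; exact sub_pos.2 ha) _
    have hlt : ‖M.charpoly.eval z‖ < (‖z‖ - a) ^ Fintype.card X := by
      rwa [h0, norm_zero]
    filter_upwards [hcont.continuousAt.eventually (gt_mem_nhds hlt)] with M' hM'
    by_contra hle
    exact absurd (pow_le_norm_eval_charpoly M' (not_lt.1 hle) (hzr ▸ ha.le)) (not_le.2 hM')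
  · obtain ⟨p, hp, hp1⟩ := (((tendsto_norm_pow_matrixSpectralRadius M).eventually
      (gt_mem_nhds ha)).and (eventually_ge_atTop 1)).exists
    obtain ⟨q, rfl⟩ := Nat.exists_eq_add_of_le' hp1
    have hcont : Continuous fun M' : Matrix X X ℂ =>
        ‖M' ^ (q + 1)‖ ^ (1 / ((q + 1 : ℕ) : ℝ)) :=
      (continuous_pow (q + 1)).norm.rpow_const fun _ => Or.inr (by positivity)
    filter_upwards [hcont.continuousAt.eventually (gt_mem_nhds hp)] with M' hM'
    exact (matrixSpectralRadius_le_norm_pow M' q).trans_lt hM'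

theorem tendsto_sum_norm_pow (M : Matrix X X ℂ) :
    Tendsto (fun p : ℕ => (∑ i, ∑ j, ‖(M ^ p) i j‖) ^ (1 / (p : ℝ))) atTop
      (𝓝 (matrixSpectralRadius M)) := by
  have hrow : ∀ (A : Matrix X X ℂ) (i : X), ∑ j, ‖A i j‖ ≤ ‖A‖ := fun A i => by
    rw [Matrix.linfty_opNorm_def]
    have h := Finset.le_sup (f := fun i => ∑ j, ‖A i j‖₊) (Finset.mem_univ i)
    have h2 := NNReal.coe_le_coe.2 h
    push_cast at h2
    exact h2
  have hle : ∀ A : Matrix X X ℂ, ‖A‖ ≤ ∑ i, ∑ j, ‖A i j‖ := fun A => by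
    rw [Matrix.linfty_opNorm_def]
    have h : (Finset.univ.sup fun i => ∑ j, ‖A i j‖₊) ≤ ∑ i, ∑ j, ‖A i j‖₊ :=
      Finset.sup_le fun i _ => Finset.single_le_sum (f := fun i => ∑ j, ‖A i j‖₊)
        (fun _ _ => zero_le) (Finset.mem_univ i)
    have h2 := NNReal.coe_le_coe.2 h
    push_cast at h2
    exact h2
  refine tendsto_rpow_one_div_of_comparable one_pos (C := Fintype.card X)
    (by exact_mod_cast Fintype.card_pos) (fun p => norm_nonneg (M ^ p))
    (Eventually.of_forall fun p => by rw [one_mul]; exact hle _)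
    (Eventually.of_forall fun p => ?_) (tendsto_norm_pow_matrixSpectralRadius M)
  calc ∑ i, ∑ j, ‖(M ^ p) i j‖ ≤ ∑ _i : X, ‖M ^ p‖ := Finset.sum_le_sum fun i _ => hrow _ i
    _ = _ := by rw [Finset.sum_const, Finset.card_univ, nsmul_eq_mul]

end SpectralRadius

/-! ### Growth of the minors of the powers of a matrix. -/

section Minors

/-- The exponent 0 is excluded: rows and columns run over all index maps, so the identity is sent to
an antisymmetrizing projection, in general not to the identity. -/
theorem minorMatrix_pow {𝕜 J ι : Type*} [Field 𝕜] [CharZero 𝕜] [Fintype ι] [DecidableEq ι]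
    [Fintype J] [DecidableEq J] (A : Matrix J J 𝕜) {p : ℕ} (hp : 1 ≤ p) :
    minorMatrix ι (A ^ p) = minorMatrix ι A ^ p := by
  induction p, hp using Nat.le_induction with
  | base => simp
  | succ p _ ih => rw [pow_succ, minorMatrix_mul, ih, pow_succ]

theorem continuous_minorMatrix {J ι : Type*} [Fintype ι] [DecidableEq ι] :
    Continuous (minorMatrix ι : Matrix J J ℝ → Matrix (ι → J) (ι → J) ℝ) :=
  continuous_matrix fun _ _ =>
    (Continuous.matrix_det (continuous_id.matrix_submatrix _ _)).div_const _

/-- The exponential growth rate of the minors of the powers of a matrix. -/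
noncomputable def minorGrowth (σ : Type*) [Fintype σ] [DecidableEq σ] {J : Type*} [Fintype J]
    [DecidableEq J] (A : Matrix J J ℝ) : ℝ :=
  matrixSpectralRadius ((minorMatrix σ A).map ((↑) : ℝ → ℂ))

variable {σ J : Type*} [Fintype σ] [DecidableEq σ] [Fintype J] [DecidableEq J] [Nonempty (σ → J)]

theorem continuous_minorGrowth : Continuous (minorGrowth σ : Matrix J J ℝ → ℝ) :=
  continuous_matrixSpectralRadius.comp
    (continuous_minorMatrix.matrix_map Complex.continuous_ofReal)

/-- For p ≥ 1 the minors of A ^ p are, up to the factorial, the entries of the p-th power of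
`minorMatrix`. Complex entries are needed because the spectral radius in Gelfand's formula counts
complex eigenvalues. -/
theorem tendsto_minorSum_pow (A : Matrix J J ℝ) :
    Tendsto (fun p : ℕ => minorSum σ (A ^ p) ^ (1 / (p : ℝ))) atTop (𝓝 (minorGrowth σ A)) := by
  have h0 : (0 : ℝ) < (Nat.factorial (Fintype.card σ) : ℝ) := by exact_mod_cast Nat.factorial_pos _
  have hpow : ∀ p : ℕ, 1 ≤ p → ((minorMatrix σ A).map ((↑) : ℝ → ℂ)) ^ p =
      (minorMatrix σ (A ^ p)).map ((↑) : ℝ → ℂ) := fun p hp => by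
    rw [minorMatrix_pow A hp]
    exact (map_pow (Complex.ofRealHom.mapMatrix) (minorMatrix σ A) p).symm
  have heq : ∀ p : ℕ, 1 ≤ p → minorSum σ (A ^ p) = (Nat.factorial (Fintype.card σ) : ℝ) *
      ∑ f, ∑ g, ‖(((minorMatrix σ A).map ((↑) : ℝ → ℂ)) ^ p) f g‖ := fun p hp => by
    rw [hpow p hp, minorSum, Finset.mul_sum]
    refine Finset.sum_congr rfl fun f _ => ?_
    rw [Finset.mul_sum]
    refine Finset.sum_congr rfl fun g _ => ?_
    rw [Matrix.map_apply, Complex.norm_real, minorMatrix, Matrix.of_apply, norm_div,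
      Real.norm_of_nonneg h0.le, mul_div_cancel₀ _ h0.ne', Real.norm_eq_abs]
  refine tendsto_rpow_one_div_of_comparable h0 h0 (fun p => by positivity) ?_ ?_
    (tendsto_sum_norm_pow ((minorMatrix σ A).map ((↑) : ℝ → ℂ)))
  · filter_upwards [eventually_ge_atTop 1] with p hp using (heq p hp).ge
  · filter_upwards [eventually_ge_atTop 1] with p hp using (heq p hp).le

end Minors

/-! ### Degrees, dynamical degrees and the conclusion. -/

section Degree

variable {E : Type*} [NormedAddCommGroup E] [InnerProductSpace ℝ E] [FiniteDimensional ℝ E]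
  [MeasurableSpace E] [BorelSpace E] {k : ℕ}

/-- The convolution of valuations of complementary degrees is comparable to the value of the first
one at the unit ball, if the second one is strictly positive. -/
theorem exists_convolution_comparable (hk : k ≤ finrank ℝ E) {φ : ConvexBody E → ℝ}
    (hφ : StrictlyPPositive k φ) : ∃ c C : ℝ, 0 < c ∧ 0 < C ∧
      ∀ ψ ∈ PCone E (finrank ℝ E - k),
        c * ψ (unitBall E) ≤ convolution (finrank ℝ E - k) k ψ φ (unitBall E) ∧
        convolution (finrank ℝ E - k) k ψ φ (unitBall E) ≤ C * ψ (unitBall E) := by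
  obtain ⟨hφP, ε, hε, hlow⟩ := hφ
  have hν := hφP.choose_spec
  set ν := hφP.choose
  obtain ⟨C, hC, hup⟩ := hν.exists_polarization_le hk
  set c₀ : ℝ := (Nat.factorial (finrank ℝ E - k) : ℝ) * (Nat.factorial k : ℝ) /
    (Nat.factorial (finrank ℝ E) : ℝ) with hc₀
  have hc₀pos : 0 < c₀ := div_pos (mul_pos (Nat.cast_pos.2 (Nat.factorial_pos _))
    (Nat.cast_pos.2 (Nat.factorial_pos _))) (Nat.cast_pos.2 (Nat.factorial_pos _))
  refine ⟨c₀ * ε, c₀ * C, by positivity, by positivity, fun ψ hψ => ?_⟩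
  have hμ := hψ.choose_spec
  have hconv : convolution (finrank ℝ E - k) k ψ φ (unitBall E) =
      c₀ * ∫ A, ∫ B, mixedVolume (Sum.elim
        (fun _ : Fin (finrank ℝ E - k + k - finrank ℝ E) => unitBall E) (Sum.elim A B))
          ∂ν ∂hψ.choose := by
    rw [convolution, dif_pos ⟨hψ, hφP⟩]
  set μ := hψ.choose
  -- The arguments A of a measure representing ψ are indexed by n - (n - k), equal but not
  -- definitionally to k. The slots for D in the convolution form an empty type, so its value at the
  -- ball is just the number ψ * φ.
  let e : Fin k ≃ Fin (finrank ℝ E - (finrank ℝ E - k)) := finCongr (by omega)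
  have hempty : IsEmpty (Fin (finrank ℝ E - k + k - finrank ℝ E)) :=
    ⟨fun x => absurd x.2 (by omega)⟩
  have h := card_fin_add_card_fin_sub hk
  have hinner : ∀ A : Fin (finrank ℝ E - (finrank ℝ E - k)) → ConvexBody E,
      ∫ B, mixedVolume (Sum.elim
        (fun _ : Fin (finrank ℝ E - k + k - finrank ℝ E) => unitBall E) (Sum.elim A B)) ∂ν =
        polarization φ fun j => A (e j) := by
    intro A
    rw [hν.polarization_eq_integral hk]
    refine integral_congr_ae (Eventually.of_forall fun B => ?_)
    change _ = mixedVolume (Sum.elim (fun j => A (e j)) fun j => B (Equiv.refl _ j))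
    have key : mixedVolume (Sum.elim A B) = mixedVolume (Sum.elim
        (fun _ : Fin (finrank ℝ E - k + k - finrank ℝ E) => unitBall E) (Sum.elim A B)) :=
      mixedVolume_comp_equiv (by simp only [Fintype.card_sum, Fintype.card_fin]; omega)
        (Equiv.emptySum (Fin (finrank ℝ E - k + k - finrank ℝ E))
          (Fin (finrank ℝ E - (finrank ℝ E - k)) ⊕ Fin (finrank ℝ E - k))).symm
        (Sum.elim (fun _ => unitBall E) (Sum.elim A B))
    exact key.symm.trans (mixedVolume_elim_comp_equiv h e (Equiv.refl _) A B).symm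
  have hball : ∀ A : Fin (finrank ℝ E - (finrank ℝ E - k)) → ConvexBody E,
      mixedVolume (Sum.elim (fun _ : Fin (finrank ℝ E - k) => unitBall E) fun j => A (e j)) =
      mixedVolume (Sum.elim (fun _ : Fin (finrank ℝ E - k) => unitBall E) A) := fun A =>
    mixedVolume_elim_comp_equiv (by rw [add_comm, h]) (Equiv.refl _) e (fun _ => unitBall E) A
  have hcont : Continuous fun A : Fin (finrank ℝ E - (finrank ℝ E - k)) → ConvexBody E =>
      polarization φ fun j => A (e j) :=
    (hν.continuous_polarization hk).comp (continuous_pi fun j => continuous_apply (e j))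
  have hlow' : ∀ A : Fin (finrank ℝ E - (finrank ℝ E - k)) → ConvexBody E,
      ε * mixedVolume (Sum.elim (fun _ : Fin (finrank ℝ E - k) => unitBall E) A) ≤
        polarization φ fun j => A (e j) := fun A => hball A ▸ hlow fun j => A (e j)
  have hup' : ∀ A : Fin (finrank ℝ E - (finrank ℝ E - k)) → ConvexBody E,
      (polarization φ fun j => A (e j)) ≤
        C * mixedVolume (Sum.elim (fun _ : Fin (finrank ℝ E - k) => unitBall E) A) :=
    fun A => hball A ▸ hup fun j => A (e j)
  have hnn : ∀ A : Fin (finrank ℝ E - (finrank ℝ E - k)) → ConvexBody E,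
      0 ≤ mixedVolume (Sum.elim (fun _ : Fin (finrank ℝ E - k) => unitBall E) A) := fun A =>
    mixedVolume_nonneg (by simp only [Fintype.card_sum, Fintype.card_fin]; omega) _
  -- The two-sided bound makes the inner integral comparable to V(B[n-k], A), whose integral over A
  -- is ψ(B). The bounds hold for whichever representing measures were chosen.
  have hint : Integrable (fun A => polarization φ fun j => A (e j)) μ := by
    refine (hμ.integrable.const_mul C).mono' hcont.aestronglyMeasurable
      (Eventually.of_forall fun A => ?_)
    rw [Real.norm_of_nonneg ((mul_nonneg hε.le (hnn A)).trans (hlow' A))]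
    exact hup' A
  rw [hconv]
  simp only [hinner]
  have h1 := integral_mono (hμ.integrable.const_mul ε) hint hlow'
  have h2 := integral_mono hint (hμ.integrable.const_mul C) hup'
  rw [integral_const_mul] at h1 h2
  rw [mul_assoc, mul_assoc, hμ.eq_integral]
  exact ⟨mul_le_mul_of_nonneg_left h1 hc₀pos.le, mul_le_mul_of_nonneg_left h2 hc₀pos.le⟩

/-- Strict positivity is used twice: for φ it replaces the convolution by (g · ψ)(B), and for ψ it
replaces ψ(g⁻¹B) by a mixed volume. As g enters only through the body g⁻¹B, the constants do not
depend on it. -/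
theorem exists_degree_comparable (hk : k ≤ finrank ℝ E) {ψ φ : ConvexBody E → ℝ}
    (hψ : StrictlyPPositive (finrank ℝ E - k) ψ) (hφ : StrictlyPPositive k φ) :
    ∃ c C : ℝ, 0 < c ∧ 0 < C ∧ ∀ g : (E →L[ℝ] E)ˣ,
      c * mixedVolume (Sum.elim (fun _ : Fin (finrank ℝ E - k) => image (↑g⁻¹ : E →L[ℝ] E)
        (unitBall E)) fun _ : Fin k => unitBall E) ≤ degree k ψ φ g ∧
      degree k ψ φ g ≤ C * mixedVolume (Sum.elim (fun _ : Fin (finrank ℝ E - k) =>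
        image (↑g⁻¹ : E →L[ℝ] E) (unitBall E)) fun _ : Fin k => unitBall E) := by
  obtain ⟨c, C, hc, hC, hconv⟩ := exists_convolution_comparable hk hφ
  obtain ⟨⟨μ, hμ⟩, ε, hε, hlow⟩ := hψ
  have hk' : finrank ℝ E - k ≤ finrank ℝ E := Nat.sub_le _ _
  obtain ⟨C', hC', hup⟩ := hμ.exists_polarization_le hk'
  refine ⟨c * ε, C * C', by positivity, by positivity, fun g => ?_⟩
  have h1 := hconv (act g ψ) ⟨_, hμ.act hk' g⟩
  have h2 : act g ψ (unitBall E) =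
      polarization ψ fun _ : Fin (finrank ℝ E - k) => image (↑g⁻¹ : E →L[ℝ] E) (unitBall E) :=
    hμ.apply_eq_polarization hk' _
  have h3 : mixedVolume (Sum.elim (fun _ : Fin (finrank ℝ E - (finrank ℝ E - k)) => unitBall E)
      fun _ : Fin (finrank ℝ E - k) => image (↑g⁻¹ : E →L[ℝ] E) (unitBall E)) =
      mixedVolume (Sum.elim (fun _ : Fin (finrank ℝ E - k) => image (↑g⁻¹ : E →L[ℝ] E)
        (unitBall E)) fun _ : Fin k => unitBall E) := by
    rw [mixedVolume_elim_swap (by simp only [Fintype.card_fin]; omega)]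
    exact mixedVolume_elim_comp_equiv (by simp only [Fintype.card_fin]; omega) (Equiv.refl _)
      (finCongr (by omega : finrank ℝ E - (finrank ℝ E - k) = k))
      (fun _ => image (↑g⁻¹ : E →L[ℝ] E) (unitBall E)) fun _ => unitBall E
  have h4 := hlow fun _ => image (↑g⁻¹ : E →L[ℝ] E) (unitBall E)
  have h5 := hup fun _ => image (↑g⁻¹ : E →L[ℝ] E) (unitBall E)
  rw [h3, ← h2] at h4 h5
  rw [mul_assoc, mul_assoc]
  exact ⟨(mul_le_mul_of_nonneg_left h4 hc.le).trans h1.1,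
    h1.2.trans (mul_le_mul_of_nonneg_left h5 hC.le)⟩

theorem coordMatrix_pow {ι : Type*} [Fintype ι] [DecidableEq ι] (b : OrthonormalBasis ι ℝ E)
    (A : E →L[ℝ] E) (p : ℕ) :
    (coordMatrix b fun a => (A ^ p) (b a)) = (coordMatrix b fun a => A (b a)) ^ p := by
  -- The rows hold the images of the basis vectors, so this is the transpose of the usual matrix;
  -- transposition reverses products, which is harmless for powers.
  have h : ∀ B : E →L[ℝ] E, (coordMatrix b fun a => B (b a)) =
      (LinearMap.toMatrix b.toBasis b.toBasis (B : E →ₗ[ℝ] E)).transpose := fun B => by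
    ext i j
    simp [coordMatrix, LinearMap.toMatrix_apply, b.repr_apply_apply]
  rw [h, h]
  induction p with
  | zero => simp [LinearMap.toMatrix_one]
  | succ p ih =>
    rw [pow_succ' (Matrix.transpose _), ← ih, ← Matrix.transpose_mul,
      ← LinearMap.toMatrix_mul, pow_succ]
    rfl

/-- The limit of the degree sequence is the growth rate of the minors of order `n - k` of the
inverse. -/
theorem tendsto_degreeRoot (hk : k ≤ finrank ℝ E) {ψ φ : ConvexBody E → ℝ}
    (hψ : StrictlyPPositive (finrank ℝ E - k) ψ) (hφ : StrictlyPPositive k φ)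
    (b : OrthonormalBasis (Fin (finrank ℝ E - k) ⊕ Fin k) ℝ E) (g : (E →L[ℝ] E)ˣ) :
    Tendsto (degreeRoot k ψ φ g) atTop (𝓝 (minorGrowth (Fin (finrank ℝ E - k))
      (coordMatrix b fun a => (↑g⁻¹ : E →L[ℝ] E) (b a)))) := by
  have : Nonempty (Fin (finrank ℝ E - k) → Fin (finrank ℝ E - k) ⊕ Fin k) := ⟨Sum.inl⟩
  obtain ⟨c, C, hc, hC, hdeg⟩ := exists_degree_comparable hk hψ hφ
  obtain ⟨c', C', hc', hC', hvol⟩ := exists_mixedVolume_image_comparable b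
  have hpow : ∀ p : ℕ, (coordMatrix b fun a => (↑(g ^ p)⁻¹ : E →L[ℝ] E) (b a)) =
      (coordMatrix b fun a => (↑g⁻¹ : E →L[ℝ] E) (b a)) ^ p := fun p => by
    rw [← coordMatrix_pow, ← inv_pow, Units.val_pow_eq_pow_val]
  refine tendsto_rpow_one_div_of_comparable (mul_pos hc hc') (mul_pos hC hC')
    (fun p => ?_) (Eventually.of_forall fun p => ?_) (Eventually.of_forall fun p => ?_)
    (tendsto_minorSum_pow (coordMatrix b fun a => (↑g⁻¹ : E →L[ℝ] E) (b a)))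
  · unfold minorSum
    positivity
  · rw [← hpow, mul_assoc]
    exact (mul_le_mul_of_nonneg_left (hvol _).1 hc.le).trans (hdeg (g ^ p)).1
  · rw [← hpow, mul_assoc]
    exact (hdeg (g ^ p)).2.trans (mul_le_mul_of_nonneg_left (hvol _).2 hC.le)

end Degree

end ConvexValuation

theorem mainTheorem6 {E : Type*} [NormedAddCommGroup E] [InnerProductSpace ℝ E]
    [FiniteDimensional ℝ E] [MeasurableSpace E] [BorelSpace E]
    (k : ℕ) (hk : k ≤ Module.finrank ℝ E) :
    -- strictly positive valuations of the required degrees exist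
    (∃ ψ φ : ConvexBody E → ℝ,
      ConvexValuation.StrictlyPPositive (Module.finrank ℝ E - k) ψ ∧
        ConvexValuation.StrictlyPPositive k φ) ∧
    ∀ ψ φ : ConvexBody E → ℝ,
      ConvexValuation.StrictlyPPositive (Module.finrank ℝ E - k) ψ →
      ConvexValuation.StrictlyPPositive k φ →
      -- the limit that defines the dynamical degree exists
      (∀ g : (E →L[ℝ] E)ˣ, Tendsto (ConvexValuation.degreeRoot k ψ φ g) atTop
        (𝓝 (ConvexValuation.dynamicalDegree k ψ φ g))) ∧
      -- it does not depend on the choice of the two valuations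
      (∀ ψ' φ' : ConvexBody E → ℝ,
        ConvexValuation.StrictlyPPositive (Module.finrank ℝ E - k) ψ' →
        ConvexValuation.StrictlyPPositive k φ' →
        ConvexValuation.dynamicalDegree k ψ' φ' = ConvexValuation.dynamicalDegree k ψ φ) ∧
      -- it is a continuous function on the general linear group
      Continuous (ConvexValuation.dynamicalDegree k ψ φ) ∧
      ∀ (g : (E →L[ℝ] E)ˣ) (gl : ℕ → (E →L[ℝ] E)ˣ),
        Tendsto (fun l => (gl l : E →L[ℝ] E)) atTop (𝓝 (g : E →L[ℝ] E)) →
        Tendsto (fun l => ConvexValuation.dynamicalDegree k ψ φ (gl l)) atTop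
          (𝓝 (ConvexValuation.dynamicalDegree k ψ φ g)) := by
  open ConvexValuation in
  refine ⟨⟨_, _, strictlyPPositive_mixedVolume_unitBall (Nat.sub_le _ _),
    strictlyPPositive_mixedVolume_unitBall hk⟩, fun ψ φ hψ hφ => ?_⟩
  obtain ⟨b⟩ := exists_orthonormalBasis (E := E) (ι := Fin (finrank ℝ E - k) ⊕ Fin k)
    (by simp only [Fintype.card_sum, Fintype.card_fin]; omega)
  have : Nonempty (Fin (finrank ℝ E - k) → Fin (finrank ℝ E - k) ⊕ Fin k) := ⟨Sum.inl⟩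
  -- The limit is a formula in g alone, which gives independence of the valuations at once and
  -- reduces continuity to that of inversion and of `minorGrowth`.
  have hd : ∀ ψ φ : ConvexBody E → ℝ, StrictlyPPositive (finrank ℝ E - k) ψ →
      StrictlyPPositive k φ → dynamicalDegree k ψ φ = fun g : (E →L[ℝ] E)ˣ => minorGrowth
        (Fin (finrank ℝ E - k)) (coordMatrix b fun a => (↑g⁻¹ : E →L[ℝ] E) (b a)) :=
    fun ψ φ hψ hφ => funext fun g => (tendsto_degreeRoot hk hψ hφ b g).limUnder_eq
  have hcont : Continuous (dynamicalDegree k ψ φ) := by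
    rw [hd ψ φ hψ hφ]
    refine continuous_minorGrowth.comp (continuous_matrix fun i j => ?_)
    refine continuous_const.inner ?_
    exact (ContinuousLinearMap.apply ℝ E (b i)).continuous.comp
      (Units.continuous_val.comp continuous_inv)
  refine ⟨fun g => ?_, fun ψ' φ' hψ' hφ' => ?_, hcont, fun g gl hgl => ?_⟩
  · rw [hd ψ φ hψ hφ]
    exact tendsto_degreeRoot hk hψ hφ b g
  · rw [hd ψ φ hψ hφ, hd ψ' φ' hψ' hφ']
  -- The units of a complete normed ring carry the topology induced by the norm, so convergence as
  -- operators is convergence in the group.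
  · exact (hcont.tendsto g).comp (Units.isOpenEmbedding_val.isEmbedding.tendsto_nhds_iff.2 hgl)
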